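/- Let $d\ge 1$, $N\ge 0$. A local PT-symmetric free-fermion Hamiltonian is given by finitely many hopping matrices $T_r\in\mathbb C^{N\times N}$, $r\in\mathbb Z^d$, whose Bloch matrices $H_k=\sum_r e^{ik\cdot r}T_r$ satisfy $U\overline{H_k}=H_kU$ for all $k$ with a fixed unitary $U$. Its bands $E^\alpha_k$ ($\alpha=1,\dots,N$) are the eigenvalues of $H_k$ with multiplicity, labelled so as to be continuous and $2\pi$-periodic in $k$. *Phases.* The Hamiltonian is *gapped PT-unbroken* if all $E^\alpha_k$ are real and non-zero. It is *gapless PT-broken (with the exceptional ring as Fermi surface)* if: bands come in pairs $E^{N+1-\alpha}=-E^{\alpha}$ (an unpaired middle band is zero); all energies are real or purely imaginary; non-zero purely imaginary energies occur, and every band that takes such values also has a zero; and at each zero of a paired band, $(E^\alpha_k)^2$ is $C^1$ near that zero with non-vanishing gradient. Let $A_\alpha$ be the $(d-1)$-dimensional area of $\{k\in[-\pi,\pi)^d: E^\alpha_k=0\}$ (the number of points if $d=1$), $A_{FS}=\sum_{\alpha<N+1-\alpha}A_\alpha$ the sum over the $\lfloor N/2\rfloor$ pairs, and $$c_-(A)=\frac{2\min(\sqrt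 d,4)}{(2\pi)^{d+1}}\cdot\frac{A}{2},\qquad c_-=c_-(A_{FS}).$$ *Entropy.* On the periodic lattice with $\Lambda^d$ sites let $c^\dagger_{k\alpha}=\Lambda^{-d/2}\sum_j e^{ik\cdot j}c^\dagger_{j\alpha}$ create a fermion in the right eigenmode of band $\alpha$ and let $c_{k\alpha}$ annihilate with the corresponding left eigenmode. The ground states fill the modes with negative real energy: $|\psi^R\rangle=\prod_{\mathrm{Re}E^\alpha_k<0}c^\dagger_{k\alpha}|\mathrm{vac}\rangle$, $\langle\psi^L|=\langle\mathrm{vac}|\prod_{\mathrm{Re}E^\alpha_k<0}c_{k\alpha}$. Let $S_{\Lambda}(L)=-\mathrm{Tr}\,\rho_A\log\rho_A$ with $\rho_A=\mathrm{Tr}_{\bar A}|\psi^R\rangle\langle\psi^L|$, where $A$ consists of the modes $(j,\alpha)$ with $j$ in a cube of edge $L$. *Yang–Lee zeros.* $Z=\prod_{k,\alpha}(1+e^{-\beta E^\alpha_k})$ has a Yang–Lee zero at inverse temperature $\beta$ (in the thermodynamic limit) if $1+e^{-\beta E^\alpha_k}=0$ for some $k$ in the Brillouin zone and some $\alpha$;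 there are Yang–Lee zeros at absolute zero if this holds for all sufficiently large $\beta$. Then, for every family $(H^{(s)})_{s\in X}$ of such Hamiltonians, with bands, indexed by a topological space $X$: 1. If $H^{(s)}$ is gapless PT-broken, it has Yang–Lee zeros at absolute zero, $c_->0$, the limit $S_A(L)=\lim_{\Lambda\to\infty}S_\Lambda(L)$ exists and is real for all $L$, and $$S_A(L)>c_-L^{d-1}\log L\quad\text{for all sufficiently large }L,$$ which is at least logarithmic growth for $d=1$. Moreover, if $A_\alpha\ge A$ for each pair, then $S_A(L)>\lfloor N/2\rfloor\,c_-(A)\,L^{d-1}\log L$ for all sufficiently large $L$. 2. If $H^{(s)}$ is gapped PT-unbroken, it has no Yang–Lee zeros at any $\beta$, and an area law holds: there is $C$ with $|S_\Lambda(L)|\le C L^{d-1}$ whenever $1\le L\le\Lambda$. The area law also holds in the basis of the original orbitals $a,b$: if $\lambda_M$ are the eigenvalues of $\gamma_{ia,jb}=\delta_{ij}\delta_{ab}-2\langle\psi^L|c^\dagger_{ia}c_{jb}|\psi^R\rangle$ restricted to the cube, and $h(x)=-\frac{1+x}2\log\frac{1+x}2-\frac{1-x}2\log\frac{1-x}2$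 (principal logarithm, $0\log 0=0$), then $|\sum_M h(\lambda_M)|\le C'L^{d-1}$ whenever $1\le L\le \Lambda$. 3. Let $R\subseteq X$ be the set of parameters lying in one of the two phases. Within $R$, the parameters with Yang–Lee zeros at absolute zero are exactly those whose entropy violates the area law (where the area law means that, for some $C$ and every $L\ge1$, $|S_\Lambda(L)|\le CL^{d-1}$ for all sufficiently large $\Lambda$). Hence the edges of the Yang–Lee zero distribution (points of $X$ that are limits both of points of $R$ with and of points of $R$ without zeros) are exactly the entanglement transition points (limits both of points of $R$ violating and of points of $R$ obeying the area law). -/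

import Mathlib

namespace FreeFermion

/-! ## Local PT-symmetric Bloch Hamiltonians -/

/-- Momentum space `ℝ^d`; every function of the momentum below is `2π`-periodic. -/
abbrev Momentum (d : ℕ) := EuclideanSpace ℝ (Fin d)

/-- The phase `exp(i k·r)` for a momentum `k` and a lattice vector `r ∈ ℤ^d`. -/
noncomputable def phase {d : ℕ} (k : Momentum d) (r : Fin d → ℤ) : ℂ :=
  Complex.exp (Complex.I * ((∑ i, k i * (r i : ℝ) : ℝ) : ℂ))

/-- The Bloch Hamiltonian `H_k = ∑_r e^{i k·r} T_r` of the hopping amplitudes `T_r`. -/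
noncomputable def blochMatrix {d N : ℕ} (T : (Fin d → ℤ) →₀ Matrix (Fin N) (Fin N) ℂ)
    (k : Momentum d) : Matrix (Fin N) (Fin N) ℂ :=
  T.sum fun r t => phase k r • t

/-- A translation invariant quadratic fermion Hamiltonian on `ℤ^d` with `N` orbitals per site.
It is local (only finitely many hopping matrices are non-zero), it need not be Hermitian, and it is
PT-symmetric: `P` and `T` both reverse the momentum, so `PT` acts at each fixed `k` as an
antiunitary operator `U ∘ (complex conjugation)` which commutes with `H_k`. -/
structure LocalPTHamiltonian (d N : ℕ) where
  hopping : (Fin d → ℤ) →₀ Matrix (Fin N) (Fin N) ℂ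
  pt_symmetric : ∃ U ∈ Matrix.unitaryGroup (Fin N) ℂ, ∀ k : Momentum d,
    U * (blochMatrix hopping k).map (starRingEnd ℂ) = blochMatrix hopping k * U

noncomputable def LocalPTHamiltonian.bloch {d N : ℕ} (H : LocalPTHamiltonian d N)
    (k : Momentum d) : Matrix (Fin N) (Fin N) ℂ :=
  blochMatrix H.hopping k

/-- `E_k^α` are the energy bands of `H`: the eigenvalues of `H_k` with multiplicity, labelled by a
band index `α` in such a way that each band is a continuous periodic function of `k`. -/
structure IsBandStructure {d N : ℕ} (H : LocalPTHamiltonian d N)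
    (E : Fin N → Momentum d → ℂ) : Prop where
  continuous : ∀ α, Continuous (E α)
  periodic : ∀ α k i, E α (k + EuclideanSpace.single i (2 * Real.pi)) = E α k
  charpoly_eq : ∀ k, (H.bloch k).charpoly = ∏ α, (Polynomial.X - Polynomial.C (E α k))

/-! ## The two phases -/

/-- The gapped PT-unbroken phase: all energies are real, and none of them vanishes. -/
structure IsGappedUnbroken {d N : ℕ} (H : LocalPTHamiltonian d N)
    (E : Fin N → Momentum d → ℂ) : Prop where
  bands : IsBandStructure H E
  real : ∀ α k, (E α k).im = 0
  gapped : ∀ α k, E α k ≠ 0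

/-- The gapless PT-broken phase in which the Fermi surface is the exceptional ring. Energies come in
pairs `±E` (the bands `α` and `Fin.rev α`; for odd `N` the unpaired middle band is the zero band)
and are real or purely imaginary. Purely imaginary energies occur, and a band with purely imaginary
energies also reaches the exceptional points `E = 0` which surround them. At the zeros of a pair
of bands, `E²` vanishes to first order, i.e. `E ∝ (k - k_E)^{1/2}` across the ring. -/
structure IsGaplessBroken {d N : ℕ} (H : LocalPTHamiltonian d N)
    (E : Fin N → Momentum d → ℂ) : Prop where
  bands : IsBandStructure H E
  pairing : ∀ α k, E (Fin.rev α) k = -E α k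
  real_or_imaginary : ∀ α k, (E α k ^ 2).im = 0
  broken : ∃ α k, (E α k).re = 0 ∧ (E α k).im ≠ 0
  surrounded : ∀ α, (∃ k, (E α k).re = 0 ∧ (E α k).im ≠ 0) → ∃ k, E α k = 0
  square_root : ∀ α, Fin.rev α ≠ α → ∀ k, E α k = 0 →
    ContDiffAt ℝ 1 (fun q => (E α q ^ 2).re) k ∧ fderiv ℝ (fun q => (E α q ^ 2).re) k ≠ 0

/-! ## The Fermi surface -/

/-- The Brillouin zone `[-π, π)^d`. -/
def brillouinZone (d : ℕ) : Set (Momentum d) :=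
  {k | ∀ i, k i ∈ Set.Ico (-Real.pi) Real.pi}

open scoped MeasureTheory in
/-- The area of the exceptional ring `{E^α = 0}` of a band (and of its partner): the
`(d-1)`-dimensional surface measure, which is the number of points if `d = 1`. -/
noncomputable def ringArea {d N : ℕ} (E : Fin N → Momentum d → ℂ) (α : Fin N) : ℝ :=
  (μHE[d - 1] {k ∈ brillouinZone d | E α k = 0}).toReal

/-- The area of the Fermi surface: the exceptional rings of all `⌊N/2⌋` pairs `±E`. -/
noncomputable def fermiArea {d N : ℕ} (E : Fin N → Momentum d → ℂ) : ℝ :=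
  ∑ α with α < Fin.rev α, ringArea E α

/-- `c₋ = 2 √d s₋ / (2π)^{d+1}` with `s₋ = A/2`, where `√d` is capped at `4` if `d > 16`. -/
noncomputable def cMinus (d : ℕ) (A : ℝ) : ℝ :=
  2 * min (Real.sqrt d) 4 / (2 * Real.pi) ^ (d + 1) * (A / 2)

/-! ## Yang-Lee zeros -/

/-- The factor `∏_α (1 + e^{-β E_k^α})` of the partition function `Z = ∏_k ∏_α (1 + e^{-β E_k^α})`. -/
noncomputable def partitionFactor {d N : ℕ} (H : LocalPTHamiltonian d N) (β : ℝ)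
    (k : Momentum d) : ℂ :=
  ((H.bloch k).charpoly.roots.map fun z => 1 + Complex.exp (-(β : ℂ) * z)).prod

/-- A Yang-Lee zero at inverse temperature `β` in the thermodynamic limit, in which the momentum
runs over the whole Brillouin zone. -/
def HasYangLeeZero {d N : ℕ} (H : LocalPTHamiltonian d N) (β : ℝ) : Prop :=
  ∃ k ∈ brillouinZone d, partitionFactor H β k = 0

/-- Yang-Lee zeros at absolute zero: first the thermodynamic limit, then `β → ∞`. -/
def HasYangLeeZeroAtAbsoluteZero {d N : ℕ} (H : LocalPTHamiltonian d N) : Prop :=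
  ∀ᶠ β : ℝ in Filter.atTop, HasYangLeeZero H β

/-! ## Reduced density matrices and entanglement entropy -/

/-- The wave function `det (u_j (x_i)) / √n!` of the state `u_1^† ⋯ u_n^† |vac⟩` of `n` fermions with
modes in `M`. -/
noncomputable def slater {M : Type*} {n : ℕ} (u : Fin n → M → ℂ) (x : Fin n → M) : ℂ :=
  (Matrix.of fun i j : Fin n => u j (x i)).det / (Real.sqrt (n.factorial : ℝ) : ℂ)

/-- The configuration with the first `m` particles at `x`, in `A`, and the others at `z`, outside. -/
def joinConfig {M : Type*} (A : Finset M) {n : ℕ} (m : Fin (n + 1))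
    (x : Fin (m : ℕ) → {p // p ∈ A}) (z : Fin (n - (m : ℕ)) → {p // p ∉ A}) (i : Fin n) : M :=
  if h : (i : ℕ) < (m : ℕ) then (x ⟨i, h⟩ : M)
  else (z ⟨(i : ℕ) - (m : ℕ), by have := i.2; omega⟩ : M)

/-- The reduced density matrix `ρ_A = Tr_Ā |ψ^R⟩⟨ψ^L|` of the Slater states `ψ^R`, `ψ^L` with orbitals
`u`, `v`. It preserves the number `m` of fermions in `A`, and its `m`-particle block has the kernel
`ρ_A(x, y) = C(n, m) ∑_{z ∈ Ā^{n-m}} ψ^R(x, z) conj ψ^L(y, z)` for `x, y ∈ A^m`. (The block is written on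
all functions on `A^m`; it vanishes on the complement of the antisymmetric ones.) -/
noncomputable def reducedDensity {M : Type*} [Fintype M] [DecidableEq M] (A : Finset M) {n : ℕ}
    (u v : Fin n → M → ℂ) :
    Matrix (Σ m : Fin (n + 1), Fin (m : ℕ) → {p // p ∈ A})
      (Σ m : Fin (n + 1), Fin (m : ℕ) → {p // p ∈ A}) ℂ :=
  Matrix.blockDiagonal' fun m : Fin (n + 1) => Matrix.of fun x y =>
    (n.choose (m : ℕ) : ℂ) * ∑ z : Fin (n - (m : ℕ)) → {p // p ∉ A},
      slater u (joinConfig A m x z) * starRingEnd ℂ (slater v (joinConfig A m y z))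

/-- `-Tr (ρ log ρ) = -∑ z log z` over the eigenvalues `z` of `ρ` with multiplicity (`0 log 0 = 0`). -/
noncomputable def entropy {ι : Type*} [Fintype ι] [DecidableEq ι] (ρ : Matrix ι ι ℂ) : ℂ :=
  -(ρ.charpoly.roots.map fun z => z * Complex.log z).sum

/-- Modes on the torus with `Λ^d` sites: a site (or a momentum label) and a band (or an orbital). -/
abbrev Mode (d N Λ : ℕ) := (Fin d → Fin Λ) × Fin N

/-- The momentum `2π n / Λ`. -/
noncomputable def gridMomentum {d Λ : ℕ} (n : Fin d → Fin Λ) : Momentum d :=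
  WithLp.toLp 2 fun i => 2 * Real.pi * ((n i : ℕ) : ℝ) / (Λ : ℝ)

/-- The site `x` as a vector of `ℤ^d`. -/
def siteVector {d Λ : ℕ} (x : Fin d → Fin Λ) : Fin d → ℤ := fun i => ((x i : ℕ) : ℤ)

/-- The subsystem: all modes on the sites of a hypercube of edge length `L`. -/
def cube (d N Λ L : ℕ) : Finset (Mode d N Λ) :=
  Finset.univ.filter fun p => ∀ i, (p.1 i : ℕ) < L

/-- The wave function of the momentum-space band mode `q = (k, α)` over the lattice band modes
`(j, β)`: `c_{kα}^† = Λ^{-d/2} ∑_j e^{i k·j} c_{jα}^†`. -/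
noncomputable def bandOrbital {d N Λ : ℕ} (q p : Mode d N Λ) : ℂ :=
  if q.2 = p.2 then
    phase (gridMomentum q.1) (siteVector p.1) / (Real.sqrt ((Λ : ℝ) ^ d) : ℂ)
  else 0

open scoped Classical in
/-- The band modes with negative real part of the energy. -/
noncomputable def filledModes {d N : ℕ} (E : Fin N → Momentum d → ℂ) (Λ : ℕ) :
    Finset (Mode d N Λ) :=
  Finset.univ.filter fun q => (E q.2 (gridMomentum q.1)).re < 0

/-- The filled band orbitals, enumerated (the order does not affect `|ψ^R⟩⟨ψ^L|`). -/
noncomputable def groundOrbitals {d N : ℕ} (E : Fin N → Momentum d → ℂ) (Λ : ℕ)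
    (j : Fin (filledModes E Λ).card) : Mode d N Λ → ℂ :=
  bandOrbital ((filledModes E Λ).equivFin.symm j : Mode d N Λ)

/-- The entanglement entropy `S_A = -Tr (ρ_A log ρ_A)`, `ρ_A = Tr_Ā |ψ^R⟩⟨ψ^L|`, of the biorthogonal
ground state `|ψ^R⟩ = ∏_{Re E_k^α < 0} c_{kα}^† |vac⟩`, `⟨ψ^L| = ⟨vac| ∏_{Re E_k^α < 0} c_{kα}`. Here `c_{kα}^†`
and `c_{kα}` create the right and annihilate with the left eigenmode of band `α`; they obey the
canonical anticommutation relations, so both states are the Slater state of the filled band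
orbitals over the lattice band modes `c_{jα}`, and `A` is a cube of these. -/
noncomputable def groundEntropy {d N : ℕ} (E : Fin N → Momentum d → ℂ) (Λ L : ℕ) : ℂ :=
  entropy (reducedDensity (cube d N Λ L) (groundOrbitals E Λ) (groundOrbitals E Λ))

/-- The area law in the thermodynamic limit. -/
def ObeysAreaLaw {d N : ℕ} (E : Fin N → Momentum d → ℂ) : Prop :=
  ∃ C : ℝ, ∀ L : ℕ, 1 ≤ L → ∀ᶠ Λ : ℕ in Filter.atTop, ‖groundEntropy E Λ L‖ ≤ C * (L : ℝ) ^ (d - 1)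

/-! ## The ground state in the basis of the original orbitals -/

/-- `P` is the spectral projection of `K` onto the eigenvalues with negative real part, along the
other generalized eigenvectors. In general it is not orthogonal. -/
structure IsNegativeProjection {N : ℕ} (K P : Matrix (Fin N) (Fin N) ℂ) : Prop where
  idempotent : P * P = P
  range_eq : LinearMap.range (Matrix.toLin' P) =
    ⨆ z : {z : ℂ // z.re < 0}, Module.End.maxGenEigenspace (Matrix.toLin' K) (z : ℂ)
  ker_eq : LinearMap.ker (Matrix.toLin' P) =
    ⨆ z : {z : ℂ // 0 ≤ z.re}, Module.End.maxGenEigenspace (Matrix.toLin' K) (z : ℂ)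

/-- The correlation matrix `γ_{ia,jb} = δ_{ij} δ_{ab} - 2 ⟨ψ^L| c_{ia}^† c_{jb} |ψ^R⟩` of the cube for the
original orbitals `a, b`, where `⟨ψ^L| c_{ia}^† c_{jb} |ψ^R⟩ = Λ^{-d} ∑_k e^{-i k·i} e^{i k·j} P(k)_{ba}`. -/
noncomputable def orbitalCorrelation {d N : ℕ}
    (P : Momentum d → Matrix (Fin N) (Fin N) ℂ) (Λ L : ℕ) :
    Matrix {p // p ∈ cube d N Λ L} {p // p ∈ cube d N Λ L} ℂ :=
  Matrix.of fun p q => (if p = q then 1 else 0) - 2 * ((Λ : ℂ) ^ d)⁻¹ *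
    ∑ n : Fin d → Fin Λ,
      starRingEnd ℂ (phase (gridMomentum n) (siteVector p.1.1)) *
        phase (gridMomentum n) (siteVector q.1.1) * P (gridMomentum n) q.1.2 p.1.2

/-- `h(x) = -((1+x)/2) log ((1+x)/2) - ((1-x)/2) log ((1-x)/2)`. -/
noncomputable def entropyFunction (x : ℂ) : ℂ :=
  -((1 + x) / 2) * Complex.log ((1 + x) / 2) - ((1 - x) / 2) * Complex.log ((1 - x) / 2)

/-- The entropy `∑_M h(λ_M)` over the eigenvalues of the orbital correlation matrix of the cube. -/
noncomputable def orbitalEntropy {d N : ℕ}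
    (P : Momentum d → Matrix (Fin N) (Fin N) ℂ) (Λ L : ℕ) : ℂ :=
  ((orbitalCorrelation P Λ L).charpoly.roots.map entropyFunction).sum

/-! ## Phases and entanglement along a family of Hamiltonians -/

/-- The parameters which lie in one of the two phases. -/
def phaseSet {d N : ℕ} {X : Type*} (H : X → LocalPTHamiltonian d N)
    (E : X → Fin N → Momentum d → ℂ) : Set X :=
  {s | IsGaplessBroken (H s) (E s) ∨ IsGappedUnbroken (H s) (E s)}

/-- The parameters with Yang-Lee zeros at absolute zero. -/
def zeroSet {d N : ℕ} {X : Type*} (H : X → LocalPTHamiltonian d N) : Set X :=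
  {s | HasYangLeeZeroAtAbsoluteZero (H s)}

/-- The parameters at which the ground state violates the area law. -/
def violationSet {d N : ℕ} {X : Type*} (E : X → Fin N → Momentum d → ℂ) : Set X :=
  {s | ¬ ObeysAreaLaw (E s)}

/-- The points which are limits both of points of `R` inside `Y` and of points of `R` outside `Y`. -/
def transitionPoints {X : Type*} [TopologicalSpace X] (R Y : Set X) : Set X :=
  closure (R ∩ Y) ∩ closure (R \ Y)

end FreeFermion

set_option linter.unusedSectionVars false

/-! Filling a band means filling the plane waves with `Re E < 0`, so the correlation matrix of the
cube is block Toeplitz, one block per band, with the Fourier coefficients of the indicator of the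
filled region. The reduced density matrix of a Slater state is that of independent bits with
probabilities given by the eigenvalues of this matrix (`entropy_reducedDensity`), so the entropy is
a sum of binary entropies.

Gapless phase. On the finite torus the coefficients are Riemann sums; the boundary of the filled
region lies in the null set `E = 0` and the faces of the cell, so they converge, and so does the
entropy. Binary entropy is at least `(5/2) x (1 - x)`, so the entropy is at least 5/2 times the
particle number variance `Tr (C - C²)` (`limitEntropy_ge`). By Parseval the variance is at least
about `L^(d-1)` times a weighted sum of `|a_v|²` with weight `∑ᵢ min(|v_i|, M)`, where `M` is a
small multiple of `L`. This weight dominates a sum of `(1 - cos (m h v_i)) / m²`, and each cosine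
sum is the volume by which the filled region changes under translation by `m h` along an axis. For
small translations `t` these volumes add up, over the axes and the two bands of a pair, to at least
`(1 - η) A t` (`RegularZeros.shift_ge`). The sum over `m` becomes harmonic and yields the logarithm,
with constant `5 A / (2π)^(d+1)`. Since `c₋` has `min(√d, 4)` in place of 5, the strict inequality
follows. Yang-Lee zeros come from the intermediate value theorem for the real function `E²`, which
takes the value `-(π/β)²`.

Gapped phase. Real bands without zeros keep their sign, so every band is full or empty and the
entropy in band modes vanishes. In the orbital basis the correlation matrix is the compression to
the cube of the involution `G = 1 - 2P`. As `1 - 2P = K / √(K²)`, a power series with uniformly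
decaying terms approximates the symbol by trigonometric polynomials, and `G` decays exponentially
(`IsGappedUnbroken.exists_decay`). The compression `γ` need not be normal; Jensen's formula and a
determinant bound give the Weyl type estimate `sum_posLog_le`, which controls the eigenvalues of `1
- γ²` by its row sums. These are exponentially small away from the faces of the cube, and `|h(λ)| ≤
C √|1 - λ²|` turns this into the bound `L^(d-1)`.

Zeros and violation of the area law therefore both hold in one phase and both fail in the other, and
transition points depend only on the trace of a set on the phase set. -/

namespace FreeFermion

/-! ## Sums over the spectrum of a matrix -/

/-- The sum of `φ` over the eigenvalues of `M`, with multiplicity. -/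
noncomputable def spectralSum {ι : Type*} [Fintype ι] [DecidableEq ι] (φ : ℂ → ℂ)
    (M : Matrix ι ι ℂ) : ℂ :=
  (M.charpoly.roots.map φ).sum

section SpectralSum

variable {ι κ : Type*} [Fintype ι] [DecidableEq ι] [Fintype κ] [DecidableEq κ]

/-- The characteristic polynomials of `AB` and `BA` agree up to powers of `X`, so the spectra differ
only by zeros, to which `φ` gives no weight. -/
theorem spectralSum_mul_comm (φ : ℂ → ℂ) (h0 : φ 0 = 0) (A : Matrix ι κ ℂ) (B : Matrix κ ι ℂ) :
    spectralSum φ (A * B) = spectralSum φ (B * A) := by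
  have h := congrArg (fun p => (p.roots.map φ).sum) (Matrix.charpoly_mul_comm' A B)
  have hX : ∀ k : ℕ, (Polynomial.X : Polynomial ℂ) ^ k ≠ 0 := fun k =>
    pow_ne_zero _ Polynomial.X_ne_zero
  beta_reduce at h
  rw [Polynomial.roots_mul (mul_ne_zero (hX _) (Matrix.charpoly_monic _).ne_zero),
    Polynomial.roots_mul (mul_ne_zero (hX _) (Matrix.charpoly_monic _).ne_zero)] at h
  simpa [spectralSum, Polynomial.roots_X_pow, h0, Multiset.map_nsmul, Multiset.sum_nsmul] using h

theorem spectralSum_diagonal (φ : ℂ → ℂ) (d : ι → ℂ) :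
    spectralSum φ (Matrix.diagonal d) = ∑ i, φ (d i) := by
  have h : (∏ i, (Polynomial.X - Polynomial.C (d i))).roots = Finset.univ.val.map d := by
    rw [← Polynomial.roots_multiset_prod_X_sub_C (Finset.univ.val.map d), Multiset.map_map]
    rfl
  rw [spectralSum, Matrix.charpoly_diagonal, h, Multiset.map_map]
  rfl

theorem spectralSum_reindex (φ : ℂ → ℂ) (e : ι ≃ κ) (M : Matrix ι ι ℂ) :
    spectralSum φ (Matrix.reindex e e M) = spectralSum φ M := by
  rw [spectralSum, Matrix.charpoly_reindex, spectralSum]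

theorem spectralSum_of_isHermitian (φ : ℂ → ℂ) {M : Matrix ι ι ℂ} (hM : M.IsHermitian) :
    spectralSum φ M = ∑ i, φ (hM.eigenvalues i) := by
  rw [spectralSum, hM.roots_charpoly_eq_eigenvalues, Multiset.map_map]
  rfl

theorem entropy_eq_spectralSum (M : Matrix ι ι ℂ) :
    entropy M = spectralSum (fun z => -(z * Complex.log z)) M := by
  simp [entropy, spectralSum]

end SpectralSum

/-! ## Determinantal identities -/

section Determinants

variable {R : Type*} [CommRing R]

/-- Andréief's identity. -/
theorem sum_det_mul_det {m : ℕ} {P : Type*} [Fintype P] [DecidableEq P] (a b : Fin m → P → R) :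
    ∑ z : Fin m → P, (Matrix.of fun i j => a j (z i)).det * (Matrix.of fun i j => b j (z i)).det
      = (m.factorial : R) * (Matrix.of fun i j => ∑ p, a i p * b j p).det := by
  -- Every permutation in the Leibniz expansion of the first determinant contributes the same
  -- amount: permuting the points `z` by `σ` produces a second sign from the other determinant,
  -- which cancels the first.
  have key : ∀ σ : Equiv.Perm (Fin m),
      ∑ z : Fin m → P, ((Equiv.Perm.sign σ : ℤ) : R) * (∏ i, a i (z (σ i))) *
        (Matrix.of fun i j => b j (z i)).det
      = (Matrix.of fun i j => ∑ p, a i p * b j p).det := by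
    intro σ
    rw [← (Equiv.arrowCongr σ (Equiv.refl P)).sum_comp]
    have h2 : (Matrix.of fun i j => ∑ p, a i p * b j p).det =
        ∑ z : Fin m → P, (∏ i, a i (z i)) * (Matrix.of fun i j => b j (z i)).det := by
      have h3 := (Matrix.detRowAlternating (R := R) (n := Fin m)).toMultilinearMap.map_sum
        (fun i (p : P) j => a i p * b j p)
      have h4 : (Matrix.of fun i j => ∑ p, a i p * b j p) =
          fun i => ∑ p, (fun j => a i p * b j p) := by
        ext i j; simp
      rw [h4]
      refine Eq.trans h3 (Finset.sum_congr rfl fun z _ => ?_)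
      exact Matrix.det_mul_column (fun i => a i (z i)) (Matrix.of fun i j => b j (z i))
    rw [h2]
    refine Finset.sum_congr rfl fun z _ => ?_
    have h5 : (Matrix.of fun i j => b j ((Equiv.arrowCongr σ (Equiv.refl P)) z i)) =
        (Matrix.of fun i j => b j (z i)).submatrix σ.symm id := by
      ext i j; simp [Equiv.arrowCongr]
    rw [h5, Matrix.det_permute]
    have h6 : ((Equiv.Perm.sign σ : ℤ) : R) * ((Equiv.Perm.sign σ.symm : ℤ) : R) = 1 := by
      rw [Equiv.Perm.sign_symm, ← Int.cast_mul, ← Units.val_mul, Int.units_mul_self]; simp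
    have h7 : ∏ i, a i ((Equiv.arrowCongr σ (Equiv.refl P)) z (σ i)) = ∏ i, a i (z i) := by
      simp [Equiv.arrowCongr]
    rw [h7]
    linear_combination (∏ i, a i (z i)) * (Matrix.of fun i j => b j (z i)).det * h6
  have hexp : ∀ z : Fin m → P, (Matrix.of fun i j => a j (z i)).det =
      ∑ σ : Equiv.Perm (Fin m), ((Equiv.Perm.sign σ : ℤ) : R) * ∏ i, a i (z (σ i)) := by
    intro z
    rw [Matrix.det_apply']
    rfl
  simp_rw [hexp, Finset.sum_mul]
  rw [Finset.sum_comm]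
  simp_rw [key]
  simp [Fintype.card_perm]

variable {n m k : ℕ}

/-- A set of `m` out of `n` indices, with the remaining `k`, as a reordering of the indices. -/
def shuffle (h : n = m + k) (S : {S : Finset (Fin n) // S.card = m}) : Fin m ⊕ Fin k ≃ Fin n :=
  finSumEquivOfFinset S.2 (by rw [Finset.card_compl, S.2, Fintype.card_fin]; omega)

theorem shuffle_inl_mem (h : n = m + k) (S : {S : Finset (Fin n) // S.card = m}) (i : Fin m) :
    shuffle h S (Sum.inl i) ∈ S.1 := by
  simp [shuffle, finSumEquivOfFinset_inl]

theorem shuffle_inr_notMem (h : n = m + k) (S : {S : Finset (Fin n) // S.card = m}) (i : Fin k) :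
    shuffle h S (Sum.inr i) ∉ S.1 := by
  have := Finset.orderEmbOfFin_mem S.1ᶜ
    (by rw [Finset.card_compl, S.2, Fintype.card_fin]; omega : S.1ᶜ.card = k) i
  rw [Finset.mem_compl] at this
  rwa [shuffle, finSumEquivOfFinset_inr]

theorem mem_iff_shuffle (h : n = m + k) (S : {S : Finset (Fin n) // S.card = m}) (j : Fin n) :
    j ∈ S.1 ↔ ∃ i, shuffle h S (Sum.inl i) = j := by
  constructor
  · intro hj
    rcases hx : (shuffle h S).symm j with i | i
    · exact ⟨i, by rw [← hx]; simp⟩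
    · exact absurd hj (by have := shuffle_inr_notMem h S i; rwa [← hx, Equiv.apply_symm_apply] at this)
  · rintro ⟨i, rfl⟩
    exact shuffle_inl_mem h S i

/-- A permutation is an image of the first block together with an ordering of each block.
Injectivity is direct, and surjectivity follows from `n! = C(n,m) m! k!`. -/
theorem shuffle_bijective (h : n = m + k) (e : Fin m ⊕ Fin k ≃ Fin n) :
    Function.Bijective fun t : {S : Finset (Fin n) // S.card = m} ×
      (Equiv.Perm (Fin m) × Equiv.Perm (Fin k)) =>
        (e.symm.trans ((Equiv.sumCongr t.2.1 t.2.2).trans (shuffle h t.1)) :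
          Equiv.Perm (Fin n)) := by
  rw [Fintype.bijective_iff_injective_and_card]
  constructor
  · rintro ⟨S, π, ρ⟩ ⟨S', π', ρ'⟩ hst
    have hst' : ∀ x, shuffle h S (Sum.map π ρ x) = shuffle h S' (Sum.map π' ρ' x) := by
      intro x
      have := congrArg (fun f : Equiv.Perm (Fin n) => f (e x)) hst
      simpa using this
    have hS : S = S' := by
      apply Subtype.ext
      ext j
      rw [mem_iff_shuffle h S, mem_iff_shuffle h S']
      constructor
      · rintro ⟨i, rfl⟩
        refine ⟨π' (π.symm i), ?_⟩
        have := hst' (Sum.inl (π.symm i))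
        simpa using this.symm
      · rintro ⟨i, rfl⟩
        refine ⟨π (π'.symm i), ?_⟩
        have := hst' (Sum.inl (π'.symm i))
        simpa using this
    subst hS
    have h2 : ∀ x, Sum.map π ρ x = Sum.map π' ρ' x := fun x => (shuffle h S).injective (hst' x)
    have hπ : π = π' := by
      ext i; have := h2 (Sum.inl i); simp at this; rw [this]
    have hρ : ρ = ρ' := by
      ext i; have := h2 (Sum.inr i); simp at this; rw [this]
    rw [hπ, hρ]
  · rw [Fintype.card_prod, Fintype.card_prod, Fintype.card_perm, Fintype.card_perm,
      Fintype.card_perm, Fintype.card_finset_len]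
    simp only [Fintype.card_fin]
    have := Nat.choose_mul_factorial_mul_factorial (show m ≤ n by omega)
    rw [show n - m = k by omega] at this
    rw [← mul_assoc, this]

/-- Laplace expansion along the first `m` rows of a reordered matrix. -/
theorem det_eq_sum_shuffle (h : n = m + k) (e : Fin m ⊕ Fin k ≃ Fin n)
    (M : Matrix (Fin n) (Fin n) R) :
    M.det = ∑ S : {S : Finset (Fin n) // S.card = m},
      ((Equiv.Perm.sign (e.symm.trans (shuffle h S)) : ℤ) : R) *
        ((Matrix.of fun i j => M (e (Sum.inl i)) (shuffle h S (Sum.inl j))).det *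
        (Matrix.of fun i j => M (e (Sum.inr i)) (shuffle h S (Sum.inr j))).det) := by
  rw [← Matrix.det_transpose, Matrix.det_apply',
    ← (shuffle_bijective h e).sum_comp (fun σ : Equiv.Perm (Fin n) =>
      ((Equiv.Perm.sign σ : ℤ) : R) * ∏ i, M.transpose (σ i) i), Fintype.sum_prod_type]
  refine Finset.sum_congr rfl fun S _ => ?_
  rw [← Matrix.det_transpose (Matrix.of fun i j => M (e (Sum.inl i)) (shuffle h S (Sum.inl j))),
    ← Matrix.det_transpose (Matrix.of fun i j => M (e (Sum.inr i)) (shuffle h S (Sum.inr j))),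
    Matrix.det_apply', Matrix.det_apply', Finset.sum_mul_sum, Finset.mul_sum,
    Fintype.sum_prod_type]
  refine Finset.sum_congr rfl fun π _ => ?_
  rw [Finset.mul_sum]
  refine Finset.sum_congr rfl fun ρ _ => ?_
  have hs : Equiv.Perm.sign (e.symm.trans ((Equiv.sumCongr π ρ).trans (shuffle h S)) :
        Equiv.Perm (Fin n)) =
      Equiv.Perm.sign (e.symm.trans (shuffle h S)) *
        (Equiv.Perm.sign π * Equiv.Perm.sign ρ) := by
    have h1 : (e.symm.trans ((Equiv.sumCongr π ρ).trans (shuffle h S)) : Equiv.Perm (Fin n)) =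
        (e.symm.trans (shuffle h S) : Equiv.Perm (Fin n)) *
          ((e.symm.trans (Equiv.Perm.sumCongr π ρ)).trans e) := by
      ext x; simp [Equiv.Perm.mul_apply]
    rw [h1, Equiv.Perm.sign_mul, Equiv.Perm.sign_symm_trans_trans, Equiv.Perm.sign_sumCongr]
  have hp : ∏ i, M.transpose
        ((e.symm.trans ((Equiv.sumCongr π ρ).trans (shuffle h S)) : Equiv.Perm (Fin n)) i) i =
      (∏ i, M (e (Sum.inl i)) (shuffle h S (Sum.inl (π i)))) *
        ∏ i, M (e (Sum.inr i)) (shuffle h S (Sum.inr (ρ i))) := by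
    rw [← e.prod_comp, Fintype.prod_sum_type]
    simp
  simp only [hs, hp]
  simp only [Matrix.transpose_apply, Matrix.of_apply, Units.val_mul, Int.cast_mul]
  ring

end Determinants

/-! ## Entropy of a product distribution -/

/-- Shannon entropy is additive for independent bits; adding one bit uses the product rule for `-x
log x` and the fact that the probabilities of the remaining bits sum to 1. -/
theorem sum_negMulLog_powerset {ι : Type*} [DecidableEq ι] (s : Finset ι) (ν : ι → ℝ) :
    ∑ S ∈ s.powerset, Real.negMulLog ((∏ j ∈ S, ν j) * ∏ j ∈ s \ S, (1 - ν j)) =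
      ∑ j ∈ s, Real.binEntropy (ν j) := by
  induction s using Finset.induction_on with
  | empty => simp
  | insert a s ha ih =>
    have hone : ∑ S ∈ s.powerset, (∏ j ∈ S, ν j) * ∏ j ∈ s \ S, (1 - ν j) = 1 := by
      rw [← Finset.prod_add]; simp
    rw [Finset.sum_powerset_insert ha, Finset.sum_insert ha, ← ih]
    have h1 : ∀ S ∈ s.powerset, Real.negMulLog ((∏ j ∈ S, ν j) * ∏ j ∈ insert a s \ S, (1 - ν j))
        = (1 - ν a) * Real.negMulLog ((∏ j ∈ S, ν j) * ∏ j ∈ s \ S, (1 - ν j)) +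
          ((∏ j ∈ S, ν j) * ∏ j ∈ s \ S, (1 - ν j)) * Real.negMulLog (1 - ν a) := by
      intro S hS
      have haS : a ∉ S := fun h => ha (Finset.mem_powerset.mp hS h)
      rw [Finset.insert_sdiff_of_notMem _ haS, Finset.prod_insert (by simp [ha]),
        show (∏ j ∈ S, ν j) * ((1 - ν a) * ∏ j ∈ s \ S, (1 - ν j)) =
          ((∏ j ∈ S, ν j) * ∏ j ∈ s \ S, (1 - ν j)) * (1 - ν a) by ring, Real.negMulLog_mul]
    have h2 : ∀ S ∈ s.powerset,
        Real.negMulLog ((∏ j ∈ insert a S, ν j) * ∏ j ∈ insert a s \ insert a S, (1 - ν j))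
        = ν a * Real.negMulLog ((∏ j ∈ S, ν j) * ∏ j ∈ s \ S, (1 - ν j)) +
          ((∏ j ∈ S, ν j) * ∏ j ∈ s \ S, (1 - ν j)) * Real.negMulLog (ν a) := by
      intro S hS
      have haS : a ∉ S := fun h => ha (Finset.mem_powerset.mp hS h)
      have h3 : insert a s \ insert a S = s \ S := by
        ext x
        simp only [Finset.mem_sdiff, Finset.mem_insert]
        constructor
        · tauto
        · rintro ⟨hx, hx'⟩
          exact ⟨Or.inr hx, fun h => h.elim (fun h => ha (h ▸ hx)) hx'⟩
      rw [Finset.prod_insert haS, h3,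
        show (ν a * ∏ j ∈ S, ν j) * ∏ j ∈ s \ S, (1 - ν j) =
          ((∏ j ∈ S, ν j) * ∏ j ∈ s \ S, (1 - ν j)) * ν a by ring, Real.negMulLog_mul]
    rw [Finset.sum_congr rfl h1, Finset.sum_congr rfl h2, Finset.sum_add_distrib,
      Finset.sum_add_distrib, ← Finset.mul_sum, ← Finset.mul_sum, ← Finset.sum_mul,
      ← Finset.sum_mul, hone, Real.binEntropy_eq_negMulLog_add_negMulLog_one_sub]
    ring

end FreeFermion

namespace FreeFermion

/-! ## The entropy of a reduced Slater state -/

section Peschel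

open Matrix

theorem slater_rotate {M : Type*} {n : ℕ} (U : Matrix (Fin n) (Fin n) ℂ) (u : Fin n → M → ℂ)
    (x : Fin n → M) :
    slater (fun j p => ∑ i, U i j * u i p) x = U.det * slater u x := by
  have h : (Matrix.of fun i j : Fin n => ∑ k, U k j * u k (x i)) =
      (Matrix.of fun i j : Fin n => u j (x i)) * U := by
    ext i j
    simp [Matrix.mul_apply, mul_comm]
  rw [slater, h, Matrix.det_mul, slater]
  ring

/-- Mixing the filled orbitals multiplies the Slater state by the phase `det U`, which cancels
between ket and bra. This frees the choice of an orbital basis adapted to `A`. -/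
theorem reducedDensity_rotate {M : Type*} [Fintype M] [DecidableEq M] (A : Finset M) {n : ℕ}
    {U : Matrix (Fin n) (Fin n) ℂ} (hU : U ∈ Matrix.unitaryGroup (Fin n) ℂ) (u : Fin n → M → ℂ) :
    reducedDensity A (fun j p => ∑ i, U i j * u i p) (fun j p => ∑ i, U i j * u i p) =
      reducedDensity A u u := by
  have hdet : U.det * (starRingEnd ℂ) U.det = 1 := by
    have h := congrArg Matrix.det (Matrix.mem_unitaryGroup_iff.mp hU)
    rwa [Matrix.det_mul, Matrix.star_eq_conjTranspose, Matrix.det_conjTranspose,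
      Matrix.det_one] at h
  unfold reducedDensity
  congr 1
  funext m
  ext x y
  simp only [Matrix.of_apply, slater_rotate, map_mul]
  congr 1
  refine Finset.sum_congr rfl fun z _ => ?_
  linear_combination (slater u (joinConfig A m x z) *
    (starRingEnd ℂ) (slater u (joinConfig A m y z))) * hdet

/-- Overlaps of Slater determinants of pairwise orthogonal orbitals. -/
theorem sum_det_mul_conj_det {n k : ℕ} {P : Type*} [Fintype P] (w : Fin n → P → ℂ) (c : Fin n → ℂ)
    (hw : ∀ i j, ∑ p, w i p * starRingEnd ℂ (w j p) = if i = j then c i else 0)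
    (s t : Fin k → Fin n) :
    ∑ z : Fin k → P, (Matrix.of fun i j => w (s j) (z i)).det *
        starRingEnd ℂ (Matrix.of fun i j => w (t j) (z i)).det =
      (k.factorial : ℂ) * (Matrix.of fun i j => if s i = t j then c (s i) else 0).det := by
  classical
  have h := sum_det_mul_det (fun j p => w (s j) p) (fun j p => starRingEnd ℂ (w (t j) p))
  simp only [hw] at h
  rw [← h]
  refine Finset.sum_congr rfl fun z _ => ?_
  rw [RingHom.map_det]
  rfl

theorem det_ite_self {n k : ℕ} (c : Fin n → ℂ) {s : Fin k → Fin n} (hs : Function.Injective s) :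
    (Matrix.of fun i j => if s i = s j then c (s i) else 0).det = ∏ i, c (s i) := by
  rw [← Matrix.det_diagonal]
  congr 1
  ext i j
  by_cases h : i = j
  · subst h; simp
  · simp [h, hs.ne h]

theorem det_ite_of_notMem {n k : ℕ} (c : Fin n → ℂ) {s t : Fin k → Fin n} (i : Fin k)
    (hi : ∀ j, s i ≠ t j) : (Matrix.of fun i j => if s i = t j then c (s i) else 0).det = 0 :=
  Matrix.det_eq_zero_of_row_eq_zero i fun j => by simp [hi j]

variable {n m k : ℕ}

theorem prod_shuffle_inl (h : n = m + k) (S : {S : Finset (Fin n) // S.card = m}) (c : Fin n → ℂ) :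
    ∏ i, c (shuffle h S (Sum.inl i)) = ∏ j ∈ S.1, c j := by
  rw [← Finset.prod_image (f := c) (g := fun i => shuffle h S (Sum.inl i)) (s := Finset.univ)]
  · congr 1
    ext j
    simp [mem_iff_shuffle h S j]
  · intro a _ b _ hab
    simpa using hab

theorem prod_shuffle_inr (h : n = m + k) (S : {S : Finset (Fin n) // S.card = m}) (c : Fin n → ℂ) :
    ∏ i, c (shuffle h S (Sum.inr i)) = ∏ j ∈ S.1ᶜ, c j := by
  rw [← Finset.prod_image (f := c) (g := fun i => shuffle h S (Sum.inr i)) (s := Finset.univ)]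
  · congr 1
    ext j
    simp only [Finset.mem_image, Finset.mem_univ, true_and, Finset.mem_compl]
    constructor
    · rintro ⟨i, rfl⟩
      exact shuffle_inr_notMem h S i
    · intro hj
      rcases hx : (shuffle h S).symm j with i | i
      · exact absurd (by rw [← Equiv.apply_symm_apply (shuffle h S) j, hx]
                         exact shuffle_inl_mem h S i) hj
      · exact ⟨i, by rw [← hx]; simp⟩
  · intro a _ b _ hab
    simpa using hab

variable {P : Type*} [Fintype P] (w : Fin n → P → ℂ) (c : Fin n → ℂ)

/-- Two different sets of equal size each contain an orbital missing from the other, so the overlap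
matrix has a zero row; for equal sets it is diagonal. -/
theorem sum_shuffle_inl (hw : ∀ i j, ∑ p, w i p * starRingEnd ℂ (w j p) = if i = j then c i else 0)
    (h : n = m + k) (S T : {S : Finset (Fin n) // S.card = m}) :
    ∑ z : Fin m → P, (Matrix.of fun i j => w (shuffle h S (Sum.inl j)) (z i)).det *
        starRingEnd ℂ (Matrix.of fun i j => w (shuffle h T (Sum.inl j)) (z i)).det =
      if S = T then (m.factorial : ℂ) * ∏ j ∈ S.1, c j else 0 := by
  rw [sum_det_mul_conj_det w c hw]
  split_ifs with hST
  · subst hST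
    rw [det_ite_self c (fun a b hab => by simpa using hab), prod_shuffle_inl]
  · obtain ⟨j, hjS, hjT⟩ : ∃ j ∈ S.1, j ∉ T.1 := by
      by_contra! hsub
      exact hST (Subtype.ext (Finset.eq_of_subset_of_card_le hsub (by rw [S.2, T.2])))
    obtain ⟨i, rfl⟩ := (mem_iff_shuffle h S j).mp hjS
    rw [det_ite_of_notMem c i (fun j' hj' => hjT (by
      have h1 := shuffle_inl_mem h T j'
      rwa [← hj'] at h1)), mul_zero]

theorem sum_shuffle_inr (hw : ∀ i j, ∑ p, w i p * starRingEnd ℂ (w j p) = if i = j then c i else 0)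
    (h : n = m + k) (S T : {S : Finset (Fin n) // S.card = m}) :
    ∑ z : Fin k → P, (Matrix.of fun i j => w (shuffle h S (Sum.inr j)) (z i)).det *
        starRingEnd ℂ (Matrix.of fun i j => w (shuffle h T (Sum.inr j)) (z i)).det =
      if S = T then (k.factorial : ℂ) * ∏ j ∈ S.1ᶜ, c j else 0 := by
  rw [sum_det_mul_conj_det w c hw]
  split_ifs with hST
  · subst hST
    rw [det_ite_self c (fun a b hab => by simpa using hab), prod_shuffle_inr]
  · obtain ⟨j, hjT, hjS⟩ : ∃ j ∈ T.1, j ∉ S.1 := by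
      by_contra! hsub
      exact hST (Subtype.ext (Finset.eq_of_subset_of_card_le hsub (by rw [S.2, T.2])).symm)
    rcases hx : (shuffle h S).symm j with i | i
    · exact absurd (by rw [← Equiv.apply_symm_apply (shuffle h S) j, hx]
                       exact shuffle_inl_mem h S i) hjS
    · have hi : shuffle h S (Sum.inr i) = j := by rw [← hx]; simp
      rw [det_ite_of_notMem c i (fun j' hj' => shuffle_inr_notMem h T j' (by rwa [← hj', hi])),
        mul_zero]

end Peschel

/-! ### Schmidt decomposition of a Slater state. -/

section ReducedDensity

variable {M : Type*} [Fintype M] [DecidableEq M] (A : Finset M) {n : ℕ} (w : Fin n → M → ℂ)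

theorem eq_add_sub_of_fin (m : Fin (n + 1)) : n = (m : ℕ) + (n - (m : ℕ)) := by
  have := m.2; omega

/-- The minor of the orbitals `S` at the positions `x`. -/
noncomputable def minor (m : Fin (n + 1)) (S : {S : Finset (Fin n) // S.card = (m : ℕ)})
    (x : Fin (m : ℕ) → {p // p ∈ A}) : ℂ :=
  (Matrix.of fun i j => w (shuffle (eq_add_sub_of_fin m) S (Sum.inl j)) (x i)).det

/-- The row order of `joinConfig`. -/
def joinEquiv (m : Fin (n + 1)) : Fin (m : ℕ) ⊕ Fin (n - (m : ℕ)) ≃ Fin n :=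
  finSumFinEquiv.trans (finCongr (eq_add_sub_of_fin m).symm)

theorem joinConfig_inl (m : Fin (n + 1)) (x : Fin (m : ℕ) → {p // p ∈ A})
    (z : Fin (n - (m : ℕ)) → {p // p ∉ A}) (i : Fin (m : ℕ)) :
    joinConfig A m x z (joinEquiv m (Sum.inl i)) = x i := by
  simp [joinConfig, joinEquiv]

theorem joinConfig_inr (m : Fin (n + 1)) (x : Fin (m : ℕ) → {p // p ∈ A})
    (z : Fin (n - (m : ℕ)) → {p // p ∉ A}) (i : Fin (n - (m : ℕ))) :
    joinConfig A m x z (joinEquiv m (Sum.inr i)) = z i := by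
  simp [joinConfig, joinEquiv]

/-- Both determinants are expanded by Laplace along the rows in `A`. Summing over the outside
positions makes the complementary minors orthogonal, so only equal index sets survive, and `C(n,m)
(n-m)! / n! = 1/m!`. -/
theorem reducedDensity_block (c : Fin n → ℂ)
    (hout : ∀ i j, ∑ p : {p // p ∉ A}, w i p * starRingEnd ℂ (w j p) = if i = j then c i else 0)
    (m : Fin (n + 1)) (x y : Fin (m : ℕ) → {p // p ∈ A}) :
    (n.choose (m : ℕ) : ℂ) * ∑ z : Fin (n - (m : ℕ)) → {p // p ∉ A},
      slater w (joinConfig A m x z) * starRingEnd ℂ (slater w (joinConfig A m y z)) =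
    ∑ S : {S : Finset (Fin n) // S.card = (m : ℕ)},
      minor A w m S x * (((∏ j ∈ S.1ᶜ, c j) / ((m : ℕ).factorial : ℂ)) *
        starRingEnd ℂ (minor A w m S y)) := by
  have hn : n = (m : ℕ) + (n - (m : ℕ)) := eq_add_sub_of_fin m
  let s : {S : Finset (Fin n) // S.card = (m : ℕ)} → ℂ := fun S =>
    ((Equiv.Perm.sign ((joinEquiv m).symm.trans (shuffle hn S)) : ℤ) : ℂ)
  have hs : ∀ S, s S * starRingEnd ℂ (s S) = 1 := by
    intro S
    simp only [s, map_intCast]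
    rw [← Int.cast_mul, ← Units.val_mul, Int.units_mul_self]; simp
  let D : {S : Finset (Fin n) // S.card = (m : ℕ)} → (Fin (n - (m : ℕ)) → {p // p ∉ A}) → ℂ := fun S z =>
    (Matrix.of fun i j => w (shuffle hn S (Sum.inr j)) (z i)).det
  have hdet : ∀ (x : Fin (m : ℕ) → {p // p ∈ A}) (z : Fin (n - (m : ℕ)) → {p // p ∉ A}),
      slater w (joinConfig A m x z) =
        (∑ S, s S * (minor A w m S x * D S z)) / (Real.sqrt (n.factorial : ℝ) : ℂ) := by
    intro x z
    rw [slater, det_eq_sum_shuffle hn (joinEquiv m)]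
    simp only [Matrix.of_apply, joinConfig_inl, joinConfig_inr]
    rfl
  have hD : ∀ S T, ∑ z, D S z * starRingEnd ℂ (D T z) =
      if S = T then ((n - (m : ℕ)).factorial : ℂ) * ∏ j ∈ S.1ᶜ, c j else 0 :=
    fun S T => sum_shuffle_inr (fun i (p : {p // p ∉ A}) => w i p) c hout hn S T
  have hsq : (Real.sqrt (n.factorial : ℝ) : ℂ) * (Real.sqrt (n.factorial : ℝ) : ℂ) =
      (n.factorial : ℂ) := by
    rw [← Complex.ofReal_mul, Real.mul_self_sqrt (by positivity)]; simp
  have hsum : ∑ z : Fin (n - (m : ℕ)) → {p // p ∉ A},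
      slater w (joinConfig A m x z) * starRingEnd ℂ (slater w (joinConfig A m y z)) =
      (∑ S, minor A w m S x * starRingEnd ℂ (minor A w m S y) *
        (((n - (m : ℕ)).factorial : ℂ) * ∏ j ∈ S.1ᶜ, c j)) / (n.factorial : ℂ) := by
    simp only [hdet, map_div₀, Complex.conj_ofReal, map_sum, map_mul]
    simp_rw [div_mul_div_comm, hsq, Finset.sum_mul_sum]
    rw [← Finset.sum_div]
    congr 1
    rw [Finset.sum_comm]
    refine Finset.sum_congr rfl fun S _ => ?_
    rw [Finset.sum_comm]
    rw [Finset.sum_eq_single S]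
    · have := hD S S
      rw [if_pos rfl] at this
      rw [← this, Finset.mul_sum]
      refine Finset.sum_congr rfl fun z _ => ?_
      linear_combination (minor A w m S x * D S z * ((starRingEnd ℂ) (minor A w m S y) *
        (starRingEnd ℂ) (D S z))) * hs S
    · intro T _ hT
      have := hD S T
      rw [if_neg (Ne.symm hT)] at this
      rw [← mul_zero (s S * minor A w m S x * ((starRingEnd ℂ) (s T) *
        (starRingEnd ℂ) (minor A w m T y))), ← this, Finset.mul_sum]
      exact Finset.sum_congr rfl fun z _ => by ring
    · simp
  rw [hsum, Finset.sum_div, Finset.mul_sum]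
  refine Finset.sum_congr rfl fun S _ => ?_
  have hch : (n.choose (m : ℕ) : ℂ) * (m : ℕ).factorial * (n - (m : ℕ)).factorial = n.factorial := by
    have := Nat.choose_mul_factorial_mul_factorial (show (m : ℕ) ≤ n by omega)
    exact_mod_cast this
  have h1 : ((m : ℕ).factorial : ℂ) ≠ 0 := by exact_mod_cast Nat.factorial_ne_zero _
  have h2 : (n.factorial : ℂ) ≠ 0 := by exact_mod_cast Nat.factorial_ne_zero _
  field_simp
  linear_combination (minor A w m S x * (starRingEnd ℂ) (minor A w m S y) *
    ∏ j ∈ S.1ᶜ, c j) * hch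

/-- The Schmidt vectors of the Slater state of orbitals which stay orthogonal in `A`. -/
noncomputable def schmidtMatrix :
    Matrix (Σ m : Fin (n + 1), Fin (m : ℕ) → {p // p ∈ A}) (Finset (Fin n)) ℂ :=
  Matrix.of fun q S => if h : S.card = (q.1 : ℕ) then minor A w q.1 ⟨S, h⟩ q.2 else 0

theorem schmidtMatrix_apply (m : Fin (n + 1)) (x : Fin (m : ℕ) → {p // p ∈ A})
    (S : Finset (Fin n)) (h : S.card = (m : ℕ)) :
    schmidtMatrix A w ⟨m, x⟩ S = minor A w m ⟨S, h⟩ x := by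
  simp [schmidtMatrix, h]

theorem schmidtMatrix_of_ne (m : Fin (n + 1)) (x : Fin (m : ℕ) → {p // p ∈ A})
    (S : Finset (Fin n)) (h : S.card ≠ (m : ℕ)) : schmidtMatrix A w ⟨m, x⟩ S = 0 := by
  simp [schmidtMatrix, h]

/-- The factorization `V (D V*)` is what matters: its non-zero spectrum is that of `(D V*) V`, which
`schmidtMatrix_gram` shows to be diagonal. -/
theorem reducedDensity_eq_mul (c : Fin n → ℂ)
    (hout : ∀ i j, ∑ p : {p // p ∉ A}, w i p * starRingEnd ℂ (w j p) = if i = j then c i else 0) :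
    reducedDensity A w w = schmidtMatrix A w *
      (Matrix.diagonal (fun S : Finset (Fin n) => (∏ j ∈ Sᶜ, c j) / (S.card.factorial : ℂ)) *
        (schmidtMatrix A w).conjTranspose) := by
  ext ⟨m, x⟩ ⟨m', y⟩
  rw [Matrix.mul_apply]
  simp only [Matrix.diagonal_mul, Matrix.conjTranspose_apply]
  by_cases hm : m = m'
  · subst hm
    rw [reducedDensity, Matrix.blockDiagonal'_apply_eq, Matrix.of_apply,
      reducedDensity_block A w c hout,
      ← Finset.sum_filter_of_ne (p := fun S : Finset (Fin n) => S.card = (m : ℕ)),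
      Finset.sum_subtype (p := fun S : Finset (Fin n) => S.card = (m : ℕ))
        (Finset.univ.filter fun S : Finset (Fin n) => S.card = (m : ℕ)) (by simp)]
    · refine Finset.sum_congr rfl fun S _ => ?_
      rw [schmidtMatrix_apply A w m x S.1 S.2, schmidtMatrix_apply A w m y S.1 S.2, S.2]
      rfl
    · intro S _ hS
      by_contra h
      exact hS (by rw [schmidtMatrix_of_ne A w m x S h, zero_mul])
  · rw [reducedDensity, Matrix.blockDiagonal'_apply_ne _ _ _ hm]
    symm
    refine Finset.sum_eq_zero fun S _ => ?_
    by_cases h : S.card = (m : ℕ)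
    · rw [schmidtMatrix_of_ne A w m' y S (fun h' => hm (Fin.ext (h.symm.trans h')))]
      simp
    · rw [schmidtMatrix_of_ne A w m x S h, zero_mul]

/-- Minors of different sets are orthogonal in `A`, and the factor `|S|!` from Andréief's identity
cancels the denominator of `D`. -/
theorem schmidtMatrix_gram (b c : Fin n → ℂ)
    (hin : ∀ i j, ∑ p : {p // p ∈ A}, w i p * starRingEnd ℂ (w j p) = if i = j then b i else 0) :
    Matrix.diagonal (fun S : Finset (Fin n) => (∏ j ∈ Sᶜ, c j) / (S.card.factorial : ℂ)) *
        (schmidtMatrix A w).conjTranspose * schmidtMatrix A w =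
      Matrix.diagonal fun S : Finset (Fin n) => (∏ j ∈ S, b j) * ∏ j ∈ Sᶜ, c j := by
  rw [Matrix.mul_assoc]
  ext S T
  rw [Matrix.diagonal_mul, Matrix.mul_apply, Fintype.sum_sigma]
  have hSn : S.card < n + 1 := by
    have := Finset.card_le_univ S; rw [Fintype.card_fin] at this; omega
  rw [Finset.sum_eq_single (⟨S.card, hSn⟩ : Fin (n + 1))]
  · by_cases hT : T.card = S.card
    · have h := sum_shuffle_inl (fun i (p : {p // p ∈ A}) => w i p) b hin
        (eq_add_sub_of_fin (⟨S.card, hSn⟩ : Fin (n + 1))) ⟨T, hT⟩ ⟨S, rfl⟩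
      have h' : ∑ x : Fin S.card → {p // p ∈ A},
          (schmidtMatrix A w).conjTranspose S ⟨⟨S.card, hSn⟩, x⟩ *
            schmidtMatrix A w ⟨⟨S.card, hSn⟩, x⟩ T =
          if (⟨T, hT⟩ : {S' : Finset (Fin n) // S'.card = S.card}) = ⟨S, rfl⟩ then
            (S.card.factorial : ℂ) * ∏ j ∈ T, b j else 0 := by
        rw [← h]
        refine Finset.sum_congr rfl fun x _ => ?_
        rw [Matrix.conjTranspose_apply, schmidtMatrix_apply A w ⟨S.card, hSn⟩ x S rfl,
          schmidtMatrix_apply A w ⟨S.card, hSn⟩ x T hT, mul_comm]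
        rfl
      rw [h']
      by_cases hST : S = T
      · subst hST
        have h1 : (S.card.factorial : ℂ) ≠ 0 := by exact_mod_cast Nat.factorial_ne_zero _
        rw [if_pos rfl, Matrix.diagonal_apply_eq]
        field_simp
      · rw [if_neg (fun hh => hST (congrArg Subtype.val hh).symm), Matrix.diagonal_apply_ne _ hST,
          mul_zero]
    · rw [Matrix.diagonal_apply_ne _ (fun h : S = T => hT (congrArg Finset.card h.symm)), Finset.sum_eq_zero, mul_zero]
      intro x _
      rw [schmidtMatrix_of_ne A w ⟨S.card, hSn⟩ x T hT, mul_zero]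
  · intro m _ hm
    refine Finset.sum_eq_zero fun x _ => ?_
    rw [Matrix.conjTranspose_apply,
      schmidtMatrix_of_ne A w m x S (fun h => hm (Fin.ext h.symm)), star_zero, zero_mul]
  · simp

/-- The entropy of one eigenvalue of a correlation matrix. -/
noncomputable def modeEntropy (z : ℂ) : ℂ := (Real.binEntropy z.re : ℂ)

/-- The correlation matrix of the orbitals `u` in `A`. -/
noncomputable def correlationMatrix (u : Fin n → M → ℂ) : Matrix {p // p ∈ A} {p // p ∈ A} ℂ :=
  Matrix.of fun p q => ∑ j, u j p * starRingEnd ℂ (u j q)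

/-- The eigenvalues are the probabilities of the configurations of independent bits. The norms
inside and outside `A` show `0 ≤ ν ≤ 1`, so that the complex logarithm reduces to the real one. -/
theorem entropy_reducedDensity_of_orthogonal (ν : Fin n → ℝ)
    (hin : ∀ i j, ∑ p : {p // p ∈ A}, w i p * starRingEnd ℂ (w j p) =
      if i = j then (ν i : ℂ) else 0)
    (hout : ∀ i j, ∑ p : {p // p ∉ A}, w i p * starRingEnd ℂ (w j p) =
      if i = j then ((1 - ν i : ℝ) : ℂ) else 0) :
    entropy (reducedDensity A w w) = ∑ i, (Real.binEntropy (ν i) : ℂ) := by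
  have hν0 : ∀ i, 0 ≤ ν i := by
    intro i
    have h := congrArg Complex.re (hin i i)
    rw [if_pos rfl, Complex.ofReal_re, Complex.re_sum] at h
    rw [← h]
    exact Finset.sum_nonneg fun p _ => by rw [Complex.mul_conj, Complex.ofReal_re]; exact Complex.normSq_nonneg _
  have hν1 : ∀ i, 0 ≤ 1 - ν i := by
    intro i
    have h := congrArg Complex.re (hout i i)
    rw [if_pos rfl, Complex.ofReal_re, Complex.re_sum] at h
    rw [← h]
    exact Finset.sum_nonneg fun p _ => by rw [Complex.mul_conj, Complex.ofReal_re]; exact Complex.normSq_nonneg _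
  rw [entropy_eq_spectralSum, reducedDensity_eq_mul A w _ hout,
    spectralSum_mul_comm _ (by simp), schmidtMatrix_gram A w _ _ hin, spectralSum_diagonal]
  have h := sum_negMulLog_powerset (Finset.univ : Finset (Fin n)) ν
  rw [Finset.powerset_univ] at h
  rw [← Complex.ofReal_sum, ← h, Complex.ofReal_sum]
  refine Finset.sum_congr rfl fun S _ => ?_
  rw [← Complex.ofReal_prod, ← Complex.ofReal_prod, ← Complex.ofReal_mul, ← Complex.ofReal_log,
    ← Complex.ofReal_mul, ← Complex.ofReal_neg, Real.negMulLog, ← Finset.compl_eq_univ_sdiff,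
    neg_mul]
  exact mul_nonneg (Finset.prod_nonneg fun i _ => hν0 i) (Finset.prod_nonneg fun i _ => hν1 i)

theorem sum_rotate {Q : Type*} [Fintype Q] (u : Fin n → Q → ℂ) (U : Matrix (Fin n) (Fin n) ℂ)
    {G : Matrix (Fin n) (Fin n) ℂ} (hG : ∀ k l, ∑ p, u k p * starRingEnd ℂ (u l p) = G l k)
    (i j : Fin n) :
    ∑ p, (∑ k, U k i * u k p) * starRingEnd ℂ (∑ k, U k j * u k p) = (star U * G * U) j i := by
  simp only [map_sum, map_mul, Finset.sum_mul_sum]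
  simp only [Matrix.mul_apply, Matrix.star_apply, ← hG, Finset.mul_sum, Finset.sum_mul]
  rw [Finset.sum_comm]
  refine Finset.sum_congr rfl fun k _ => ?_
  rw [Finset.sum_comm]
  refine Finset.sum_congr rfl fun l _ => Finset.sum_congr rfl fun p _ => ?_
  simp only [RCLike.star_def]
  ring

/-- The entropy of a reduced Slater state of orthonormal orbitals is a sum over the spectrum of the
correlation matrix. -/
theorem entropy_reducedDensity (u : Fin n → M → ℂ)
    (hu : ∀ i j, ∑ p, u i p * starRingEnd ℂ (u j p) = if i = j then 1 else 0) :
    entropy (reducedDensity A u u) = spectralSum modeEntropy (correlationMatrix A u) := by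
  let R : Matrix {p // p ∈ A} (Fin n) ℂ := Matrix.of fun p j => u j p
  set G : Matrix (Fin n) (Fin n) ℂ := R.conjTranspose * R with hG
  have hGh : G.IsHermitian := Matrix.isHermitian_conjTranspose_mul_self R
  have hC : correlationMatrix A u = R * R.conjTranspose := by
    ext p q
    simp [correlationMatrix, R, Matrix.mul_apply]
  -- The correlation matrix `R R*` and the Gram matrix `R* R` of the orbitals restricted to `A` have
  -- the same spectral sum, because the binary entropy vanishes at 0.
  rw [hC, spectralSum_mul_comm _ (by simp [modeEntropy]), ← hG,
    spectralSum_of_isHermitian _ hGh]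
  let U : Matrix (Fin n) (Fin n) ℂ := (hGh.eigenvectorUnitary : Matrix (Fin n) (Fin n) ℂ)
  have hU : U ∈ Matrix.unitaryGroup (Fin n) ℂ := hGh.eigenvectorUnitary.2
  have hdiag : star U * G * U = Matrix.diagonal fun i => (hGh.eigenvalues i : ℂ) := by
    have := hGh.conjStarAlgAut_star_eigenvectorUnitary
    rw [Unitary.conjStarAlgAut_star_apply] at this
    exact this
  have hin : ∀ i j, ∑ p : {p // p ∈ A}, (∑ k, U k i * u k p) *
      starRingEnd ℂ (∑ k, U k j * u k p) = if i = j then (hGh.eigenvalues i : ℂ) else 0 := by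
    intro i j
    have hGa : ∀ k l, ∑ p : {p // p ∈ A}, u k p * starRingEnd ℂ (u l p) = G l k := by
      intro k l
      simp [hG, R, Matrix.mul_apply, mul_comm]
    rw [sum_rotate (fun k (p : {p // p ∈ A}) => u k p) U hGa, hdiag, Matrix.diagonal_apply]
    by_cases h : i = j
    · subst h; simp
    · rw [if_neg h, if_neg (Ne.symm h)]
  have hall : ∀ i j, ∑ p, (∑ k, U k i * u k p) * starRingEnd ℂ (∑ k, U k j * u k p) =
      if i = j then 1 else 0 := by
    intro i j
    rw [sum_rotate u U (G := 1) (fun k l => by rw [hu, Matrix.one_apply]; simp [eq_comm]),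
      mul_one, Matrix.mem_unitaryGroup_iff'.mp hU, Matrix.one_apply]
    simp [eq_comm]
  -- After the Gram matrix in `A` is diagonalized, global orthonormality forces orthogonality
  -- outside `A` too, with the complementary weights `1 - ν`.
  have hout : ∀ i j, ∑ p : {p // p ∉ A}, (∑ k, U k i * u k p) *
      starRingEnd ℂ (∑ k, U k j * u k p) =
        if i = j then ((1 - hGh.eigenvalues i : ℝ) : ℂ) else 0 := by
    intro i j
    have h : ∑ p : {p // p ∈ A}, (∑ k, U k i * u k p) * starRingEnd ℂ (∑ k, U k j * u k p) +
        ∑ p : {p // p ∉ A}, (∑ k, U k i * u k p) * starRingEnd ℂ (∑ k, U k j * u k p) =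
        ∑ p, (∑ k, U k i * u k p) * starRingEnd ℂ (∑ k, U k j * u k p) := by
      convert Fintype.sum_subtype_add_sum_subtype (fun p => p ∈ A)
        (fun p => (∑ k, U k i * u k p) * starRingEnd ℂ (∑ k, U k j * u k p))
    rw [hall] at h
    have h' := hin i j
    split_ifs at h h' ⊢ with hij
    · push_cast
      linear_combination h - h'
    · linear_combination h - h'
  rw [← reducedDensity_rotate A hU u]
  rw [entropy_reducedDensity_of_orthogonal A (fun j p => ∑ i, U i j * u i p) _ hin hout]
  simp [modeEntropy]

end ReducedDensity

end FreeFermion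

namespace FreeFermion

/-! ## Plane waves on the discrete torus -/

section PlaneWaves

variable {d : ℕ}

theorem phase_add (k : Momentum d) (r s : Fin d → ℤ) : phase k (r + s) = phase k r * phase k s := by
  rw [phase, phase, phase, ← Complex.exp_add, ← mul_add, ← Complex.ofReal_add,
    ← Finset.sum_add_distrib]
  simp [mul_add]

@[simp] theorem phase_zero (k : Momentum d) : phase k 0 = 1 := by simp [phase]

theorem norm_phase (k : Momentum d) (r : Fin d → ℤ) : ‖phase k r‖ = 1 := by
  rw [phase, mul_comm, Complex.norm_exp_ofReal_mul_I]

theorem phase_neg (k : Momentum d) (r : Fin d → ℤ) : phase k (-r) = starRingEnd ℂ (phase k r) := by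
  rw [phase, phase, ← Complex.exp_conj]
  simp

theorem phase_sub (k : Momentum d) (r s : Fin d → ℤ) :
    phase k (r - s) = phase k r * starRingEnd ℂ (phase k s) := by
  rw [sub_eq_add_neg, phase_add, phase_neg]

theorem phase_gridMomentum {Λ : ℕ} (n : Fin d → Fin Λ) (v : Fin d → ℤ) :
    phase (gridMomentum n) v =
      ∏ i, Complex.exp (2 * Real.pi * Complex.I * (v i : ℂ) / (Λ : ℂ)) ^ (n i : ℕ) := by
  simp only [← Complex.exp_nat_mul]
  rw [phase, ← Complex.exp_sum]
  congr 1
  push_cast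
  rw [Finset.mul_sum]
  refine Finset.sum_congr rfl fun i _ => ?_
  simp only [gridMomentum]
  push_cast
  ring

/-- The exponent `2π n·x / Λ` is symmetric in momentum label and site, so sums over sites reduce to
sums over momenta. -/
theorem phase_grid_comm {Λ : ℕ} (n x : Fin d → Fin Λ) :
    phase (gridMomentum n) (siteVector x) = phase (gridMomentum x) (siteVector n) := by
  rw [phase, phase]
  congr 4
  funext i
  simp only [gridMomentum, siteVector]
  push_cast
  ring

theorem sum_exp_pow {Λ : ℕ} (hΛ : 0 < Λ) (v : ℤ) :
    ∑ a : Fin Λ, Complex.exp (2 * Real.pi * Complex.I * (v : ℂ) / (Λ : ℂ)) ^ (a : ℕ) =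
      if (Λ : ℤ) ∣ v then (Λ : ℂ) else 0 := by
  have hΛ' : (Λ : ℂ) ≠ 0 := by exact_mod_cast hΛ.ne'
  rw [Fin.sum_univ_eq_sum_range (fun a => Complex.exp (2 * Real.pi * Complex.I * (v : ℂ) /
    (Λ : ℂ)) ^ a)]
  split_ifs with h
  · obtain ⟨c, rfl⟩ := h
    have h1 : Complex.exp (2 * Real.pi * Complex.I * (((Λ : ℤ) * c : ℤ) : ℂ) / (Λ : ℂ)) = 1 := by
      rw [Complex.exp_eq_one_iff]
      refine ⟨c, ?_⟩
      push_cast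
      field_simp
    simp only [h1]
    simp
  · have h1 : Complex.exp (2 * Real.pi * Complex.I * (v : ℂ) / (Λ : ℂ)) ≠ 1 := by
      intro h1
      rw [Complex.exp_eq_one_iff] at h1
      obtain ⟨c, hc⟩ := h1
      apply h
      refine ⟨c, ?_⟩
      have hpi : (2 * Real.pi * Complex.I : ℂ) ≠ 0 := Complex.two_pi_I_ne_zero
      have : (v : ℂ) = (Λ : ℂ) * c := by
        field_simp at hc
        have h2 : (2 * Real.pi * Complex.I : ℂ) * (v : ℂ) =
            (2 * Real.pi * Complex.I : ℂ) * ((Λ : ℂ) * c) := by linear_combination (2 * Real.pi * Complex.I : ℂ) * hc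
        exact mul_left_cancel₀ hpi h2
      exact_mod_cast this
    rw [geom_sum_eq h1, ← Complex.exp_nat_mul]
    have h2 : Complex.exp ((Λ : ℂ) * (2 * Real.pi * Complex.I * (v : ℂ) / (Λ : ℂ))) = 1 := by
      rw [Complex.exp_eq_one_iff]
      exact ⟨v, by field_simp⟩
    rw [h2]; simp

theorem sum_phase_gridMomentum {Λ : ℕ} (hΛ : 0 < Λ) (v : Fin d → ℤ) :
    ∑ n : Fin d → Fin Λ, phase (gridMomentum n) v =
      if ∀ i, (Λ : ℤ) ∣ v i then (Λ : ℂ) ^ d else 0 := by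
  simp only [phase_gridMomentum]
  rw [← Fintype.piFinset_univ, Finset.sum_prod_piFinset Finset.univ
    (fun i (a : Fin Λ) => Complex.exp (2 * Real.pi * Complex.I * (v i : ℂ) / (Λ : ℂ)) ^ (a : ℕ))]
  simp only [sum_exp_pow hΛ]
  split_ifs with h
  · simp [h]
  · push Not at h
    obtain ⟨i, hi⟩ := h
    exact Finset.prod_eq_zero (Finset.mem_univ i) (if_neg hi)

theorem dvd_siteVector_sub_iff {Λ : ℕ} (x y : Fin d → Fin Λ) :
    (∀ i, (Λ : ℤ) ∣ (siteVector x - siteVector y) i) ↔ x = y := by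
  constructor
  · intro h
    ext i
    have h1 := h i
    simp only [siteVector, Pi.sub_apply] at h1
    have h2 : ((x i : ℕ) : ℤ) - ((y i : ℕ) : ℤ) = 0 := by
      apply Int.eq_zero_of_abs_lt_dvd h1
      rw [abs_lt]
      constructor <;> omega
    omega
  · rintro rfl i
    simp

theorem sum_phase_sites {Λ : ℕ} (hΛ : 0 < Λ) (n n' : Fin d → Fin Λ) :
    ∑ x : Fin d → Fin Λ, phase (gridMomentum n) (siteVector x) *
        starRingEnd ℂ (phase (gridMomentum n') (siteVector x)) =
      if n = n' then (Λ : ℂ) ^ d else 0 := by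
  have h : ∀ x : Fin d → Fin Λ, phase (gridMomentum n) (siteVector x) *
      starRingEnd ℂ (phase (gridMomentum n') (siteVector x)) =
        phase (gridMomentum x) (siteVector n - siteVector n') := by
    intro x
    rw [phase_sub, phase_grid_comm n, phase_grid_comm n']
  simp only [h, sum_phase_gridMomentum hΛ, dvd_siteVector_sub_iff]

end PlaneWaves

/-! ## The correlation matrix of the ground state -/

section GroundState

variable {d N : ℕ}

theorem sum_bandOrbital {Λ : ℕ} (hΛ : 0 < Λ) (q q' : Mode d N Λ) :
    ∑ p : Mode d N Λ, bandOrbital q p * starRingEnd ℂ (bandOrbital q' p) =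
      if q = q' then 1 else 0 := by
  have hsq : (Real.sqrt ((Λ : ℝ) ^ d) : ℂ) * (Real.sqrt ((Λ : ℝ) ^ d) : ℂ) = (Λ : ℂ) ^ d := by
    rw [← Complex.ofReal_mul, Real.mul_self_sqrt (by positivity)]; simp
  have hΛ' : (Λ : ℂ) ^ d ≠ 0 := pow_ne_zero _ (by exact_mod_cast hΛ.ne')
  rw [Fintype.sum_prod_type]
  have h1 : ∀ x : Fin d → Fin Λ, ∑ β : Fin N, bandOrbital q (x, β) *
      starRingEnd ℂ (bandOrbital q' (x, β)) = if q.2 = q'.2 then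
        phase (gridMomentum q.1) (siteVector x) *
          starRingEnd ℂ (phase (gridMomentum q'.1) (siteVector x)) / (Λ : ℂ) ^ d else 0 := by
    intro x
    rw [Finset.sum_eq_single q.2]
    · by_cases h : q.2 = q'.2
      · simp [bandOrbital, h, div_mul_div_comm, hsq]
      · simp [bandOrbital, h, Ne.symm h]
    · intro β _ hβ
      simp [bandOrbital, Ne.symm hβ]
    · simp
  simp only [h1]
  by_cases h : q.2 = q'.2
  · simp only [h, if_true]
    rw [← Finset.sum_div, sum_phase_sites hΛ]
    by_cases hq : q.1 = q'.1
    · rw [if_pos hq, if_pos (Prod.ext hq h), div_self hΛ']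
    · rw [if_neg hq, if_neg (fun h' => hq (congrArg Prod.fst h')), zero_div]
  · rw [if_neg (fun h' => h (congrArg Prod.snd h'))]
    simp [h]

/-- The Fourier coefficients of the indicator of `{Re ε < 0}` on the grid of momenta. -/
noncomputable def gridCoeff (ε : Momentum d → ℂ) (Λ : ℕ) (v : Fin d → ℤ) : ℂ :=
  ((Λ : ℂ) ^ d)⁻¹ * ∑ n : Fin d → Fin Λ,
    if (ε (gridMomentum n)).re < 0 then phase (gridMomentum n) v else 0

/-- The block Toeplitz matrix on the cube with the coefficients `a α`. -/
noncomputable def toeplitz (L : ℕ) (a : Fin N → (Fin d → ℤ) → ℂ) :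
    Matrix ((Fin d → Fin L) × Fin N) ((Fin d → Fin L) × Fin N) ℂ :=
  Matrix.of fun p q => if p.2 = q.2 then a p.2 (siteVector p.1 - siteVector q.1) else 0

theorem correlationMatrix_groundOrbitals (E : Fin N → Momentum d → ℂ) (Λ : ℕ)
    (A : Finset (Mode d N Λ)) (p q : {p // p ∈ A}) :
    correlationMatrix A (groundOrbitals E Λ) p q =
      if p.1.2 = q.1.2 then gridCoeff (E p.1.2) Λ (siteVector p.1.1 - siteVector q.1.1) else 0 := by
  classical
  have hsq : (Real.sqrt ((Λ : ℝ) ^ d) : ℂ) * (Real.sqrt ((Λ : ℝ) ^ d) : ℂ) = (Λ : ℂ) ^ d := by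
    rw [← Complex.ofReal_mul, Real.mul_self_sqrt (by positivity)]; simp
  have h1 : correlationMatrix A (groundOrbitals E Λ) p q =
      ∑ r ∈ filledModes E Λ, bandOrbital r p.1 * starRingEnd ℂ (bandOrbital r q.1) := by
    rw [← Finset.sum_coe_sort, ← (filledModes E Λ).equivFin.symm.sum_comp]
    rfl
  rw [h1, filledModes, Finset.sum_filter, Fintype.sum_prod_type, gridCoeff, Finset.mul_sum]
  have h2 : ∀ n : Fin d → Fin Λ, (∑ β : Fin N, if (E β (gridMomentum n)).re < 0 then
      bandOrbital (n, β) p.1 * starRingEnd ℂ (bandOrbital (n, β) q.1) else 0) =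
      if p.1.2 = q.1.2 then ((Λ : ℂ) ^ d)⁻¹ * (if (E p.1.2 (gridMomentum n)).re < 0 then
        phase (gridMomentum n) (siteVector p.1.1 - siteVector q.1.1) else 0) else 0 := by
    intro n
    rw [Finset.sum_eq_single p.1.2]
    · by_cases h : p.1.2 = q.1.2
      · simp only [bandOrbital, h, if_true, map_div₀, Complex.conj_ofReal, div_mul_div_comm, hsq,
          phase_sub]
        split_ifs
        · rw [div_eq_inv_mul]
        · simp
      · simp [bandOrbital, h]
    · intro β _ hβ
      simp [bandOrbital, hβ]
    · simp
  simp only [h2]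
  split_ifs <;> simp

/-- The modes of a cube inside the torus. -/
def cubeEquiv {Λ L : ℕ} (h : L ≤ Λ) : (Fin d → Fin L) × Fin N ≃ {p // p ∈ cube d N Λ L} where
  toFun p := ⟨(fun i => Fin.castLE h (p.1 i), p.2), by simp [cube]⟩
  invFun p := (fun i => ⟨(p.1.1 i : ℕ), by
    have := p.2; simp only [cube, Finset.mem_filter] at this; exact this.2 i⟩, p.1.2)
  left_inv p := by simp
  right_inv p := by simp

theorem siteVector_cubeEquiv {Λ L : ℕ} (h : L ≤ Λ) (p : (Fin d → Fin L) × Fin N) :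
    siteVector (cubeEquiv h p).1.1 = siteVector p.1 := rfl

theorem groundEntropy_eq (E : Fin N → Momentum d → ℂ) {Λ L : ℕ} (hΛ : 0 < Λ) (h : L ≤ Λ) :
    groundEntropy E Λ L =
      spectralSum modeEntropy (toeplitz L fun α => gridCoeff (E α) Λ) := by
  rw [groundEntropy, entropy_reducedDensity]
  · rw [← spectralSum_reindex _ (cubeEquiv h).symm]
    congr 1
    ext p q
    rw [Matrix.reindex_apply, Matrix.submatrix_apply, correlationMatrix_groundOrbitals]
    rfl
  · intro i j
    rw [groundOrbitals, groundOrbitals, sum_bandOrbital hΛ]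
    simp

/-- A full band has the symbol 1, whose coefficients are a delta on the torus, and an empty band has
the symbol 0. Because `L ≤ Λ`, distinct sites of the cube are not congruent modulo `Λ`. -/
theorem toeplitz_eq_diagonal {Λ L : ℕ} (hΛ : 0 < Λ) (h : L ≤ Λ) (E : Fin N → Momentum d → ℂ)
    (hE : ∀ α, (∀ k, (E α k).re < 0) ∨ ∀ k, ¬ (E α k).re < 0) :
    ∃ s : Fin N → ℂ, (∀ α, s α = 0 ∨ s α = 1) ∧
      toeplitz L (fun α => gridCoeff (E α) Λ) = Matrix.diagonal fun p => s p.2 := by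
  classical
  have hΛ' : (Λ : ℂ) ^ d ≠ 0 := pow_ne_zero _ (by exact_mod_cast hΛ.ne')
  refine ⟨fun α => if ∀ k, (E α k).re < 0 then 1 else 0, fun α => ?_, ?_⟩
  · dsimp only
    split_ifs <;> simp
  · ext p q
    rw [toeplitz, Matrix.of_apply, Matrix.diagonal_apply]
    have hpq : (∀ i, (Λ : ℤ) ∣ (siteVector p.1 - siteVector q.1) i) ↔ p.1 = q.1 := by
      rw [← siteVector_cubeEquiv h p, ← siteVector_cubeEquiv h q, dvd_siteVector_sub_iff]
      constructor
      · intro hh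
        ext i
        have := congrFun hh i
        simpa [cubeEquiv, Fin.ext_iff] using this
      · intro hh
        funext i
        simp [cubeEquiv, hh]
    by_cases h2 : p.2 = q.2
    · have h3 : p = q ↔ p.1 = q.1 := ⟨fun h => h ▸ rfl, fun h => Prod.ext h h2⟩
      rw [if_pos h2, gridCoeff]
      rcases hE p.2 with hs | hs
      · simp only [hs, if_true, sum_phase_gridMomentum hΛ, hpq, h3]
        by_cases hx : p.1 = q.1
        · simp [hx, inv_mul_cancel₀ hΛ']
        · simp [hx]
      · have : ¬ ∀ k, (E p.2 k).re < 0 := fun hh => hs 0 (hh 0)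
        simp [hs]
    · rw [if_neg h2, if_neg (fun h => h2 (congrArg Prod.snd h))]

theorem modeEntropy_zero : modeEntropy 0 = 0 := by simp [modeEntropy]

theorem modeEntropy_one : modeEntropy 1 = 0 := by simp [modeEntropy]

/-- Bands which are either completely filled or completely empty carry no entropy. -/
theorem groundEntropy_eq_zero {E : Fin N → Momentum d → ℂ}
    (hE : ∀ α, (∀ k, (E α k).re < 0) ∨ ∀ k, ¬ (E α k).re < 0) {Λ L : ℕ} (hΛ : 0 < Λ)
    (h : L ≤ Λ) : groundEntropy E Λ L = 0 := by
  obtain ⟨s, hs, hT⟩ := toeplitz_eq_diagonal hΛ h E hE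
  rw [groundEntropy_eq E hΛ h, hT, spectralSum_diagonal]
  refine Finset.sum_eq_zero fun p _ => ?_
  rcases hs p.2 with h | h <;> simp [h, modeEntropy_zero, modeEntropy_one]

/-- The bands of a gapped phase do not change sign. -/
theorem IsGappedUnbroken.sign_const {H : LocalPTHamiltonian d N} {E : Fin N → Momentum d → ℂ}
    (hH : IsGappedUnbroken H E) (α : Fin N) :
    (∀ k, (E α k).re < 0) ∨ ∀ k, ¬ (E α k).re < 0 := by
  by_contra! hcon
  obtain ⟨⟨k, hk⟩, q, hq⟩ := hcon
  have hc : Continuous fun k => (E α k).re := Complex.continuous_re.comp (hH.bands.continuous α)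
  obtain ⟨p, hp⟩ := mem_range_of_exists_le_of_exists_ge hc ⟨q, hq.le⟩ ⟨k, hk⟩
  exact hH.gapped α p (Complex.ext hp (hH.real α p))

end GroundState

end FreeFermion

namespace FreeFermion

open Filter Topology MeasureTheory
open scoped ComplexOrder Pointwise Matrix

/-! ## Continuity of spectral sums of Hermitian matrices -/

section Continuity

variable {ι : Type*} [Fintype ι] [DecidableEq ι]

theorem trace_pow_of_isHermitian {M : Matrix ι ι ℂ} (hM : M.IsHermitian) (k : ℕ) :
    (M ^ k).trace = ∑ i, (hM.eigenvalues i : ℂ) ^ k := by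
  have h : M ^ k = (Unitary.conjStarAlgAut ℂ _ hM.eigenvectorUnitary)
      (Matrix.diagonal (RCLike.ofReal ∘ hM.eigenvalues) ^ k) := by
    rw [map_pow, ← hM.spectral_theorem]
  rw [h, Unitary.conjStarAlgAut_apply, Matrix.trace_mul_cycle, Unitary.coe_star_mul_self, one_mul,
    Matrix.diagonal_pow, Matrix.trace_diagonal]
  rfl

theorem trace_aeval_of_isHermitian {M : Matrix ι ι ℂ} (hM : M.IsHermitian) (p : Polynomial ℝ) :
    (Polynomial.aeval M p).trace = ∑ i, ((p.eval (hM.eigenvalues i) : ℝ) : ℂ) := by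
  induction p using Polynomial.induction_on' with
  | add p q hp hq => simp [hp, hq, Matrix.trace_add, Finset.sum_add_distrib]
  | monomial k a =>
    rw [Polynomial.aeval_monomial, Algebra.algebraMap_eq_smul_one, smul_mul_assoc, one_mul,
      Matrix.trace_smul, trace_pow_of_isHermitian hM, Finset.smul_sum]
    simp

/-- One eigenvalue squared is at most `Tr M²`, and `|x| ≤ x² + 1`. The trace is continuous in `M`,
so a convergent family has its eigenvalues in one common interval. -/
theorem abs_eigenvalue_le {M : Matrix ι ι ℂ} (hM : M.IsHermitian) {R : ℝ}
    (hR : (M ^ 2).trace.re ≤ R) (i : ι) : |hM.eigenvalues i| ≤ R + 1 := by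
  rw [trace_pow_of_isHermitian hM, Complex.re_sum] at hR
  have h1 : hM.eigenvalues i ^ 2 ≤ R := by
    refine le_trans ?_ hR
    have := Finset.single_le_sum (f := fun i => ((hM.eigenvalues i : ℂ) ^ 2).re) (s := Finset.univ)
      (fun j _ => by rw [← Complex.ofReal_pow, Complex.ofReal_re]; positivity) (Finset.mem_univ i)
    simpa [← Complex.ofReal_pow] using this
  have h2 : |hM.eigenvalues i| ^ 2 ≤ R := by rwa [sq_abs]
  nlinarith [sq_nonneg (|hM.eigenvalues i| - 1)]

/-- Weierstrass approximation on an interval containing all the eigenvalues replaces `f` by a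
polynomial, whose spectral sum is a trace and hence continuous in the matrix. No continuity of
individual eigenvalues is needed. -/
theorem tendsto_spectralSum {κ : Type*} {l : Filter κ} {M : κ → Matrix ι ι ℂ} {M' : Matrix ι ι ℂ}
    (hM : ∀ n, (M n).IsHermitian) (hM' : M'.IsHermitian) (hlim : Tendsto M l (𝓝 M'))
    {f : ℝ → ℝ} (hf : Continuous f) :
    Tendsto (fun n => spectralSum (fun z => (f z.re : ℂ)) (M n)) l
      (𝓝 (spectralSum (fun z => (f z.re : ℂ)) M')) := by
  set R := (M' ^ 2).trace.re + 1 with hR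
  have htr : ∀ p : Polynomial ℝ, Tendsto (fun n => (Polynomial.aeval (M n) p).trace) l
      (𝓝 (Polynomial.aeval M' p).trace) := fun p => by
    have hc : Continuous fun A : Matrix ι ι ℂ => (Polynomial.aeval A p).trace :=
      (Polynomial.continuous_aeval p).matrix_trace
    exact (hc.tendsto M').comp hlim
  have hb : ∀ᶠ n in l, ((M n) ^ 2).trace.re ≤ R := by
    have h2 := htr (Polynomial.X ^ 2)
    simp only [map_pow, Polynomial.aeval_X] at h2
    have h3 := (Complex.continuous_re.tendsto _).comp h2
    exact (h3.eventually_lt_const (show (M' ^ 2).trace.re < R by rw [hR]; linarith)).mono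
      fun n hn => hn.le
  have key : ∀ ε > 0, ∃ p : Polynomial ℝ, ∀ A : Matrix ι ι ℂ, A.IsHermitian →
      (A ^ 2).trace.re ≤ R → ‖spectralSum (fun z => (f z.re : ℂ)) A -
        (Polynomial.aeval A p).trace‖ ≤ ε := by
    intro ε hε
    obtain ⟨p, hp⟩ := exists_polynomial_near_of_continuousOn (-(R + 1)) (R + 1) f hf.continuousOn
      (ε / (Fintype.card ι + 1)) (by positivity)
    refine ⟨p, fun A hA hAR => ?_⟩
    rw [spectralSum_of_isHermitian _ hA, trace_aeval_of_isHermitian hA, ← Finset.sum_sub_distrib]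
    refine (norm_sum_le _ _).trans ?_
    have h4 : ∀ i ∈ Finset.univ, ‖((f (hA.eigenvalues i : ℂ).re : ℂ)) -
        ((p.eval (hA.eigenvalues i) : ℝ) : ℂ)‖ ≤ ε / (Fintype.card ι + 1) := by
      intro i _
      rw [Complex.ofReal_re, ← Complex.ofReal_sub, Complex.norm_real, Real.norm_eq_abs, abs_sub_comm]
      exact (hp _ (abs_le.mp (abs_eigenvalue_le hA hAR i))).le
    refine (Finset.sum_le_sum h4).trans ?_
    rw [Finset.sum_const, Finset.card_univ, nsmul_eq_mul, mul_div_assoc', div_le_iff₀ (by positivity)]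
    nlinarith
  rw [Metric.tendsto_nhds]
  intro ε hε
  obtain ⟨p, hp⟩ := key (ε / 4) (by positivity)
  filter_upwards [hb, Metric.tendsto_nhds.mp (htr p) (ε / 4) (by positivity)] with n hn1 hn2
  have h1 := hp (M n) (hM n) hn1
  have h2 := hp M' hM' (by rw [hR]; linarith)
  rw [dist_eq_norm] at hn2 ⊢
  have : spectralSum (fun z => (f z.re : ℂ)) (M n) - spectralSum (fun z => (f z.re : ℂ)) M' =
      (spectralSum (fun z => (f z.re : ℂ)) (M n) - (Polynomial.aeval (M n) p).trace) +
      ((Polynomial.aeval (M n) p).trace - (Polynomial.aeval M' p).trace) -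
      (spectralSum (fun z => (f z.re : ℂ)) M' - (Polynomial.aeval M' p).trace) := by ring
  rw [this]
  refine (norm_sub_le _ _).trans_lt ?_
  have := norm_add_le (spectralSum (fun z => (f z.re : ℂ)) (M n) - (Polynomial.aeval (M n) p).trace)
    ((Polynomial.aeval (M n) p).trace - (Polynomial.aeval M' p).trace)
  linarith

end Continuity

/-! ## The entropy dominates the particle number variance -/

/-- The two leading terms of the logarithm series give `-log(1-y) ≥ y + y²/2`; using this for `y =
x` and `y = 1 - x` yields `2 + 1/2`. The usual constant 2 would give only 4 in place of 5 at the
end, and no strict inequality at the cap `min(√d, 4) = 4`. -/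
theorem binEntropy_ge {x : ℝ} (h0 : 0 ≤ x) (h1 : x ≤ 1) :
    5 / 2 * (x * (1 - x)) ≤ Real.binEntropy x := by
  have key : ∀ y : ℝ, 0 ≤ y → y < 1 → y + y ^ 2 / 2 ≤ -Real.log (1 - y) := by
    intro y hy0 hy1
    have h := Real.hasSum_pow_div_log_of_abs_lt_one (x := y) (by rw [abs_of_nonneg hy0]; exact hy1)
    have h2 := h.summable.sum_le_tsum (Finset.range 2) (fun i _ => by positivity)
    rw [h.tsum_eq, Finset.sum_range_succ, Finset.sum_range_one] at h2
    norm_num at h2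
    linarith
  rcases h0.eq_or_lt with rfl | h0
  · simp
  rcases h1.eq_or_lt with rfl | h1
  · simp
  have ha := key (1 - x) (by linarith) (by linarith)
  have hb := key x h0.le h1
  rw [sub_sub_cancel] at ha
  rw [Real.binEntropy_eq_negMulLog_add_negMulLog_one_sub, Real.negMulLog, Real.negMulLog]
  nlinarith [mul_le_mul_of_nonneg_left ha h0.le, mul_le_mul_of_nonneg_left hb (sub_pos.mpr h1).le]

/-- Positivity of `C - C²` puts the eigenvalues in `[0, 1]`; then `binEntropy_ge` applies to each of
them, and the traces sum the results. -/
theorem spectralSum_modeEntropy_ge {ι : Type*} [Fintype ι] [DecidableEq ι] {C : Matrix ι ι ℂ}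
    (hC : C.IsHermitian) (hC' : (C - C * C).PosSemidef) :
    5 / 2 * (C.trace.re - (C * C).trace.re) ≤ (spectralSum modeEntropy C).re := by
  have hev : ∀ i, 0 ≤ hC.eigenvalues i * (1 - hC.eigenvalues i) := by
    intro i
    have h1 := hC'.re_dotProduct_nonneg (⇑(hC.eigenvectorBasis i))
    have h2 := hC.mulVec_eigenvectorBasis i
    have h3 : star ⇑(hC.eigenvectorBasis i) ⬝ᵥ ⇑(hC.eigenvectorBasis i) = 1 := by
      have := hC.eigenvectorBasis.orthonormal.1 i
      rw [dotProduct_comm, ← EuclideanSpace.inner_eq_star_dotProduct, inner_self_eq_norm_sq_to_K, this]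
      simp
    have h4 : (C - C * C).mulVec ⇑(hC.eigenvectorBasis i) =
        ((hC.eigenvalues i * (1 - hC.eigenvalues i) : ℝ) : ℂ) • ⇑(hC.eigenvectorBasis i) := by
      rw [Matrix.sub_mulVec, ← Matrix.mulVec_mulVec, h2, Matrix.mulVec_smul, h2]
      ext j
      simp
      ring
    rw [h4, dotProduct_smul, h3] at h1
    simpa using h1
  have h01 : ∀ i, 0 ≤ hC.eigenvalues i ∧ hC.eigenvalues i ≤ 1 := by
    intro i
    have := hev i
    constructor <;> nlinarith
  have ht1 := trace_pow_of_isHermitian hC 1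
  have ht2 := trace_pow_of_isHermitian hC 2
  rw [pow_one] at ht1
  rw [sq] at ht2
  rw [ht1, ht2, spectralSum_of_isHermitian _ hC, Complex.re_sum, Complex.re_sum, Complex.re_sum,
    ← Finset.sum_sub_distrib, Finset.mul_sum]
  refine Finset.sum_le_sum fun i _ => ?_
  have := binEntropy_ge (h01 i).1 (h01 i).2
  rw [← Complex.ofReal_pow, ← Complex.ofReal_pow, Complex.ofReal_re, Complex.ofReal_re, modeEntropy,
    Complex.ofReal_re, Complex.ofReal_re]
  nlinarith

/-! ## The thermodynamic limit of the correlation matrix -/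

section Limit

variable {d N : ℕ}

/-- The momentum `2π x`. -/
noncomputable def momentumOf (x : Fin d → ℝ) : Momentum d := WithLp.toLp 2 fun i => 2 * Real.pi * x i

theorem continuous_momentumOf : Continuous (momentumOf (d := d)) := by
  unfold momentumOf
  fun_prop

theorem continuous_phase (v : Fin d → ℤ) : Continuous fun k : Momentum d => phase k v := by
  unfold phase
  fun_prop

/-- The part of the unit cube where the band `ε` is filled. -/
def filledRegion (ε : Momentum d → ℂ) : Set (Fin d → ℝ) :=
  {x | (∀ i, x i ∈ Set.Ico (0 : ℝ) 1) ∧ (ε (momentumOf x)).re < 0}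

/-- The Fourier coefficients of the indicator of `{Re ε < 0}`. -/
noncomputable def fillCoeff (ε : Momentum d → ℂ) (v : Fin d → ℤ) : ℂ :=
  ∫ x in filledRegion ε, phase (momentumOf x) v

theorem measurableSet_filledRegion {ε : Momentum d → ℂ} (hε : Continuous ε) :
    MeasurableSet (filledRegion ε) := by
  refine MeasurableSet.inter ?_ ?_
  · exact MeasurableSet.univ_pi' fun i => measurableSet_Ico
  · exact (isOpen_lt (Complex.continuous_re.comp (hε.comp continuous_momentumOf))
      continuous_const).measurableSet

theorem isBounded_filledRegion (ε : Momentum d → ℂ) : Bornology.IsBounded (filledRegion ε) := by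
  refine (Metric.isBounded_Icc (0 : Fin d → ℝ) 1).subset fun x hx => ?_
  exact ⟨fun i => (hx.1 i).1, fun i => (hx.1 i).2.le⟩

/-- The points of the scaled integer lattice in the half-open cube are exactly the grid momenta,
each counted once; this brings the grid sum to the form of the Riemann sum theorem. -/
theorem sum_grid_eq_tsum (ε : Momentum d → ℂ) {Λ : ℕ} (hΛ : 0 < Λ) (F : (Fin d → ℝ) → ℝ) :
    (∑' x : ↑(filledRegion ε ∩ (Λ : ℝ)⁻¹ •
      (Submodule.span ℤ (Set.range (Pi.basisFun ℝ (Fin d))) : Set (Fin d → ℝ))), F x) =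
      ∑ n : Fin d → Fin Λ, if (ε (gridMomentum n)).re < 0 then
        F (fun i => ((n i : ℕ) : ℝ) / Λ) else 0 := by
  classical
  have : NeZero Λ := ⟨hΛ.ne'⟩
  have hΛ' : (0 : ℝ) < Λ := by exact_mod_cast hΛ
  have hmom : ∀ n : Fin d → Fin Λ, momentumOf (fun i => ((n i : ℕ) : ℝ) / Λ) = gridMomentum n := by
    intro n
    ext i
    simp only [momentumOf, gridMomentum]
    ring
  have hset : filledRegion ε ∩ (Λ : ℝ)⁻¹ •
      (Submodule.span ℤ (Set.range (Pi.basisFun ℝ (Fin d))) : Set (Fin d → ℝ)) =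
      ↑((Finset.univ.filter fun n : Fin d → Fin Λ => (ε (gridMomentum n)).re < 0).image
        fun n i => ((n i : ℕ) : ℝ) / (Λ : ℝ)) := by
    ext x
    simp only [Finset.coe_image, Finset.coe_filter, Finset.mem_univ, true_and, Set.mem_image,
      Set.mem_ofPred_eq]
    constructor
    · rintro ⟨hx, hx'⟩
      have h1 : ∀ i, (Λ : ℝ) * x i ∈ Set.range (algebraMap ℤ ℝ) :=
        BoxIntegral.unitPartition.mem_smul_span_iff.mp hx'
      choose a ha using h1
      have h2 : ∀ i, x i = (a i : ℝ) / Λ := by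
        intro i
        rw [eq_div_iff hΛ'.ne', mul_comm]
        exact (ha i).symm
      have h3 : ∀ i, 0 ≤ a i ∧ a i < Λ := by
        intro i
        have h4 := hx.1 i
        rw [h2 i] at h4
        constructor
        · have := h4.1
          rw [le_div_iff₀ hΛ', zero_mul] at this
          exact_mod_cast this
        · have := h4.2
          rw [div_lt_iff₀ hΛ', one_mul] at this
          exact_mod_cast this
      have h5 : x = fun i => (((⟨(a i).toNat, by have := h3 i; omega⟩ : Fin Λ) : ℕ) : ℝ) / Λ := by
        funext i
        rw [h2 i]
        congr 1
        have : ((a i).toNat : ℤ) = a i := Int.toNat_of_nonneg (h3 i).1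
        exact_mod_cast this.symm
      refine ⟨fun i => ⟨(a i).toNat, by have := h3 i; omega⟩, ?_, h5.symm⟩
      rw [← hmom, ← h5]
      exact hx.2
    · rintro ⟨n, hn, rfl⟩
      refine ⟨⟨fun i => ⟨by positivity, ?_⟩, ?_⟩, ?_⟩
      · rw [div_lt_one hΛ']
        exact_mod_cast (n i).2
      · rwa [hmom]
      · refine BoxIntegral.unitPartition.mem_smul_span_iff.mpr fun i => ⟨((n i : ℕ) : ℤ), ?_⟩
        field_simp
        simp
  rw [hset, Finset.tsum_subtype' _ F, Finset.sum_image, Finset.sum_filter]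
  intro n _ n' _ h
  funext i
  have := congrFun h i
  simp only at this
  rw [div_left_inj' hΛ'.ne'] at this
  exact Fin.ext (by exact_mod_cast this)

theorem integrableOn_phase {ε : Momentum d → ℂ} (v : Fin d → ℤ) :
    IntegrableOn (fun x => phase (momentumOf x) v) (filledRegion ε) := by
  have hK : IsCompact (Set.Icc (0 : Fin d → ℝ) 1) := isCompact_Icc
  refine (((continuous_phase v).comp continuous_momentumOf).continuousOn.integrableOn_compact
    hK).mono_set fun x hx => ⟨fun i => (hx.1 i).1, fun i => (hx.1 i).2.le⟩

/-- Riemann sums of a continuous function over a bounded region converge when the boundary of the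
region is null; real and imaginary parts are treated separately. -/
theorem tendsto_gridCoeff {ε : Momentum d → ℂ} (hε : Continuous ε)
    (hfr : volume (frontier (filledRegion ε)) = 0) (v : Fin d → ℤ) :
    Tendsto (fun Λ => gridCoeff ε Λ v) atTop (𝓝 (fillCoeff ε v)) := by
  have hcont : Continuous fun x : Fin d → ℝ => phase (momentumOf x) v :=
    (continuous_phase v).comp continuous_momentumOf
  have hmom : ∀ (Λ : ℕ) (n : Fin d → Fin Λ),
      momentumOf (fun i => ((n i : ℕ) : ℝ) / Λ) = gridMomentum n := by
    intro Λ n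
    ext i
    simp only [momentumOf, gridMomentum]
    ring
  have hre := tendsto_tsum_div_pow_atTop_integral (filledRegion ε)
    (fun x => (phase (momentumOf x) v).re) (Complex.continuous_re.comp hcont)
    (isBounded_filledRegion ε) (measurableSet_filledRegion hε) hfr
  have him := tendsto_tsum_div_pow_atTop_integral (filledRegion ε)
    (fun x => (phase (momentumOf x) v).im) (Complex.continuous_im.comp hcont)
    (isBounded_filledRegion ε) (measurableSet_filledRegion hε) hfr
  have h1 : ∫ x in filledRegion ε, (phase (momentumOf x) v).re = (fillCoeff ε v).re :=
    integral_re (integrableOn_phase v)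
  have h2 : ∫ x in filledRegion ε, (phase (momentumOf x) v).im = (fillCoeff ε v).im :=
    integral_im (integrableOn_phase v)
  rw [h1] at hre
  rw [h2] at him
  have h3 := ((Complex.continuous_ofReal.tendsto _).comp hre).add
    (((Complex.continuous_ofReal.tendsto _).comp him).mul_const Complex.I)
  rw [Complex.re_add_im] at h3
  refine h3.congr' ?_
  filter_upwards [eventually_gt_atTop 0] with Λ hΛ
  simp only [Function.comp_apply]
  rw [sum_grid_eq_tsum ε hΛ (fun x => (phase (momentumOf x) v).re),
    sum_grid_eq_tsum ε hΛ (fun x => (phase (momentumOf x) v).im), Fintype.card_fin, gridCoeff]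
  simp only [hmom]
  push_cast
  rw [div_eq_inv_mul, div_eq_inv_mul, mul_assoc, ← mul_add, Finset.sum_mul,
    ← Finset.sum_add_distrib]
  congr 1
  refine Finset.sum_congr rfl fun n _ => ?_
  split_ifs
  · rw [Complex.re_add_im]
  · simp

theorem gridCoeff_neg (ε : Momentum d → ℂ) (Λ : ℕ) (v : Fin d → ℤ) :
    gridCoeff ε Λ (-v) = starRingEnd ℂ (gridCoeff ε Λ v) := by
  simp only [gridCoeff, map_mul, map_sum, map_inv₀, map_pow, Complex.conj_natCast, phase_neg]
  congr 1
  refine Finset.sum_congr rfl fun n _ => ?_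
  split_ifs <;> simp

theorem fillCoeff_neg (ε : Momentum d → ℂ) (v : Fin d → ℤ) :
    fillCoeff ε (-v) = starRingEnd ℂ (fillCoeff ε v) := by
  rw [fillCoeff, fillCoeff, ← integral_conj]
  simp only [phase_neg]

theorem toeplitz_isHermitian {L : ℕ} {a : Fin N → (Fin d → ℤ) → ℂ}
    (ha : ∀ α v, a α (-v) = starRingEnd ℂ (a α v)) : (toeplitz L a).IsHermitian := by
  ext p q
  simp only [toeplitz, Matrix.conjTranspose_apply, Matrix.of_apply]
  by_cases h : p.2 = q.2
  · rw [if_pos h, if_pos h.symm, ← neg_sub (siteVector p.1) (siteVector q.1), ha, h]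
    simp
  · rw [if_neg h, if_neg (Ne.symm h), star_zero]

/-- On the whole torus the filled orbitals define an orthogonal projection `F`. For its compression
`C` to the cube, `C - C² = B B*`, where `B` is the block of `F` between the cube and the outside. -/
theorem gridToeplitz_posSemidef (E : Fin N → Momentum d → ℂ) {Λ L : ℕ} (hΛ : 0 < Λ) (h : L ≤ Λ) :
    (toeplitz L (fun α => gridCoeff (E α) Λ) - toeplitz L (fun α => gridCoeff (E α) Λ) *
      toeplitz L (fun α => gridCoeff (E α) Λ)).PosSemidef := by
  classical
  let F : Mode d N Λ → Mode d N Λ → ℂ := fun p q =>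
    ∑ j, groundOrbitals E Λ j p * starRingEnd ℂ (groundOrbitals E Λ j q)
  have hFF : ∀ p q, ∑ r, F p r * F r q = F p q := by
    intro p q
    simp only [F, Finset.sum_mul_sum]
    rw [Finset.sum_comm]
    refine Finset.sum_congr rfl fun i _ => ?_
    rw [Finset.sum_comm, Finset.sum_eq_single i]
    · have := sum_bandOrbital hΛ ((filledModes E Λ).equivFin.symm i : Mode d N Λ)
        ((filledModes E Λ).equivFin.symm i : Mode d N Λ)
      rw [if_pos rfl] at this
      calc _ = (groundOrbitals E Λ i p * starRingEnd ℂ (groundOrbitals E Λ i q)) *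
          ∑ r, groundOrbitals E Λ i r * starRingEnd ℂ (groundOrbitals E Λ i r) := by
            rw [Finset.mul_sum]
            exact Finset.sum_congr rfl fun r _ => by ring
        _ = _ := by
            simp only [groundOrbitals]
            rw [this, mul_one]
    · intro j _ hj
      have := sum_bandOrbital hΛ ((filledModes E Λ).equivFin.symm j : Mode d N Λ)
        ((filledModes E Λ).equivFin.symm i : Mode d N Λ)
      rw [if_neg (by simpa [Subtype.ext_iff] using hj)] at this
      calc _ = (groundOrbitals E Λ i p * starRingEnd ℂ (groundOrbitals E Λ j q)) *
          ∑ r, groundOrbitals E Λ j r * starRingEnd ℂ (groundOrbitals E Λ i r) := by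
            rw [Finset.mul_sum]
            exact Finset.sum_congr rfl fun r _ => by ring
        _ = _ := by
            simp only [groundOrbitals]
            rw [this, mul_zero]
    · simp
  have hFstar : ∀ p q, starRingEnd ℂ (F p q) = F q p := by
    intro p q
    simp only [F, map_sum, map_mul, Complex.conj_conj]
    exact Finset.sum_congr rfl fun i _ => mul_comm _ _
  have hT : ∀ p q, toeplitz L (fun α => gridCoeff (E α) Λ) p q =
      F (cubeEquiv h p).1 (cubeEquiv h q).1 := by
    intro p q
    exact (correlationMatrix_groundOrbitals E Λ (cube d N Λ L) (cubeEquiv h p)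
      (cubeEquiv h q)).symm
  let B : Matrix ((Fin d → Fin L) × Fin N) {p // p ∉ cube d N Λ L} ℂ :=
    Matrix.of fun p r => F (cubeEquiv h p).1 r
  have hB : toeplitz L (fun α => gridCoeff (E α) Λ) - toeplitz L (fun α => gridCoeff (E α) Λ) *
      toeplitz L (fun α => gridCoeff (E α) Λ) = B * B.conjTranspose := by
    ext p q
    rw [Matrix.sub_apply, Matrix.mul_apply, Matrix.mul_apply, sub_eq_iff_eq_add]
    simp only [hT, B, Matrix.conjTranspose_apply, Matrix.of_apply, RCLike.star_def, hFstar]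
    rw [← hFF, (cubeEquiv h).sum_comp (fun r : {p // p ∈ cube d N Λ L} =>
      F (cubeEquiv h p).1 r * F r (cubeEquiv h q).1), add_comm]
    symm
    convert Fintype.sum_subtype_add_sum_subtype (fun r => r ∈ cube d N Λ L)
      (fun r => F (cubeEquiv h p).1 r * F r (cubeEquiv h q).1)
  rw [hB]
  exact Matrix.posSemidef_self_mul_conjTranspose B

/-- The entropy of the cube in the thermodynamic limit. -/
noncomputable def limitEntropy (E : Fin N → Momentum d → ℂ) (L : ℕ) : ℝ :=
  (spectralSum modeEntropy (toeplitz L fun α => fillCoeff (E α))).re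

theorem ofReal_limitEntropy (E : Fin N → Momentum d → ℂ) (L : ℕ) :
    (limitEntropy E L : ℂ) = spectralSum modeEntropy (toeplitz L fun α => fillCoeff (E α)) := by
  rw [limitEntropy, spectralSum_of_isHermitian _
    (toeplitz_isHermitian fun α v => fillCoeff_neg (E α) v)]
  simp [modeEntropy, Complex.re_sum]

theorem tendsto_toeplitz {E : Fin N → Momentum d → ℂ} (hE : ∀ α, Continuous (E α))
    (hfr : ∀ α, volume (frontier (filledRegion (E α))) = 0) (L : ℕ) :
    Tendsto (fun Λ => toeplitz L fun α => gridCoeff (E α) Λ) atTop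
      (𝓝 (toeplitz L fun α => fillCoeff (E α))) := by
  refine tendsto_pi_nhds.mpr fun p => tendsto_pi_nhds.mpr fun q => ?_
  by_cases h : p.2 = q.2
  · simpa [toeplitz, h] using tendsto_gridCoeff (hE q.2) (hfr q.2) _
  · simp [toeplitz, h]

theorem tendsto_groundEntropy {E : Fin N → Momentum d → ℂ} (hE : ∀ α, Continuous (E α))
    (hfr : ∀ α, volume (frontier (filledRegion (E α))) = 0) (L : ℕ) :
    Tendsto (fun Λ => groundEntropy E Λ L) atTop (𝓝 (limitEntropy E L : ℂ)) := by
  rw [ofReal_limitEntropy]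
  refine (tendsto_spectralSum (f := Real.binEntropy)
    (fun Λ => toeplitz_isHermitian fun α v => gridCoeff_neg (E α) Λ v)
    (toeplitz_isHermitian fun α v => fillCoeff_neg (E α) v)
    (tendsto_toeplitz hE hfr L) Real.binEntropy_continuous).congr' ?_
  filter_upwards [eventually_ge_atTop L, eventually_gt_atTop 0] with Λ h1 h2
  exact (groundEntropy_eq E h2 h1).symm

/-- The projection property is used on the finite torus, and the resulting inequality passes to the
limit. -/
theorem limitEntropy_ge {E : Fin N → Momentum d → ℂ} (hE : ∀ α, Continuous (E α))
    (hfr : ∀ α, volume (frontier (filledRegion (E α))) = 0) (L : ℕ) :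
    5 / 2 * ((toeplitz L fun α => fillCoeff (E α)).trace.re -
      ((toeplitz L fun α => fillCoeff (E α)) * toeplitz L fun α => fillCoeff (E α)).trace.re) ≤
      limitEntropy E L := by
  have h1 := (Complex.continuous_re.tendsto _).comp (tendsto_groundEntropy hE hfr L)
  have hT := tendsto_toeplitz hE hfr L
  have hc : Continuous fun M : Matrix ((Fin d → Fin L) × Fin N) ((Fin d → Fin L) × Fin N) ℂ =>
      5 / 2 * (M.trace.re - (M * M).trace.re) := by fun_prop
  have h2 := (hc.tendsto _).comp hT
  refine le_of_tendsto_of_tendsto h2 h1 ?_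
  filter_upwards [eventually_ge_atTop L, eventually_gt_atTop 0] with Λ h3 h4
  simp only [Function.comp_apply]
  rw [groundEntropy_eq E h4 h3]
  exact spectralSum_modeEntropy_ge (toeplitz_isHermitian fun α v => gridCoeff_neg (E α) Λ v)
    (gridToeplitz_posSemidef E h4 h3)

end Limit

end FreeFermion

namespace FreeFermion

open Filter Topology MeasureTheory
open scoped ENNReal NNReal RealInnerProductSpace

/-! ## Hypersurfaces with a cone condition -/

section Hausdorff

variable {X Y : Type*} [MetricSpace X] [MeasurableSpace X] [BorelSpace X]
  [MetricSpace Y] [MeasurableSpace Y] [BorelSpace Y]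

theorem euclideanHausdorffMeasure_image_le {K : ℝ≥0} {g : X → Y} {s : Set X}
    (hg : LipschitzOnWith K g s) (m : ℕ) : μHE[m] (g '' s) ≤ (K : ℝ≥0∞) ^ m * μHE[m] s := by
  have h := hg.hausdorffMeasure_image_le (d := (m : ℝ)) (Nat.cast_nonneg m)
  rw [Measure.euclideanHausdorffMeasure_def, Measure.euclideanHausdorffMeasure_def,
    Measure.smul_apply, Measure.smul_apply, ENNReal.smul_def, ENNReal.smul_def, smul_eq_mul,
    smul_eq_mul, mul_left_comm]
  rw [ENNReal.rpow_natCast] at h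
  gcongr

theorem euclideanHausdorffMeasure_le_image [Nonempty X] {K : ℝ≥0} {g : X → Y} {s : Set X}
    (hg : ∀ x ∈ s, ∀ y ∈ s, dist x y ≤ K * dist (g x) (g y)) (m : ℕ) :
    μHE[m] s ≤ (K : ℝ≥0∞) ^ m * μHE[m] (g '' s) := by
  have hinj : Set.InjOn g s := by
    intro x hx y hy hxy
    have := hg x hx y hy
    rw [hxy, dist_self, mul_zero] at this
    exact dist_le_zero.mp this
  have hleft := hinj.leftInvOn_invFunOn
  have hL : LipschitzOnWith K (Function.invFunOn g s) (g '' s) := by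
    refine LipschitzOnWith.of_dist_le_mul ?_
    rintro _ ⟨x, hx, rfl⟩ _ ⟨y, hy, rfl⟩
    rw [hleft hx, hleft hy]
    exact hg x hx y hy
  have h := euclideanHausdorffMeasure_image_le hL m
  rwa [hinj.invFunOn_image subset_rfl] at h

end Hausdorff

/-! ### Zero sets as Lipschitz graphs over the hyperplane orthogonal to a normal. -/

section Cone

variable {d : ℕ}

/-- Near `p` the hypersurface `{f = 0}` has a normal `n` up to the aperture `ε`. -/
def ConeCondition (f : Momentum d → ℝ) (n : Momentum d) (ε : ℝ) (U : Set (Momentum d)) : Prop :=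
  ∀ x ∈ U, f x = 0 → ∀ y ∈ U,
    (ε * ‖y - x‖ < ⟪n, y - x⟫ → 0 < f y) ∧ (⟪n, y - x⟫ < -(ε * ‖y - x‖) → f y < 0)

/-- The normal is the normalized gradient at `p`. Strict differentiability compares `f y - f x` with
the linear part for all pairs near `p`, so this one normal serves every zero in the ball. -/
theorem exists_coneCondition {f : Momentum d → ℝ} {p : Momentum d} (hf : ContDiffAt ℝ 1 f p)
    (hf' : fderiv ℝ f p ≠ 0) {ε : ℝ} (hε : 0 < ε) :
    ∃ n : Momentum d, ‖n‖ = 1 ∧ ∃ r > 0, ConeCondition f n ε (Metric.ball p r) := by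
  set g : Momentum d := (InnerProductSpace.toDual ℝ (Momentum d)).symm (fderiv ℝ f p) with hg
  have hg0 : 0 < ‖g‖ := by
    rw [hg, LinearIsometryEquiv.norm_map]
    exact norm_pos_iff.mpr hf'
  have hgv : ∀ v, fderiv ℝ f p v = ⟪g, v⟫ := fun v =>
    (InnerProductSpace.toDual_symm_apply).symm
  have hs := hf.hasStrictFDerivAt one_ne_zero
  have ho := (hs.isLittleO).def (c := ε * ‖g‖ / 2) (by positivity)
  rw [Metric.eventually_nhds_iff] at ho
  obtain ⟨r, hr, hball⟩ := ho
  refine ⟨‖g‖⁻¹ • g, by rw [norm_smul, norm_inv, norm_norm, inv_mul_cancel₀ hg0.ne'], r, hr, ?_⟩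
  intro x hx hfx y hy
  have h1 := hball (y := (y, x)) (by
    rw [Prod.dist_eq]; exact max_lt hy hx)
  simp only [hgv, hfx, sub_zero] at h1
  have hin : ⟪‖g‖⁻¹ • g, y - x⟫ = ‖g‖⁻¹ * ⟪g, y - x⟫ := by
    rw [inner_smul_left]; simp
  rw [Real.norm_eq_abs, abs_le] at h1
  have h4 : 0 ≤ ε * ‖g‖ * ‖y - x‖ := by positivity
  rw [hin]
  constructor
  · intro h2
    rw [lt_inv_mul_iff₀ hg0] at h2
    nlinarith [h1.1]
  · intro h2
    rw [inv_mul_lt_iff₀ hg0] at h2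
    nlinarith [h1.2]

theorem ConeCondition.abs_inner_le {f : Momentum d → ℝ} {n : Momentum d} {ε : ℝ}
    {U : Set (Momentum d)} (h : ConeCondition f n ε U) {x y : Momentum d} (hx : x ∈ U)
    (hy : y ∈ U) (hfx : f x = 0) (hfy : f y = 0) : |⟪n, x - y⟫| ≤ ε * ‖x - y‖ := by
  have h1 := h y hy hfy x hx
  rw [abs_le]
  constructor
  · by_contra! hc
    exact absurd (h1.2 hc) (by rw [hfx]; exact lt_irrefl 0)
  · by_contra! hc
    exact absurd (h1.1 hc) (by rw [hfx]; exact lt_irrefl 0)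

/-- The orthogonal projection along `n`. -/
noncomputable def projAlong (n : Momentum d) : Momentum d →L[ℝ] (ℝ ∙ n)ᗮ :=
  (ℝ ∙ n)ᗮ.orthogonalProjectionOnto

theorem self_eq_projAlong_add {n : Momentum d} (hn : ‖n‖ = 1) (v : Momentum d) :
    v = (projAlong n v : Momentum d) + ⟪n, v⟫ • n := by
  have h1 := (ℝ ∙ n).starProjection_add_starProjection_orthogonal v
  have h2 : (ℝ ∙ n).starProjection v = ⟪n, v⟫ • n :=
    Submodule.starProjection_unit_singleton ℝ hn v
  rw [h2] at h1
  rw [add_comm]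
  exact h1.symm

theorem norm_projAlong_ge {n : Momentum d} (hn : ‖n‖ = 1) (v : Momentum d) :
    ‖v‖ ≤ ‖projAlong n v‖ + |⟪n, v⟫| := by
  conv_lhs => rw [self_eq_projAlong_add hn v]
  refine (norm_add_le _ _).trans (le_of_eq ?_)
  rw [norm_smul, hn, mul_one, Real.norm_eq_abs, Submodule.coe_norm]

theorem finrank_orthogonal (hd : 0 < d) {n : Momentum d} (hn : ‖n‖ = 1) :
    Module.finrank ℝ (ℝ ∙ n)ᗮ = d - 1 := by
  have : Fact (Module.finrank ℝ (Momentum d) = (d - 1) + 1) := ⟨by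
    rw [finrank_euclideanSpace_fin]; omega⟩
  exact Submodule.finrank_orthogonal_span_singleton (n := d - 1)
    (fun h => by rw [h, norm_zero] at hn; exact zero_ne_one hn)

theorem euclideanHausdorffMeasure_orthogonal (hd : 0 < d) {n : Momentum d} (hn : ‖n‖ = 1) :
    (μHE[d - 1] : Measure (ℝ ∙ n)ᗮ) = volume := by
  rw [← finrank_orthogonal hd hn]
  exact InnerProductSpace.euclideanHausdorffMeasure_eq_volume

/-- The projection along `n` contracts distances within `S` by at most the factor `1 - ε`, so its
inverse on the image is Lipschitz. -/
theorem measure_zeros_le_volume (hd : 0 < d) {n : Momentum d} (hn : ‖n‖ = 1) {ε : ℝ} (hε : ε < 1)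
    {S : Set (Momentum d)} (hS : ∀ x ∈ S, ∀ y ∈ S, |⟪n, x - y⟫| ≤ ε * ‖x - y‖) :
    μHE[d - 1] S ≤ ENNReal.ofReal ((1 - ε)⁻¹ ^ (d - 1)) * volume (projAlong n '' S) := by
  have h1 : (0 : ℝ) < (1 - ε)⁻¹ := inv_pos.mpr (by linarith)
  have h := euclideanHausdorffMeasure_le_image (K := (1 - ε)⁻¹.toNNReal) (g := projAlong n) (s := S)
    (fun x hx y hy => by
      rw [Real.coe_toNNReal _ h1.le, dist_eq_norm, dist_eq_norm, ← map_sub,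
        le_inv_mul_iff₀ (by linarith)]
      have := norm_projAlong_ge hn (x - y)
      have := hS x hx y hy
      linarith) (d - 1)
  rw [euclideanHausdorffMeasure_orthogonal hd hn] at h
  rwa [ENNReal.ofReal_pow h1.le]

theorem volume_le_measure_zeros (hd : 0 < d) {n : Momentum d} (hn : ‖n‖ = 1)
    (S : Set (Momentum d)) : volume (projAlong n '' S) ≤ μHE[d - 1] S := by
  have hL : LipschitzOnWith 1 (projAlong n) S := by
    refine LipschitzOnWith.of_dist_le_mul fun x _ y _ => ?_
    rw [dist_eq_norm, dist_eq_norm, ← map_sub, NNReal.coe_one, one_mul]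
    exact Submodule.norm_orthogonalProjectionOnto_apply_le _ _
  have h := euclideanHausdorffMeasure_image_le hL (d - 1)
  rwa [euclideanHausdorffMeasure_orthogonal hd hn, ENNReal.coe_one, one_pow, one_mul] at h

theorem measure_zeros_lt_top (hd : 0 < d) {f : Momentum d → ℝ} {n : Momentum d} (hn : ‖n‖ = 1)
    {p : Momentum d} {r ε : ℝ} (hε : ε < 1) (h : ConeCondition f n ε (Metric.ball p r)) :
    μHE[d - 1] ({k | f k = 0} ∩ Metric.ball p r) < ⊤ := by
  refine (measure_zeros_le_volume hd hn hε fun x hx y hy =>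
    h.abs_inner_le hx.2 hy.2 hx.1 hy.1).trans_lt ?_
  refine ENNReal.mul_lt_top ENNReal.ofReal_lt_top ?_
  refine Bornology.IsBounded.measure_lt_top ?_
  exact ((projAlong n).lipschitz.isBounded_image
    (Metric.isBounded_ball.subset Set.inter_subset_right))

theorem projAlong_coe {n : Momentum d} (w : (ℝ ∙ n)ᗮ) : projAlong n (w : Momentum d) = w :=
  Submodule.orthogonalProjectionOnto_mem_subspace_eq_self w

theorem projAlong_smul {n : Momentum d} (s : ℝ) : projAlong n (s • n) = 0 := by
  refine Submodule.orthogonalProjectionOnto_apply_of_mem_orthogonal ?_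
  rw [Submodule.orthogonal_orthogonal]
  exact Submodule.smul_mem _ _ (Submodule.mem_span_singleton_self n)

theorem inner_coe_orthogonal {n : Momentum d} (w : (ℝ ∙ n)ᗮ) : ⟪n, (w : Momentum d)⟫ = 0 :=
  Submodule.mem_orthogonal_singleton_iff_inner_right.mp w.2

/-- On each line parallel to `n` near `p`, the points at heights `± r/2` lie in the two cones with
vertex `p`, so `f` changes sign between them. The zeros therefore project onto a full ball of the
hyperplane. -/
theorem measure_zeros_pos (hd : 0 < d) {f : Momentum d → ℝ} (hf : Continuous f) {n : Momentum d}
    (hn : ‖n‖ = 1) {p : Momentum d} (hp : f p = 0) {r ε : ℝ} (hr : 0 < r) (hε0 : 0 < ε)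
    (hε : ε ≤ 1 / 2) (h : ConeCondition f n ε (Metric.ball p r)) :
    0 < μHE[d - 1] ({k | f k = 0} ∩ Metric.ball p r) := by
  refine lt_of_lt_of_le ?_ (volume_le_measure_zeros hd hn _)
  refine (Metric.measure_ball_pos volume (projAlong n p) (show (0 : ℝ) < r / 4 by positivity)).trans_le
    (measure_mono ?_)
  intro w hw
  rw [Metric.mem_ball, dist_eq_norm] at hw
  let y : ℝ → Momentum d := fun t => (w : Momentum d) + (⟪n, p⟫ + t) • n
  have hyp : ∀ t, y t - p = ((w - projAlong n p : (ℝ ∙ n)ᗮ) : Momentum d) + t • n := by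
    intro t
    simp only [y, Submodule.coe_sub, add_smul]
    rw [sub_eq_iff_eq_add]
    calc (w : Momentum d) + (⟪n, p⟫ • n + t • n)
        = w - projAlong n p + t • n + (projAlong n p + ⟪n, p⟫ • n) := by abel
      _ = _ := by rw [← self_eq_projAlong_add hn p]
  have hin : ∀ t, ⟪n, y t - p⟫ = t := by
    intro t
    rw [hyp, inner_add_right, inner_coe_orthogonal, inner_smul_right, real_inner_self_eq_norm_sq, hn]
    ring
  have hnorm : ∀ t, ‖y t - p‖ < r / 4 + |t| := by
    intro t
    rw [hyp]
    refine (norm_add_le _ _).trans_lt ?_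
    rw [norm_smul, hn, mul_one, Real.norm_eq_abs]
    have : ‖((w - projAlong n p : (ℝ ∙ n)ᗮ) : Momentum d)‖ < r / 4 := hw
    linarith
  have hmem : ∀ t, |t| ≤ r / 2 → y t ∈ Metric.ball p r := by
    intro t ht
    rw [Metric.mem_ball, dist_eq_norm]
    linarith [hnorm t]
  have hp' : p ∈ Metric.ball p r := Metric.mem_ball_self hr
  have hr2 : |r / 2| = r / 2 := abs_of_pos (by positivity)
  have hpos : 0 < f (y (r / 2)) := by
    refine (h p hp' hp _ (hmem _ hr2.le)).1 ?_
    rw [hin]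
    have := hnorm (r / 2)
    rw [hr2] at this
    nlinarith
  have hneg : f (y (-(r / 2))) < 0 := by
    refine (h p hp' hp _ (hmem _ (by rw [abs_neg]; exact hr2.le))).2 ?_
    rw [hin]
    have := hnorm (-(r / 2))
    rw [abs_neg, hr2] at this
    nlinarith
  have hyc : Continuous y := by fun_prop
  obtain ⟨t, ht, hft⟩ := intermediate_value_Icc (show -(r / 2) ≤ r / 2 by linarith)
    (hf.comp hyc).continuousOn ⟨hneg.le, hpos.le⟩
  refine ⟨y t, ⟨hft, hmem t (abs_le.mpr ht)⟩, ?_⟩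
  simp only [y]
  rw [map_add, projAlong_coe, projAlong_smul, add_zero]

/-- A set whose lines along `n` over `W` have length at least `c`. -/
theorem volume_ge_of_lines {n : Momentum d} (hn : ‖n‖ = 1) {T : Set (Momentum d)}
    (hT : MeasurableSet T) (W : Set (ℝ ∙ n)ᗮ) {c : ℝ≥0∞}
    (hc : ∀ w ∈ W, c ≤ volume {s : ℝ | (w : Momentum d) + s • n ∈ T}) :
    c * volume W ≤ volume T := by
  -- Tonelli for the orthogonal splitting into the line of `n` and its complement; the unit vector
  -- `n` identifies the line isometrically with `ℝ`.
  have hmp := ((ℝ ∙ n).measurePreserving_measurableEquivProd (0 : Momentum d)).symm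
  rw [InnerProductSpace.euclideanHausdorffMeasure_eq_volume] at hmp
  let e := (ℝ ∙ n).measurableEquivProd (0 : Momentum d)
  have h1 : volume T = volume (e.symm ⁻¹' T) := (hmp.measure_preimage_equiv T).symm
  have h2 : volume (e.symm ⁻¹' T) = ∫⁻ w : (ℝ ∙ n)ᗮ, volume ((fun x => (x, w)) ⁻¹' (e.symm ⁻¹' T)) :=
    Measure.prod_apply_symm (e.symm.measurable hT)
  have h3 : ∀ w : (ℝ ∙ n)ᗮ, volume ((fun x => (x, w)) ⁻¹' (e.symm ⁻¹' T)) =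
      volume {s : ℝ | (w : Momentum d) + s • n ∈ T} := by
    intro w
    have hm := (LinearIsometryEquiv.toSpanUnitSingleton n hn).measurePreserving
    rw [← hm.measure_preimage]
    · congr 1
      ext s
      simp only [Set.mem_preimage, Set.mem_ofPred_eq, e, Submodule.measurableEquivProd_symm_apply,
        vadd_eq_add, add_zero, LinearIsometryEquiv.toSpanUnitSingleton_apply]
      rw [add_comm]
    · exact ((measurable_prodMk_right (y := w)) (e.symm.measurable hT)).nullMeasurableSet
  have hmeas : Measurable fun w : (ℝ ∙ n)ᗮ => volume ((fun x => (x, w)) ⁻¹' (e.symm ⁻¹' T)) :=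
    measurable_measure_prodMk_right (e.symm.measurable hT)
  rw [h1, h2]
  simp only [h3] at hmeas ⊢
  calc c * volume W = ∫⁻ _ in W, c := by rw [setLIntegral_const]
    _ ≤ ∫⁻ w in W, volume {s : ℝ | (w : Momentum d) + s • n ∈ T} := by
        exact setLIntegral_mono hmeas hc
    _ ≤ _ := setLIntegral_le_lintegral _ _

end Cone

end FreeFermion

namespace FreeFermion

open Filter Topology MeasureTheory
open scoped ENNReal NNReal RealInnerProductSpace

/-! ## Translates of a domain with a smooth boundary -/

section Shift

variable {d : ℕ}

/-- The points where the sign of `f` changes under a translation by `v`. -/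
def shiftSet (f : Momentum d → ℝ) (v : Momentum d) : Set (Momentum d) :=
  {k | ¬(0 < f k ↔ 0 < f (k + v))}

theorem measurableSet_shiftSet {f : Momentum d → ℝ} (hf : Continuous f) (v : Momentum d) :
    MeasurableSet (shiftSet f v) := by
  have h1 : MeasurableSet {k | 0 < f k} := (isOpen_lt continuous_const hf).measurableSet
  have h2 : MeasurableSet {k | 0 < f (k + v)} :=
    (isOpen_lt continuous_const (hf.comp (continuous_id.add continuous_const))).measurableSet
  exact (h1.iff h2).compl

/-- Along `z + s n` the sign of `f` is that of `s`. After the translation by `t e` it is that of `s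
+ t⟪n,e⟫`, as soon as this exceeds `2 ε t` in absolute value. The two signs differ on an interval of
length `t(|⟪n,e⟫| - 2ε)` on one side of `z`. -/
theorem ConeCondition.line_ge {f : Momentum d → ℝ} {n : Momentum d} {ε : ℝ}
    {U : Set (Momentum d)} (h : ConeCondition f n ε U) (hn : ‖n‖ = 1) (hε0 : 0 < ε) (hε : ε < 1)
    {e : Momentum d} (he : ‖e‖ = 1) {t : ℝ} (ht : 0 < t) {z : Momentum d} (hz : z ∈ U)
    (hfz : f z = 0) {T : Set (Momentum d)}
    (hT : ∀ s, |s| ≤ t → z + s • n ∈ T ∧ z + s • n ∈ U ∧ z + s • n + t • e ∈ U) :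
    ENNReal.ofReal (t * (|⟪n, e⟫| - 2 * ε)) ≤
      volume {s : ℝ | (projAlong n z : Momentum d) + s • n ∈ shiftSet f (t • e) ∩ T} := by
  set a := ⟪n, e⟫ with ha
  have ha1 : |a| ≤ 1 := by
    have := abs_real_inner_le_norm n e
    rwa [hn, he, mul_one] at this
  set c := t * (|a| - 2 * ε) with hc
  rcases le_or_gt c 0 with hc0 | hc0
  · rw [ENNReal.ofReal_of_nonpos hc0]; exact zero_le
  have hct : c ≤ t := by rw [hc]; nlinarith
  have hpt : ∀ s : ℝ, (projAlong n z : Momentum d) + (⟪n, z⟫ + s) • n = z + s • n := by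
    intro s
    conv_rhs => rw [self_eq_projAlong_add hn z]
    rw [add_smul, add_assoc]
  have hi1 : ∀ s : ℝ, ⟪n, z + s • n - z⟫ = s := by
    intro s
    rw [add_sub_cancel_left, inner_smul_right, real_inner_self_eq_norm_sq, hn]; ring
  have hi2 : ∀ s : ℝ, ‖z + s • n - z‖ = |s| := by
    intro s
    rw [add_sub_cancel_left, norm_smul, hn, mul_one, Real.norm_eq_abs]
  have hi3 : ∀ s : ℝ, ⟪n, z + s • n + t • e - z⟫ = s + t * a := by
    intro s
    rw [show z + s • n + t • e - z = s • n + t • e by abel, inner_add_right, inner_smul_right,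
      inner_smul_right, real_inner_self_eq_norm_sq, hn]; ring
  have hi4 : ∀ s : ℝ, ‖z + s • n + t • e - z‖ ≤ |s| + t := by
    intro s
    rw [show z + s • n + t • e - z = s • n + t • e by abel]
    refine (norm_add_le _ _).trans ?_
    rw [norm_smul, norm_smul, hn, he, mul_one, mul_one, Real.norm_eq_abs, Real.norm_eq_abs,
      abs_of_pos ht]
  rcases le_or_gt a 0 with ha0 | ha0
  · have hvol : ENNReal.ofReal c = volume (Set.Ioo ⟪n, z⟫ (⟪n, z⟫ + c)) := by
      rw [Real.volume_Ioo]; congr 1; ring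
    rw [hvol]
    refine measure_mono fun s hs => ?_
    obtain ⟨s, rfl⟩ : ∃ s', s = ⟪n, z⟫ + s' := ⟨s - ⟪n, z⟫, by ring⟩
    have hs0 : 0 < s := by linarith [hs.1]
    have hs1 : s < c := by linarith [hs.2]
    have hsa : |s| = s := abs_of_pos hs0
    obtain ⟨hT1, hT2, hT3⟩ := hT s (by rw [hsa]; linarith)
    have hp : 0 < f (z + s • n) := by
      refine (h z hz hfz _ hT2).1 ?_
      rw [hi1, hi2, hsa]; nlinarith
    have hm : f (z + s • n + t • e) < 0 := by
      refine (h z hz hfz _ hT3).2 ?_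
      rw [hi3]
      have := hi4 s
      rw [hsa] at this
      have hst : ε * ‖z + s • n + t • e - z‖ ≤ ε * (2 * t) :=
        mul_le_mul_of_nonneg_left (by linarith) hε0.le
      rw [hc, abs_of_nonpos ha0] at hs1
      linarith
    simp only [Set.mem_ofPred_eq, hpt]
    refine ⟨fun hiff => ?_, hT1⟩
    exact absurd (hiff.mp hp) (not_lt.mpr hm.le)
  · have hvol : ENNReal.ofReal c = volume (Set.Ioo (⟪n, z⟫ - c) ⟪n, z⟫) := by
      rw [Real.volume_Ioo]; congr 1; ring
    rw [hvol]
    refine measure_mono fun s hs => ?_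
    obtain ⟨s, rfl⟩ : ∃ s', s = ⟪n, z⟫ + s' := ⟨s - ⟪n, z⟫, by ring⟩
    have hs0 : s < 0 := by linarith [hs.2]
    have hs1 : -c < s := by linarith [hs.1]
    have hsa : |s| = -s := abs_of_neg hs0
    obtain ⟨hT1, hT2, hT3⟩ := hT s (by rw [hsa]; linarith)
    have hm : f (z + s • n) < 0 := by
      refine (h z hz hfz _ hT2).2 ?_
      rw [hi1, hi2, hsa]; nlinarith
    have hp : 0 < f (z + s • n + t • e) := by
      refine (h z hz hfz _ hT3).1 ?_
      rw [hi3]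
      have := hi4 s
      rw [hsa] at this
      have hst : ε * ‖z + s • n + t • e - z‖ ≤ ε * (2 * t) :=
        mul_le_mul_of_nonneg_left (by linarith) hε0.le
      rw [hc, abs_of_pos ha0] at hs1
      linarith
    simp only [Set.mem_ofPred_eq, hpt]
    refine ⟨fun hiff => ?_, hT1⟩
    exact absurd (hiff.mpr hp) (not_lt.mpr hm.le)

theorem sum_ofReal_ge {ι : Type*} (s : Finset ι) (g : ι → ℝ) :
    ENNReal.ofReal (∑ i ∈ s, g i) ≤ ∑ i ∈ s, ENNReal.ofReal (g i) := by
  classical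
  induction s using Finset.induction_on with
  | empty => simp
  | insert a s ha ih =>
    rw [Finset.sum_insert ha, Finset.sum_insert ha]
    exact ENNReal.ofReal_add_le.trans (add_le_add le_rfl ih)

/-- The `ℓ¹` norm dominates the `ℓ²` norm. Hence translations along the axes together detect at
least the full area, whatever the direction of the normal. -/
theorem one_le_sum_abs_inner {n : Momentum d} (hn : ‖n‖ = 1) :
    1 ≤ ∑ i, |⟪n, EuclideanSpace.single i (1 : ℝ)⟫| := by
  have h1 : ∀ i, ⟪n, EuclideanSpace.single i (1 : ℝ)⟫ = n i := by
    intro i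
    rw [EuclideanSpace.inner_single_right]; simp
  simp only [h1]
  have h2 : ∑ i, (n i) ^ 2 = 1 := by
    have := EuclideanSpace.real_norm_sq_eq n
    rw [hn] at this
    linarith
  rw [← h2]
  refine Finset.sum_le_sum fun i _ => ?_
  have h3 : |n i| ≤ 1 := by
    rw [← hn, ← Real.norm_eq_abs]; exact PiLp.norm_apply_le n i
  rw [← sq_abs]
  nlinarith [abs_nonneg (n i)]

/-- A compact piece of the hypersurface contributes its area to the translates. -/
theorem ConeCondition.sum_shift_ge (hd : 0 < d) {f : Momentum d → ℝ} (hf : Continuous f)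
    {n : Momentum d} {ε : ℝ} {U : Set (Momentum d)} (h : ConeCondition f n ε U) (hn : ‖n‖ = 1)
    (hε0 : 0 < ε) (hε : ε < 1) {K : Set (Momentum d)} (hK : ∀ k ∈ K, f k = 0)
    {t : ℝ} (ht : 0 < t) (hKU : Metric.cthickening (2 * t) K ⊆ U) :
    ENNReal.ofReal (t * (1 - 2 * d * ε)) * μHE[d - 1] K ≤
      ENNReal.ofReal ((1 - ε)⁻¹ ^ (d - 1)) *
        ∑ i, volume (shiftSet f (t • EuclideanSpace.single i (1 : ℝ)) ∩
          Metric.cthickening (2 * t) K) := by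
  have hKU' : K ⊆ U := (Metric.self_subset_cthickening K).trans hKU
  have h1 : ∀ i : Fin d, ENNReal.ofReal (t * (|⟪n, EuclideanSpace.single i (1 : ℝ)⟫| - 2 * ε)) *
      volume (projAlong n '' K) ≤ volume (shiftSet f (t • EuclideanSpace.single i (1 : ℝ)) ∩
          Metric.cthickening (2 * t) K) := by
    intro i
    refine volume_ge_of_lines hn ((measurableSet_shiftSet hf _).inter
      Metric.isClosed_cthickening.measurableSet) _ ?_
    rintro _ ⟨z, hz, rfl⟩
    have he : ‖(EuclideanSpace.single i (1 : ℝ) : Momentum d)‖ = 1 := by simp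
    refine h.line_ge hn hε0 hε he ht (hKU' hz) (hK z hz) fun s hs => ?_
    have hm1 : z + s • n ∈ Metric.cthickening (2 * t) K := by
      refine Metric.mem_cthickening_of_dist_le _ z _ _ hz ?_
      rw [dist_eq_norm, add_sub_cancel_left, norm_smul, hn, mul_one, Real.norm_eq_abs]
      linarith
    have hm2 : z + s • n + t • EuclideanSpace.single i (1 : ℝ) ∈ Metric.cthickening (2 * t) K := by
      refine Metric.mem_cthickening_of_dist_le _ z _ _ hz ?_
      rw [dist_eq_norm, show z + s • n + t • EuclideanSpace.single i (1 : ℝ) - z =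
        s • n + t • EuclideanSpace.single i (1 : ℝ) by abel]
      refine (norm_add_le _ _).trans ?_
      rw [norm_smul, norm_smul, hn, he, mul_one, mul_one, Real.norm_eq_abs, Real.norm_eq_abs,
        abs_of_pos ht]
      linarith
    exact ⟨hm1, hKU hm1, hKU hm2⟩
  have h2 := measure_zeros_le_volume hd hn hε (S := K) fun x hx y hy =>
    h.abs_inner_le (hKU' hx) (hKU' hy) (hK x hx) (hK y hy)
  have h3 : ENNReal.ofReal (t * (1 - 2 * d * ε)) ≤
      ∑ i : Fin d, ENNReal.ofReal (t * (|⟪n, EuclideanSpace.single i (1 : ℝ)⟫| - 2 * ε)) := by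
    refine le_trans (ENNReal.ofReal_le_ofReal ?_) (sum_ofReal_ge _ _)
    rw [← Finset.mul_sum, Finset.sum_sub_distrib]
    have := one_le_sum_abs_inner hn
    simp only [Finset.sum_const, Finset.card_univ, Fintype.card_fin, nsmul_eq_mul]
    refine mul_le_mul_of_nonneg_left ?_ ht.le
    linarith
  calc ENNReal.ofReal (t * (1 - 2 * d * ε)) * μHE[d - 1] K
      ≤ (∑ i : Fin d, ENNReal.ofReal (t * (|⟪n, EuclideanSpace.single i (1 : ℝ)⟫| - 2 * ε))) *
        (ENNReal.ofReal ((1 - ε)⁻¹ ^ (d - 1)) * volume (projAlong n '' K)) := by gcongr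
    _ = ENNReal.ofReal ((1 - ε)⁻¹ ^ (d - 1)) *
        ∑ i : Fin d, ENNReal.ofReal (t * (|⟪n, EuclideanSpace.single i (1 : ℝ)⟫| - 2 * ε)) *
          volume (projAlong n '' K) := by
        rw [← Finset.sum_mul]; ring
    _ ≤ _ := by
        gcongr with i
        exact h1 i

end Shift

/-! ## Area of the zero set of a smooth periodic function -/

section Area

variable {d : ℕ}

/-- At its zeros the function is continuously differentiable with non-zero gradient. -/
def RegularZeros (f : Momentum d → ℝ) : Prop :=
  ∀ p, f p = 0 → ContDiffAt ℝ 1 f p ∧ fderiv ℝ f p ≠ 0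

theorem RegularZeros.measure_lt_top (hd : 0 < d) {f : Momentum d → ℝ} (hreg : RegularZeros f)
    (hf : Continuous f) {C : Set (Momentum d)} (hC : IsCompact C) :
    μHE[d - 1] ({k | f k = 0} ∩ C) < ⊤ := by
  have hcl : IsClosed {k | f k = 0} := isClosed_eq hf continuous_const
  refine (hC.inter_left hcl).measure_lt_top_of_nhdsWithin fun p hp => ?_
  obtain ⟨n, hn, r, hr, hcone⟩ := exists_coneCondition (hreg p hp.1).1 (hreg p hp.1).2
    (show (0 : ℝ) < 1 / 2 by norm_num)
  refine ⟨{k | f k = 0} ∩ Metric.ball p r, ?_,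
    measure_zeros_lt_top hd hn (by norm_num) hcone⟩
  refine Filter.inter_mem (mem_of_superset self_mem_nhdsWithin Set.inter_subset_left)
    (mem_nhdsWithin_of_mem_nhds (Metric.ball_mem_nhds p hr))

theorem isBounded_brillouinZone : Bornology.IsBounded (brillouinZone d) := by
  rw [isBounded_iff_forall_norm_le]
  refine ⟨Real.sqrt (∑ _i : Fin d, Real.pi ^ 2), fun k hk => ?_⟩
  rw [EuclideanSpace.norm_eq]
  refine Real.sqrt_le_sqrt (Finset.sum_le_sum fun i _ => ?_)
  rw [Real.norm_eq_abs, sq_abs]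
  have := hk i
  exact sq_le_sq' this.1 this.2.le

theorem measurableSet_brillouinZone : MeasurableSet (brillouinZone d) := by
  have h : brillouinZone d = ⋂ i, {k : Momentum d | k i ∈ Set.Ico (-Real.pi) Real.pi} := by
    ext k; simp [brillouinZone]
  rw [h]
  refine MeasurableSet.iInter fun i => ?_
  have hm : Measurable fun k : Momentum d => k i := by fun_prop
  exact hm measurableSet_Ico

theorem RegularZeros.zone_lt_top (hd : 0 < d) {f : Momentum d → ℝ} (hreg : RegularZeros f)
    (hf : Continuous f) : μHE[d - 1] ({k | f k = 0} ∩ brillouinZone d) < ⊤ :=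
  (measure_mono (Set.inter_subset_inter_right _ subset_closure)).trans_lt
    (hreg.measure_lt_top hd hf isBounded_brillouinZone.isCompact_closure)

/-- A box of edge `2π`, open on the left. -/
def periodBox (b : ℝ) : Set (Momentum d) :=
  {k | ∀ i, k i ∈ Set.Ioc b (b + 2 * Real.pi)}

/-- Finitely many cone neighbourhoods cover the zeros in the closed zone; they are made disjoint and
then shrunk by inner regularity. Compact disjoint pieces have disjoint thickenings, so their
contributions to a translate do not overlap. -/
theorem exists_compact_pieces (hd : 0 < d) {f : Momentum d → ℝ} (hreg : RegularZeros f)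
    (hf : Continuous f) {ε : ℝ} (hε : 0 < ε) {δ : ℝ≥0∞} (hδ : δ ≠ 0) :
    ∃ (m : ℕ) (K : Fin m → Set (Momentum d)) (n : Fin m → Momentum d)
      (U : Fin m → Set (Momentum d)),
      (∀ j, IsCompact (K j)) ∧ (∀ j, K j ⊆ {k | f k = 0} ∩ brillouinZone d) ∧
      Pairwise (Function.onFun Disjoint K) ∧ (∀ j, ‖n j‖ = 1) ∧ (∀ j, IsOpen (U j)) ∧
      (∀ j, K j ⊆ U j) ∧ (∀ j, ConeCondition f (n j) ε (U j)) ∧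
      μHE[d - 1] ({k | f k = 0} ∩ brillouinZone d) ≤ ∑ j, μHE[d - 1] (K j) + δ := by
  have hcl : IsClosed {k | f k = 0} := isClosed_eq hf continuous_const
  have hC : IsCompact ({k | f k = 0} ∩ closure (brillouinZone d)) :=
    isBounded_brillouinZone.isCompact_closure.inter_left hcl
  have hchoice : ∀ p : Momentum d, ∃ n : Momentum d, ∃ U : Set (Momentum d), f p = 0 →
      ‖n‖ = 1 ∧ IsOpen U ∧ p ∈ U ∧ ConeCondition f n ε U := by
    intro p
    by_cases hp : f p = 0
    · obtain ⟨n, hn, r, hr, hcone⟩ := exists_coneCondition (hreg p hp).1 (hreg p hp).2 hε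
      exact ⟨n, Metric.ball p r, fun _ => ⟨hn, Metric.isOpen_ball, Metric.mem_ball_self hr, hcone⟩⟩
    · exact ⟨0, ∅, fun h => absurd h hp⟩
  choose n U hnU using hchoice
  obtain ⟨t, ht, hcov⟩ := hC.elim_nhds_subcover U fun p hp =>
    (hnU p hp.1).2.1.mem_nhds (hnU p hp.1).2.2.1
  let p : Fin t.card → Momentum d := fun j => (t.equivFin.symm j : Momentum d)
  have hp : ∀ j, f (p j) = 0 := fun j => (ht _ (t.equivFin.symm j).2).1
  let B : Fin t.card → Set (Momentum d) := disjointed fun j => U (p j)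
  have hBm : ∀ j, MeasurableSet (B j) := fun j =>
    disjointedRec (fun _ _ h => h.diff (hnU _ (hp _)).2.1.measurableSet)
      (hnU _ (hp j)).2.1.measurableSet
  set S := {k | f k = 0} ∩ brillouinZone d with hS
  have hSm : MeasurableSet S := hcl.measurableSet.inter measurableSet_brillouinZone
  have hfin : μHE[d - 1] S < ⊤ := hreg.zone_lt_top hd hf
  let μ : Measure (Momentum d) := (μHE[d - 1]).restrict S
  have : IsFiniteMeasure μ := ⟨by rw [Measure.restrict_apply_univ]; exact hfin⟩
  -- An error `δ / (card + 1)` per piece keeps the total below `δ`, also when there are no pieces.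
  have hcomp : ∀ j, ∃ K ⊆ S ∩ B j, IsCompact K ∧ μ (S ∩ B j) < μ K + δ / (t.card + 1 : ℕ) := by
    intro j
    refine (hSm.inter (hBm j)).exists_isCompact_lt_add (measure_ne_top _ _) ?_
    exact (ENNReal.div_pos hδ (ENNReal.natCast_ne_top _)).ne'
  choose K hKS hK hKμ using hcomp
  refine ⟨t.card, K, fun j => n (p j), fun j => U (p j), hK, fun j => (hKS j).trans
    Set.inter_subset_left, ?_, fun j => (hnU _ (hp j)).1, fun j => (hnU _ (hp j)).2.1,
    fun j => ?_, fun j => (hnU _ (hp j)).2.2.2, ?_⟩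
  · intro i j hij
    exact (disjoint_disjointed (fun j => U (p j)) hij).mono
      ((hKS i).trans Set.inter_subset_right) ((hKS j).trans Set.inter_subset_right)
  · exact ((hKS j).trans Set.inter_subset_right).trans (disjointed_subset _ j)
  · have hμ : ∀ T ⊆ S, MeasurableSet T → μ T = μHE[d - 1] T := by
      intro T hT hTm
      rw [Measure.restrict_apply hTm, Set.inter_eq_left.mpr hT]
    have hcover : S ⊆ ⋃ j, S ∩ B j := by
      intro k hk
      rw [← Set.inter_iUnion, iUnion_disjointed]
      refine ⟨hk, ?_⟩
      have hk' := hcov ⟨hk.1, subset_closure hk.2⟩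
      simp only [Set.mem_iUnion] at hk' ⊢
      obtain ⟨q, hq, hkq⟩ := hk'
      exact ⟨t.equivFin ⟨q, hq⟩, by simpa [p] using hkq⟩
    calc μHE[d - 1] S ≤ ∑ j, μHE[d - 1] (S ∩ B j) :=
          (measure_mono hcover).trans (measure_iUnion_fintype_le _ _)
      _ ≤ ∑ j, (μHE[d - 1] (K j) + δ / (t.card + 1 : ℕ)) := by
          refine Finset.sum_le_sum fun j _ => ?_
          rw [← hμ _ Set.inter_subset_left (hSm.inter (hBm j)),
            ← hμ _ ((hKS j).trans Set.inter_subset_left) (hK j).measurableSet]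
          exact (hKμ j).le
      _ = ∑ j, μHE[d - 1] (K j) + t.card * (δ / (t.card + 1 : ℕ)) := by
          rw [Finset.sum_add_distrib]; simp
      _ ≤ _ := by
          gcongr
          rw [← mul_div_assoc, ENNReal.div_le_iff (by simp) (ENNReal.natCast_ne_top _), mul_comm]
          gcongr
          exact_mod_cast Nat.le_succ _

end Area

end FreeFermion

namespace FreeFermion

open Filter Topology MeasureTheory
open scoped ENNReal NNReal RealInnerProductSpace

/-! ### Area of the zero set against the volume changed by small translations. -/

section Limit

variable {d : ℕ}

theorem volume_periodBox_lt_top (b : ℝ) : volume (periodBox b : Set (Momentum d)) < ⊤ := by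
  have h : Bornology.IsBounded (periodBox b : Set (Momentum d)) := by
    rw [isBounded_iff_forall_norm_le]
    refine ⟨Real.sqrt (∑ _i : Fin d, (|b| + 2 * Real.pi) ^ 2), fun k hk => ?_⟩
    rw [EuclideanSpace.norm_eq]
    refine Real.sqrt_le_sqrt (Finset.sum_le_sum fun i _ => ?_)
    rw [Real.norm_eq_abs, sq_abs]
    have := hk i
    have h1 := neg_abs_le b
    have h2 := le_abs_self b
    have h3 := Real.pi_pos
    exact sq_le_sq' (by linarith [this.1]) (by linarith [this.2])
  exact h.measure_lt_top

/-- Three losses are collected in one `η`: the Lipschitz factor `(1-ε)^(d-1)`, the cone apertures `1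
- 2dε` over the axes, and the part `ε` of the area lost to inner regularity. -/
theorem exists_small_cone_constant {η : ℝ} (hη : 0 < η) :
    ∃ ε : ℝ, 0 < ε ∧ ε < 1 ∧ 0 < 1 - 2 * d * ε ∧
      1 - η ≤ (1 - ε) ^ (d - 1) * ((1 - 2 * d * ε) * (1 - ε)) := by
  have hc : Continuous fun ε : ℝ => (1 - ε) ^ (d - 1) * ((1 - 2 * d * ε) * (1 - ε)) := by fun_prop
  have h1 : ∀ᶠ ε : ℝ in 𝓝 0, 1 - η < (1 - ε) ^ (d - 1) * ((1 - 2 * d * ε) * (1 - ε)) :=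
    (hc.tendsto 0).eventually (lt_mem_nhds (by simp; exact hη))
  have hc2 : Continuous fun ε : ℝ => 1 - 2 * d * ε := by fun_prop
  have h2 : ∀ᶠ ε : ℝ in 𝓝 0, 0 < 1 - 2 * d * ε :=
    (hc2.tendsto 0).eventually (lt_mem_nhds (by simp))
  have h3 : ∀ᶠ ε : ℝ in 𝓝[>] (0 : ℝ), ε ∈ Set.Ioo (0 : ℝ) 1 := Ioo_mem_nhdsGT one_pos
  obtain ⟨ε, h⟩ := ((h1.filter_mono nhdsWithin_le_nhds).and
    ((h2.filter_mono nhdsWithin_le_nhds).and h3)).exists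
  exact ⟨ε, h.2.2.1, h.2.2.2, h.2.1, h.1.le⟩

/-- A compact subset of the half-open zone may touch the lower faces but stays a distance `δ` below
the upper ones. Moving the box down by `δ/2` leaves room on both sides, so thickenings stay inside a
single period. -/
theorem exists_periodBox {Q : Set (Momentum d)} (hQ : IsCompact Q) (hQz : Q ⊆ brillouinZone d) :
    ∃ b : ℝ, ∃ s₀ : ℝ, 0 < s₀ ∧ ∀ s, 0 < s → s < s₀ → Metric.cthickening s Q ⊆ periodBox b := by
  have hV : IsOpen {k : Momentum d | ∀ i, k i < Real.pi} := by
    rw [Set.ofPred_forall]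
    exact isOpen_iInter_of_finite fun i => isOpen_lt (by fun_prop) continuous_const
  obtain ⟨δ, hδ, hδV⟩ := hQ.exists_cthickening_subset_open hV fun k hk i => (hQz hk i).2
  refine ⟨-Real.pi - δ / 2, δ / 2, by positivity, fun s hs hs2 y hy i => ?_⟩
  rw [hQ.cthickening_eq_biUnion_closedBall hs.le] at hy
  simp only [Set.mem_iUnion] at hy
  obtain ⟨z, hz, hyz⟩ := hy
  have h1 : |y i - z i| ≤ s := by
    rw [Metric.mem_closedBall, dist_eq_norm] at hyz
    exact (PiLp.norm_apply_le (y - z) i).trans hyz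
  have h2 := (hQz hz i).1
  have h3 : z i + δ < Real.pi := by
    have : z + EuclideanSpace.single i δ ∈ Metric.cthickening δ Q := by
      refine Metric.mem_cthickening_of_dist_le _ z _ _ hz ?_
      rw [dist_eq_norm, add_sub_cancel_left]
      simp [abs_of_pos hδ]
    have := hδV this i
    simpa using this
  rw [abs_le] at h1
  constructor <;> linarith

/-- For small `t` the thickened pieces of radius `2t` are disjoint, lie in their cone neighbourhoods
and fit into one period box, so the bounds for the pieces add up. -/
theorem RegularZeros.shift_ge (hd : 0 < d) {f : Momentum d → ℝ} (hreg : RegularZeros f)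
    (hf : Continuous f) {η : ℝ} (hη : 0 < η) :
    ∃ t₀ : ℝ, 0 < t₀ ∧ ∃ b : ℝ, ∀ t, 0 < t → t < t₀ →
      (1 - η) * (μHE[d - 1] ({k | f k = 0} ∩ brillouinZone d)).toReal * t ≤
        ∑ i, (volume (shiftSet f (t • EuclideanSpace.single i (1 : ℝ)) ∩ periodBox b)).toReal := by
  set A := (μHE[d - 1] ({k | f k = 0} ∩ brillouinZone d)).toReal with hA
  have hAtop := (hreg.zone_lt_top hd hf).ne
  rcases (ENNReal.toReal_nonneg : 0 ≤ A).eq_or_lt with hA0 | hA0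
  · refine ⟨1, one_pos, 0, fun t _ _ => ?_⟩
    have hA0' : A = 0 := hA0.symm
    rw [hA0', mul_zero, zero_mul]
    exact Finset.sum_nonneg fun i _ => ENNReal.toReal_nonneg
  obtain ⟨ε, hε0, hε1, hε2, hε3⟩ := exists_small_cone_constant (d := d) hη
  obtain ⟨m, K, n, U, hK, hKS, hdisj, hn, hU, hKU, hcone, hsum⟩ :=
    exists_compact_pieces hd hreg hf hε0 (δ := ENNReal.ofReal (ε * A))
      (by rw [ENNReal.ofReal_ne_zero_iff]; positivity)
  have hQ : IsCompact (⋃ j, K j) := isCompact_iUnion hK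
  obtain ⟨b, s₀, hs₀, hbox⟩ := exists_periodBox hQ
    (Set.iUnion_subset fun j => (hKS j).trans Set.inter_subset_right)
  have e1 : ∀ᶠ s in 𝓝[>] (0 : ℝ), ∀ j, Metric.cthickening s (K j) ⊆ U j := by
    rw [eventually_all]
    intro j
    obtain ⟨δ, hδ, h⟩ := (hK j).exists_cthickening_subset_open (hU j) (hKU j)
    filter_upwards [Ioo_mem_nhdsGT hδ] with s hs
    exact (Metric.cthickening_mono hs.2.le _).trans h
  have e2 : ∀ᶠ s in 𝓝[>] (0 : ℝ), ∀ j j', j ≠ j' →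
      Disjoint (Metric.cthickening s (K j)) (Metric.cthickening s (K j')) := by
    rw [eventually_all]; intro j
    rw [eventually_all]; intro j'
    by_cases hj : j = j'
    · exact Eventually.of_forall fun s h => absurd hj h
    obtain ⟨δ, hδ, h⟩ := (hdisj hj).exists_cthickenings (hK j) (hK j').isClosed
    filter_upwards [Ioo_mem_nhdsGT hδ] with s hs _
    exact h.mono (Metric.cthickening_mono hs.2.le _) (Metric.cthickening_mono hs.2.le _)
  obtain ⟨s₁, hs₁, h12⟩ := mem_nhdsGT_iff_exists_Ioo_subset.mp (e1.and e2)
  rw [Set.mem_Ioi] at hs₁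
  refine ⟨min s₀ s₁ / 2, by positivity, b, fun t ht0 ht1 => ?_⟩
  have ht2 : 2 * t < s₀ := by have := min_le_left s₀ s₁; linarith
  have ht3 : 2 * t < s₁ := by have := min_le_right s₀ s₁; linarith
  obtain ⟨hsubU, hsdisj⟩ := h12 ⟨by linarith, ht3⟩
  set T : Fin m → Set (Momentum d) := fun j => Metric.cthickening (2 * t) (K j) with hT
  have hbox' : ∀ j, T j ⊆ periodBox b := fun j =>
    (Metric.cthickening_subset_of_subset _ (Set.subset_iUnion K j)).trans
      (hbox _ (by linarith) ht2)
  set v : Fin d → Set (Momentum d) := fun i => shiftSet f (t • EuclideanSpace.single i (1 : ℝ))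
    with hv
  have hKfin : ∀ j, μHE[d - 1] (K j) ≠ ⊤ := fun j =>
    ((measure_mono (hKS j)).trans_lt (hreg.zone_lt_top hd hf)).ne
  have hvfin : ∀ i, volume (v i ∩ periodBox b) ≠ ⊤ := fun i =>
    ((measure_mono Set.inter_subset_right).trans_lt (volume_periodBox_lt_top b)).ne
  have key : ENNReal.ofReal (t * (1 - 2 * d * ε)) * ∑ j, μHE[d - 1] (K j) ≤
      ENNReal.ofReal ((1 - ε)⁻¹ ^ (d - 1)) * ∑ i, volume (v i ∩ periodBox b) := by
    calc ENNReal.ofReal (t * (1 - 2 * d * ε)) * ∑ j, μHE[d - 1] (K j)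
        ≤ ∑ j, ENNReal.ofReal ((1 - ε)⁻¹ ^ (d - 1)) * ∑ i, volume (v i ∩ T j) := by
          rw [Finset.mul_sum]
          exact Finset.sum_le_sum fun j _ => (hcone j).sum_shift_ge hd hf (hn j) hε0 hε1
            (fun k hk => (hKS j hk).1) ht0 (hsubU j)
      _ = ENNReal.ofReal ((1 - ε)⁻¹ ^ (d - 1)) * ∑ i, ∑ j, volume (v i ∩ T j) := by
          rw [← Finset.mul_sum, Finset.sum_comm]
      _ ≤ _ := by
          gcongr with i
          have h1 : ∑ j, volume (v i ∩ T j) = volume (⋃ j, v i ∩ T j) := by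
            rw [measure_iUnion _ fun j => (measurableSet_shiftSet hf _).inter
              Metric.isClosed_cthickening.measurableSet, tsum_fintype]
            intro j j' hj
            exact (hsdisj j j' hj).mono Set.inter_subset_right Set.inter_subset_right
          rw [h1]
          exact measure_mono (Set.iUnion_subset fun j => Set.inter_subset_inter_right _ (hbox' j))
  have hsum' : A ≤ ∑ j, (μHE[d - 1] (K j)).toReal + ε * A := by
    have := ENNReal.toReal_mono (ENNReal.add_ne_top.mpr
      ⟨ENNReal.sum_ne_top.mpr fun j _ => hKfin j, ENNReal.ofReal_ne_top⟩) hsum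
    rwa [ENNReal.toReal_add (ENNReal.sum_ne_top.mpr fun j _ => hKfin j) ENNReal.ofReal_ne_top,
      ENNReal.toReal_sum fun j _ => hKfin j, ENNReal.toReal_ofReal (by positivity)] at this
  have key' : t * (1 - 2 * d * ε) * ∑ j, (μHE[d - 1] (K j)).toReal ≤
      (1 - ε)⁻¹ ^ (d - 1) * ∑ i, (volume (v i ∩ periodBox b)).toReal := by
    have hε4 : 0 < 1 - ε := by linarith
    have := ENNReal.toReal_mono (ENNReal.mul_ne_top ENNReal.ofReal_ne_top
      (ENNReal.sum_ne_top.mpr fun i _ => hvfin i)) key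
    rwa [ENNReal.toReal_mul, ENNReal.toReal_mul, ENNReal.toReal_ofReal (by positivity),
      ENNReal.toReal_ofReal (by positivity), ENNReal.toReal_sum fun j _ => hKfin j,
      ENNReal.toReal_sum fun i _ => hvfin i] at this
  have hq : 0 < (1 - ε) ^ (d - 1) := pow_pos (by linarith) _
  rw [inv_pow, inv_mul_eq_div, le_div_iff₀ hq] at key'
  refine le_trans ?_ key'
  calc (1 - η) * A * t ≤ ((1 - ε) ^ (d - 1) * ((1 - 2 * d * ε) * (1 - ε))) * A * t := by gcongr
    _ = t * (1 - 2 * d * ε) * (A - ε * A) * (1 - ε) ^ (d - 1) := by ring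
    _ ≤ _ := by
      gcongr
      linarith

end Limit

/-! ### Lattice periodicity and the boundary of the filled region. -/

section Periodic

variable {d : ℕ}

theorem periodic_lattice {β : Type*} {f : Momentum d → β}
    (hf : ∀ k i, f (k + EuclideanSpace.single i (2 * Real.pi)) = f k) (k : Momentum d)
    (m : Fin d → ℤ) : f (k + WithLp.toLp 2 fun i => 2 * Real.pi * (m i : ℝ)) = f k := by
  have h1 : ∀ s : Finset (Fin d), Function.Periodic f
      (∑ i ∈ s, m i • EuclideanSpace.single i (2 * Real.pi)) := by
    intro s
    induction s using Finset.induction_on with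
    | empty => intro k; simp
    | insert a s ha ih =>
      rw [Finset.sum_insert ha]
      have ha' : Function.Periodic f (EuclideanSpace.single a (2 * Real.pi)) := fun k => hf k a
      exact (ha'.zsmul (m a)).add_period ih
  have h2 : (WithLp.toLp 2 fun i => 2 * Real.pi * (m i : ℝ) : Momentum d) =
      ∑ i, m i • EuclideanSpace.single i (2 * Real.pi) := by
    ext j
    simp [Finset.sum_apply, Pi.single_apply, mul_comm]
  rw [h2]
  exact h1 _ k

theorem exists_lattice_mem_brillouinZone (k : Momentum d) : ∃ m : Fin d → ℤ,
    (k + WithLp.toLp 2 fun i => 2 * Real.pi * (m i : ℝ)) ∈ brillouinZone d := by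
  refine ⟨fun i => -toIcoDiv Real.two_pi_pos (-Real.pi) (k i), fun i => ?_⟩
  have h := sub_toIcoDiv_zsmul_mem_Ico Real.two_pi_pos (-Real.pi) (k i)
  have e : (k + WithLp.toLp 2 fun i => 2 * Real.pi *
      ((-toIcoDiv Real.two_pi_pos (-Real.pi) (k i) : ℤ) : ℝ)) i =
      k i - toIcoDiv Real.two_pi_pos (-Real.pi) (k i) • (2 * Real.pi) := by
    simp only [PiLp.add_apply, Int.cast_neg, zsmul_eq_mul]
    ring
  rw [show -Real.pi + 2 * Real.pi = Real.pi by ring] at h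
  rw [e]
  exact h

/-- The zero `p` may lie outside the zone. A ball around it is covered by countably many lattice
translates of the zone, so a null zero set in the zone would contradict `measure_zeros_pos`. -/
theorem RegularZeros.zone_pos (hd : 0 < d) {f : Momentum d → ℝ} (hreg : RegularZeros f)
    (hf : Continuous f) (hper : ∀ k i, f (k + EuclideanSpace.single i (2 * Real.pi)) = f k)
    {p : Momentum d} (hp : f p = 0) :
    0 < μHE[d - 1] ({k | f k = 0} ∩ brillouinZone d) := by
  by_contra h
  have h0 : μHE[d - 1] ({k | f k = 0} ∩ brillouinZone d) = 0 := nonpos_iff_eq_zero.mp (not_lt.mp h)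
  obtain ⟨n, hn, r, hr, hcone⟩ := exists_coneCondition (hreg p hp).1 (hreg p hp).2
    (show (0 : ℝ) < 1 / 2 by norm_num)
  refine absurd (measure_zeros_pos hd hf hn hp hr (by norm_num) le_rfl hcone) (not_lt.mpr ?_)
  have hcov : {k | f k = 0} ∩ Metric.ball p r ⊆ ⋃ m : Fin d → ℤ,
      (fun k => k + WithLp.toLp 2 fun i => 2 * Real.pi * (m i : ℝ)) ⁻¹'
        ({k | f k = 0} ∩ brillouinZone d) := by
    intro k hk
    obtain ⟨m, hm⟩ := exists_lattice_mem_brillouinZone k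
    refine Set.mem_iUnion.mpr ⟨m, ?_, hm⟩
    show f _ = 0
    rw [periodic_lattice hper]
    exact hk.1
  refine (measure_mono hcov).trans ((measure_iUnion_le _).trans ?_)
  simp only [measure_preimage_add_right, h0, tsum_zero, le_refl]

theorem volume_preimage_momentumOf (W : Set (Momentum d)) :
    volume (momentumOf ⁻¹' W) = ENNReal.ofReal (((2 * Real.pi) ^ d)⁻¹) * volume W := by
  have h1 : (momentumOf ⁻¹' W : Set (Fin d → ℝ)) =
      (MeasurableEquiv.toLp 2 (Fin d → ℝ)) ⁻¹' ((fun k => (2 * Real.pi) • k) ⁻¹' W) := by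
    ext x
    have : momentumOf x = (2 * Real.pi) • (MeasurableEquiv.toLp 2 (Fin d → ℝ) x) := by
      ext i; simp [momentumOf]
    simp only [Set.mem_preimage, this]
  rw [h1, MeasurePreserving.measure_preimage_equiv
      (f := MeasurableEquiv.toLp 2 (Fin d → ℝ)) (PiLp.volume_preserving_toLp (Fin d)), Measure.addHaar_preimage_smul _ Real.two_pi_pos.ne']
  congr 2
  rw [finrank_euclideanSpace_fin, abs_of_pos (by positivity)]

/-- A set of finite `(d-1)`-dimensional measure is null in dimension `d`. -/
theorem RegularZeros.volume_eq_zero (hd : 0 < d) {f : Momentum d → ℝ} (hreg : RegularZeros f)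
    (hf : Continuous f) {C : Set (Momentum d)} (hC : IsCompact C) :
    volume ({k | f k = 0} ∩ C) = 0 := by
  have h := hreg.measure_lt_top hd hf hC
  have h2 := Measure.euclideanHausdorffMeasure_zero_or_top (show d - 1 < d by omega)
    ({k | f k = 0} ∩ C)
  rw [← EuclideanSpace.euclideanHausdorffMeasure_eq_volume]
  simpa using h2.resolve_right h.ne

/-- The set `Re ε = 0` may have positive volume, as it contains the region of imaginary energies.
But `ε²` is real, so `Im ε = 0` wherever `Re ε < 0`, hence also on the closure; boundary points of
`{Re ε < 0}` are therefore true zeros of `ε`. -/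
theorem volume_frontier_filledRegion (hd : 0 < d) {ε : Momentum d → ℂ} (hε : Continuous ε)
    (hreal : ∀ k, (ε k ^ 2).im = 0) (hreg : RegularZeros fun k => (ε k ^ 2).re) :
    volume (frontier (filledRegion ε)) = 0 := by
  set B : Set (Fin d → ℝ) := {x | ∀ i, x i ∈ Set.Ico (0 : ℝ) 1} with hB
  set G : Set (Fin d → ℝ) := {x | (ε (momentumOf x)).re < 0} with hG
  have hcont : Continuous fun x : Fin d → ℝ => ε (momentumOf x) := hε.comp continuous_momentumOf
  have hsplit : filledRegion ε = B ∩ G := rfl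
  have hBconv : Convex ℝ B := by
    have : B = Set.univ.pi fun _ : Fin d => Set.Ico (0 : ℝ) 1 := by ext; simp [hB]
    rw [this]
    exact convex_pi fun i _ => convex_Ico _ _
  have hBbdd : Bornology.IsBounded B := by
    refine (Metric.isBounded_Icc (0 : Fin d → ℝ) 1).subset fun x hx => ?_
    exact ⟨fun i => (hx i).1, fun i => (hx i).2.le⟩
  have hGopen : IsOpen G := isOpen_lt (Complex.continuous_re.comp hcont) continuous_const
  have hGf : frontier G ⊆ {x | (ε (momentumOf x) ^ 2).re = 0} := by
    intro x hx
    rw [hGopen.frontier_eq] at hx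
    have him : closure G ⊆ {x | (ε (momentumOf x)).im = 0} := by
      refine closure_minimal (fun y hy => ?_)
        (isClosed_eq (Complex.continuous_im.comp hcont) continuous_const)
      have h := hreal (momentumOf y)
      rw [pow_two, Complex.mul_im] at h
      have hy' : (ε (momentumOf y)).re < 0 := hy
      have : (ε (momentumOf y)).re * (ε (momentumOf y)).im = 0 := by linarith
      exact (mul_eq_zero.mp this).resolve_left hy'.ne
    have hre : closure G ⊆ {x | (ε (momentumOf x)).re ≤ 0} :=
      closure_minimal (fun y (hy : (ε (momentumOf y)).re < 0) => hy.le)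
        (isClosed_le (Complex.continuous_re.comp hcont) continuous_const)
    have h1 := him hx.1
    have h2 := hre hx.1
    have h3 : ¬ (ε (momentumOf x)).re < 0 := hx.2
    simp only [Set.mem_ofPred_eq] at h1 h2 ⊢
    have h4 : (ε (momentumOf x)).re = 0 := le_antisymm h2 (not_lt.mp h3)
    rw [pow_two, Complex.mul_re, h1, h4]; ring
  have hcompact : IsCompact (momentumOf '' closure B) :=
    hBbdd.isCompact_closure.image continuous_momentumOf
  have hsub : frontier (filledRegion ε) ⊆ frontier B ∪
      momentumOf ⁻¹' ({k | (ε k ^ 2).re = 0} ∩ momentumOf '' closure B) := by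
    rw [hsplit]
    refine (frontier_inter_subset B G).trans (Set.union_subset_union Set.inter_subset_left ?_)
    exact fun x hx => ⟨hGf hx.2, Set.mem_image_of_mem _ hx.1⟩
  refine measure_mono_null hsub (measure_union_null (hBconv.addHaar_frontier _) ?_)
  rw [volume_preimage_momentumOf, hreg.volume_eq_zero hd
    (Complex.continuous_re.comp (hε.pow 2)) hcompact, mul_zero]

end Periodic

end FreeFermion

namespace FreeFermion

open Filter Topology MeasureTheory
open scoped ENNReal NNReal

/-! ## Fourier coefficients of a filled region -/

section Torus

variable {d : ℕ}

attribute [local instance] instMeasureSpaceUnitAddCircle instIsAddHaarMeasureUnitAddCircleVolume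
  instIsProbabilityMeasureUnitAddCircleVolume

/-- The representative of a point of the torus in `(0, 1]^d`. -/
noncomputable def torusRep (t : UnitAddTorus (Fin d)) : Fin d → ℝ :=
  fun i => (AddCircle.equivIoc 1 0 (t i) : ℝ)

theorem measurable_torusRep : Measurable (torusRep (d := d)) := by
  refine measurable_pi_lambda _ fun i => ?_
  exact measurable_subtype_coe.comp
    ((AddCircle.measurableEquivIoc 1 0).measurable.comp (measurable_pi_apply i))

theorem coe_torusRep (t : UnitAddTorus (Fin d)) (i : Fin d) :
    ((torusRep t i : ℝ) : UnitAddCircle) = t i :=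
  (AddCircle.equivIoc 1 0).symm_apply_apply (t i)

/-- The function on the torus of a periodic function of the momentum. -/
noncomputable def torusFun (F : Momentum d → ℂ) (t : UnitAddTorus (Fin d)) : ℂ :=
  F (momentumOf (torusRep t))

theorem torusFun_eq {F : Momentum d → ℂ}
    (hF : ∀ k i, F (k + EuclideanSpace.single i (2 * Real.pi)) = F k)
    {t : UnitAddTorus (Fin d)} {x : Fin d → ℝ} (h : ∀ i, ((x i : ℝ) : UnitAddCircle) = t i) :
    torusFun F t = F (momentumOf x) := by
  have h1 : ∀ i, ∃ m : ℤ, torusRep t i = x i + m := by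
    intro i
    have h2 : ((torusRep t i : ℝ) : UnitAddCircle) = (x i : ℝ) := by rw [coe_torusRep, h]
    rw [QuotientAddGroup.eq_iff_sub_mem, AddSubgroup.mem_zmultiples_iff] at h2
    obtain ⟨m, hm⟩ := h2
    refine ⟨m, ?_⟩
    rw [zsmul_eq_mul, mul_one] at hm
    linarith
  choose m hm using h1
  rw [torusFun, ← periodic_lattice hF (momentumOf x) m]
  congr 1
  ext i
  simp only [momentumOf, PiLp.add_apply, hm i]
  ring

theorem mFourier_eq_phase (n : Fin d → ℤ) {t : UnitAddTorus (Fin d)} {x : Fin d → ℝ}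
    (h : ∀ i, ((x i : ℝ) : UnitAddCircle) = t i) :
    UnitAddTorus.mFourier n t = phase (momentumOf x) n := by
  simp only [UnitAddTorus.mFourier, ContinuousMap.coe_mk, phase, ← h, fourier_coe_apply,
    momentumOf]
  rw [← Complex.exp_sum]
  congr 1
  push_cast
  rw [Finset.mul_sum]
  refine Finset.sum_congr rfl fun i _ => ?_
  ring

theorem memLp_torusFun {F : Momentum d → ℂ} (hF : Measurable F) {C : ℝ} (hC : ∀ k, ‖F k‖ ≤ C) :
    MemLp (torusFun F) 2 (volume : Measure (UnitAddTorus (Fin d))) := by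
  refine MemLp.of_bound ?_ C (Eventually.of_forall fun t => hC _)
  exact (hF.comp (continuous_momentumOf.measurable.comp
    measurable_torusRep)).aestronglyMeasurable

theorem hasSum_sq_mFourierCoeff_of_memLp {g : UnitAddTorus (Fin d) → ℂ} (hg : MemLp g 2 volume) :
    HasSum (fun n => ‖UnitAddTorus.mFourierCoeff g n‖ ^ 2) (∫ t, ‖g t‖ ^ 2) := by
  have h := UnitAddTorus.hasSum_sq_mFourierCoeff (hg.toLp g)
  have h1 : ∀ n, UnitAddTorus.mFourierCoeff (hg.toLp g) n = UnitAddTorus.mFourierCoeff g n := by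
    intro n
    refine integral_congr_ae ?_
    filter_upwards [hg.coeFn_toLp] with t ht
    rw [ht]
  have h2 : ∫ t, ‖(hg.toLp g) t‖ ^ 2 = ∫ t, ‖g t‖ ^ 2 := by
    refine integral_congr_ae ?_
    filter_upwards [hg.coeFn_toLp] with t ht
    rw [ht]
  simpa only [h1, h2] using h

theorem mFourierCoeff_comp_add (g : UnitAddTorus (Fin d) → ℂ) (s : UnitAddTorus (Fin d))
    (n : Fin d → ℤ) : UnitAddTorus.mFourierCoeff (fun t => g (t + s)) n =
      UnitAddTorus.mFourier n s * UnitAddTorus.mFourierCoeff g n := by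
  rw [UnitAddTorus.mFourierCoeff, UnitAddTorus.mFourierCoeff]
  have h1 := integral_add_right_eq_self (μ := (volume : Measure (UnitAddTorus (Fin d))))
    (fun t => UnitAddTorus.mFourier (-n) (t - s) • g t) s
  simp only [add_sub_cancel_right] at h1
  rw [h1, ← integral_const_mul]
  refine integral_congr_ae (Eventually.of_forall fun t => ?_)
  have h2 : UnitAddTorus.mFourier (-n) (t - s) =
      UnitAddTorus.mFourier n s * UnitAddTorus.mFourier (-n) t := by
    simp only [UnitAddTorus.mFourier, ContinuousMap.coe_mk, ← Finset.prod_mul_distrib]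
    refine Finset.prod_congr rfl fun i _ => ?_
    rw [Pi.sub_apply, Pi.neg_apply, fourier_apply, fourier_apply, fourier_apply, ← Circle.coe_mul,
      ← AddCircle.toCircle_add]
    congr 2
    rw [neg_smul, neg_smul, smul_sub]
    abel
  simp only [h2, smul_eq_mul, mul_assoc]

end Torus

/-! ### Parseval for the filled region and its translates. -/

section Coefficients

variable {d : ℕ}

attribute [local instance] instMeasureSpaceUnitAddCircle instIsAddHaarMeasureUnitAddCircleVolume
  instIsProbabilityMeasureUnitAddCircleVolume

/-- The indicator function of the momenta where the band is filled. -/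
noncomputable def fillIndicator (ε : Momentum d → ℂ) : Momentum d → ℂ :=
  Set.indicator {k | (ε k).re < 0} 1

/-- The momenta where the occupation changes under a translation by `w`. -/
def changeSet (ε : Momentum d → ℂ) (w : Momentum d) : Set (Momentum d) :=
  {k | ¬((ε k).re < 0 ↔ (ε (k + w)).re < 0)}

theorem measurableSet_filled {ε : Momentum d → ℂ} (hε : Continuous ε) :
    MeasurableSet {k | (ε k).re < 0} :=
  (isOpen_lt (Complex.continuous_re.comp hε) continuous_const).measurableSet

theorem measurableSet_changeSet {ε : Momentum d → ℂ} (hε : Continuous ε) (w : Momentum d) :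
    MeasurableSet (changeSet ε w) :=
  ((measurableSet_filled hε).iff (measurableSet_filled
    (hε.comp (continuous_id.add continuous_const)))).compl

theorem measurable_fillIndicator {ε : Momentum d → ℂ} (hε : Continuous ε) :
    Measurable (fillIndicator ε) :=
  measurable_one.indicator (measurableSet_filled hε)

theorem norm_fillIndicator_le (ε : Momentum d → ℂ) (k : Momentum d) : ‖fillIndicator ε k‖ ≤ 1 := by
  rw [fillIndicator, Set.indicator_apply]
  split_ifs <;> simp

theorem fillIndicator_periodic {ε : Momentum d → ℂ}
    (hper : ∀ k i, ε (k + EuclideanSpace.single i (2 * Real.pi)) = ε k) (k : Momentum d)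
    (i : Fin d) : fillIndicator ε (k + EuclideanSpace.single i (2 * Real.pi)) =
      fillIndicator ε k := by
  simp only [fillIndicator, Set.indicator_apply, Set.mem_ofPred_eq, hper, Pi.one_apply]

/-- The two conventions have opposite signs in the exponent, hence `-n`; the cells `(0,1]^d` and
`[0,1)^d` differ by a null set. -/
theorem mFourierCoeff_fillIndicator {ε : Momentum d → ℂ} (hε : Continuous ε)
    (hper : ∀ k i, ε (k + EuclideanSpace.single i (2 * Real.pi)) = ε k) (n : Fin d → ℤ) :
    UnitAddTorus.mFourierCoeff (torusFun (fillIndicator ε)) n = fillCoeff ε (-n) := by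
  have h1 : ({x | ∀ i, x i ∈ Set.Ico (0 : ℝ) 1} : Set (Fin d → ℝ)) =ᵐ[volume]
      {x | ∀ i, x i ∈ Set.Ioc (0 : ℝ) (0 + 1)} := by
    have e1 := Measure.univ_pi_Ico_ae_eq_Icc (μ := fun _ : Fin d => (volume : Measure ℝ))
      (f := fun _ => 0) (g := fun _ => 1)
    have e2 := Measure.univ_pi_Ioc_ae_eq_Icc (μ := fun _ : Fin d => (volume : Measure ℝ))
      (f := fun _ => 0) (g := fun _ => 1)
    have := e1.trans e2.symm
    simpa [Set.pi, volume_pi] using this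
  rw [UnitAddTorus.mFourierCoeff_eq_integral _ _ (fun _ => 0), fillCoeff]
  have hG : MeasurableSet (momentumOf ⁻¹' {k | (ε k).re < 0} : Set (Fin d → ℝ)) :=
    continuous_momentumOf.measurable (measurableSet_filled hε)
  have h2 : filledRegion ε = {x | ∀ i, x i ∈ Set.Ico (0 : ℝ) 1} ∩
    momentumOf ⁻¹' {k | (ε k).re < 0} := rfl
  have h3 : ({x | ∀ i, x i ∈ Set.Ico (0 : ℝ) 1} ∩ momentumOf ⁻¹' {k | (ε k).re < 0} :
      Set (Fin d → ℝ)) =ᵐ[volume] ({x | ∀ i, x i ∈ Set.Ioc (0 : ℝ) (0 + 1)} ∩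
        momentumOf ⁻¹' {k | (ε k).re < 0} : Set (Fin d → ℝ)) := h1.inter (ae_eq_refl _)
  rw [h2, setIntegral_congr_set h3, ← setIntegral_indicator hG]
  congr 1
  ext x
  rw [torusFun_eq (fillIndicator_periodic hper) (x := x) fun i => rfl,
    mFourier_eq_phase _ (x := x) fun i => rfl, fillIndicator]
  by_cases hx : (ε (momentumOf x)).re < 0
  · simp [Set.indicator, hx]
  · simp [Set.indicator, hx]

/-- An indicator function equals its square, so its squared `L²` norm is its mean, the zeroth
coefficient. -/
theorem hasSum_sq_fillCoeff {ε : Momentum d → ℂ} (hε : Continuous ε)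
    (hper : ∀ k i, ε (k + EuclideanSpace.single i (2 * Real.pi)) = ε k) :
    HasSum (fun v => ‖fillCoeff ε v‖ ^ 2) (fillCoeff ε 0).re := by
  have h := hasSum_sq_mFourierCoeff_of_memLp
    (memLp_torusFun (measurable_fillIndicator hε) (norm_fillIndicator_le ε))
  simp only [mFourierCoeff_fillIndicator hε hper] at h
  rw [← (Equiv.neg (Fin d → ℤ)).hasSum_iff] at h
  simp only [Function.comp_def, Equiv.neg_apply, neg_neg] at h
  convert h using 1
  have h0 := mFourierCoeff_fillIndicator hε hper 0
  rw [neg_zero] at h0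
  rw [← h0, UnitAddTorus.mFourierCoeff]
  have h3 : ∀ t : UnitAddTorus (Fin d), UnitAddTorus.mFourier (-0) t •
      torusFun (fillIndicator ε) t = ((‖torusFun (fillIndicator ε) t‖ ^ 2 : ℝ) : ℂ) := by
    intro t
    rw [neg_zero, UnitAddTorus.mFourier_zero, ContinuousMap.one_apply, one_smul, torusFun,
      fillIndicator, Set.indicator_apply]
    split_ifs <;> simp
  simp only [h3]
  rw [integral_complex_ofReal, Complex.ofReal_re]

theorem norm_sub_one_sq (θ : ℝ) : ‖Complex.exp (Complex.I * θ) - 1‖ ^ 2 = 2 - 2 * Real.cos θ := by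
  rw [← Complex.normSq_eq_norm_sq, mul_comm, Complex.exp_mul_I, Complex.normSq_apply]
  simp only [Complex.sub_re, Complex.add_re, Complex.cos_ofReal_re, Complex.mul_re,
    Complex.sin_ofReal_re, Complex.I_re, Complex.sin_ofReal_im, Complex.I_im, Complex.one_re,
    Complex.sub_im, Complex.add_im, Complex.cos_ofReal_im, Complex.mul_im, Complex.one_im]
  nlinarith [Real.sin_sq_add_cos_sq θ]

/-- Parseval for the difference of the indicator and its translate: the difference has modulus 1
exactly on the change set, and translation multiplies the coefficient at `v` by a phase of angle `s
v_i` up to sign. By periodicity any box of edge `2π` serves. -/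
theorem hasSum_change {ε : Momentum d → ℂ} (hε : Continuous ε)
    (hper : ∀ k i, ε (k + EuclideanSpace.single i (2 * Real.pi)) = ε k) (i : Fin d) (s b : ℝ) :
    HasSum (fun v => ‖fillCoeff ε v‖ ^ 2 * (2 - 2 * Real.cos (s * v i)))
      (((2 * Real.pi) ^ d)⁻¹ *
        (volume (changeSet ε (s • EuclideanSpace.single i (1 : ℝ)) ∩ periodBox b)).toReal) := by
  set w : Momentum d := s • EuclideanSpace.single i (1 : ℝ) with hw
  set y : Fin d → ℝ := Pi.single i (s / (2 * Real.pi)) with hy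
  set τ : UnitAddTorus (Fin d) := fun j => ((y j : ℝ) : UnitAddCircle) with hτ
  have hpi := Real.pi_pos
  have hmy : momentumOf y = w := by
    ext j
    by_cases h : j = i
    · subst h; simp [momentumOf, hy, hw]; field_simp
    · simp [momentumOf, hy, hw, h]
  have hmadd : ∀ x, momentumOf (x + y) = momentumOf x + w := by
    intro x
    rw [← hmy]; ext j; simp [momentumOf]; ring
  set g := torusFun (fillIndicator ε) with hg
  have hgL : MemLp g 2 volume :=
    memLp_torusFun (measurable_fillIndicator hε) (norm_fillIndicator_le ε)
  have hgτ : MemLp (fun t => g (t + τ)) 2 volume :=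
    hgL.comp_measurePreserving (measurePreserving_add_right volume τ)
  have h := hasSum_sq_mFourierCoeff_of_memLp (hgτ.sub hgL)
  have hgx : ∀ x : Fin d → ℝ, g (fun i => x i) = fillIndicator ε (momentumOf x) := fun x =>
    torusFun_eq (fillIndicator_periodic hper) fun i => rfl
  have hgxτ : ∀ x : Fin d → ℝ, g ((fun i => ((x i : ℝ) : UnitAddCircle)) + τ) =
      fillIndicator ε (momentumOf x + w) := by
    intro x
    rw [← hmadd]
    exact torusFun_eq (fillIndicator_periodic hper) fun i => rfl
  have hcoef : ∀ n, UnitAddTorus.mFourierCoeff ((fun t => g (t + τ)) - g) n =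
      (UnitAddTorus.mFourier n τ - 1) * fillCoeff ε (-n) := by
    intro n
    have e1 : ∀ {u : UnitAddTorus (Fin d) → ℂ}, MemLp u 2 volume →
        Integrable fun t => UnitAddTorus.mFourier (-n) t • u t := by
      intro u hu
      refine (hu.integrable one_le_two).bdd_smul 1
        (UnitAddTorus.mFourier (-n)).continuous.aestronglyMeasurable (Eventually.of_forall fun t => ?_)
      exact (ContinuousMap.norm_coe_le_norm _ t).trans UnitAddTorus.mFourier_norm.le
    rw [sub_mul, one_mul, ← mFourierCoeff_fillIndicator hε hper, ← mFourierCoeff_comp_add,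
      UnitAddTorus.mFourierCoeff, UnitAddTorus.mFourierCoeff, UnitAddTorus.mFourierCoeff,
      ← integral_sub (e1 hgτ) (e1 hgL)]
    simp only [Pi.sub_apply, smul_sub]
  have hphase : ∀ n : Fin d → ℤ, UnitAddTorus.mFourier n τ = Complex.exp (Complex.I * (s * n i : ℝ)) := by
    intro n
    rw [mFourier_eq_phase n (x := y) fun i => rfl, hmy, phase]
    congr 3
    rw [Finset.sum_eq_single i]
    · simp [hw]
    · intro j _ hj; simp [hw, hj]
    · simp
  have hval : ∫ t, ‖((fun t => g (t + τ)) - g) t‖ ^ 2 = ((2 * Real.pi) ^ d)⁻¹ *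
        (volume (changeSet ε w ∩ periodBox b)).toReal := by
    rw [UnitAddTorus.integral_preimage _ (fun _ => b / (2 * Real.pi))]
    have e1 : ∀ x : Fin d → ℝ, ‖((fun t => g (t + τ)) - g) (fun i => (x i : UnitAddCircle))‖ ^ 2 =
        (momentumOf ⁻¹' changeSet ε w).indicator 1 x := by
      intro x
      simp only [Pi.sub_apply]
      rw [hgxτ, hgx]
      simp only [fillIndicator, Set.indicator_apply, changeSet, Set.mem_ofPred_eq]
      by_cases h1 : (ε (momentumOf x)).re < 0 <;> by_cases h2 : (ε (momentumOf x + w)).re < 0 <;>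
        simp [h1, h2]
    have hm : MeasurableSet (momentumOf ⁻¹' changeSet ε w : Set (Fin d → ℝ)) :=
      continuous_momentumOf.measurable (measurableSet_changeSet hε w)
    have e2 : ({x | ∀ i, x i ∈ Set.Ioc (b / (2 * Real.pi)) (b / (2 * Real.pi) + 1)} :
        Set (Fin d → ℝ)) = momentumOf ⁻¹' periodBox b := by
      ext x
      simp only [Set.mem_ofPred_eq, Set.mem_preimage, periodBox, momentumOf, Set.mem_Ioc]
      refine forall_congr' fun j => and_congr ?_ ?_
      · rw [div_lt_iff₀ (by positivity), mul_comm]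
      · rw [← sub_le_iff_le_add, le_div_iff₀ (by positivity)]
        constructor <;> intro h <;> linarith
    simp only [e1]
    rw [integral_indicator_one hm, measureReal_def, Measure.restrict_apply hm, e2,
      ← Set.preimage_inter, volume_preimage_momentumOf, ENNReal.toReal_mul,
      ENNReal.toReal_ofReal (by positivity)]
  rw [hval] at h
  rw [← (Equiv.neg (Fin d → ℤ)).hasSum_iff] at h
  refine h.congr_fun fun v => ?_
  simp only [Function.comp_def, Equiv.neg_apply, hcoef, neg_neg, norm_mul, mul_pow, hphase]
  rw [norm_sub_one_sq, mul_comm]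
  simp

end Coefficients

end FreeFermion

namespace FreeFermion

open Filter Topology MeasureTheory
open scoped ENNReal NNReal

/-! ## Logarithmic growth -/

section Growth

variable {d N : ℕ}

/-- The full series equals `π|θ|/2 - θ²/4` for `|θ| ≤ 2π`, by the Fourier series of the second
Bernoulli polynomial, and is always at most `2ζ(2)`. For larger `|θ|` the constant is the smaller
bound. This compares the truncated weight `min(|v_i|, M)` with cosines. -/
theorem sum_one_sub_cos_le (K : ℕ) (θ : ℝ) :
    ∑ m ∈ Finset.range K, (1 - Real.cos ((m + 1 : ℕ) * θ)) / ((m + 1 : ℕ) : ℝ) ^ 2 ≤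
      min (Real.pi * |θ| / 2) (Real.pi ^ 2 / 3) := by
  have hz : HasSum (fun n : ℕ => (1 : ℝ) / (n : ℝ) ^ 2) (Real.pi ^ 2 / 6) := hasSum_zeta_two
  have hsum : ∀ g : ℕ → ℝ, ∀ s, (∀ n, 0 ≤ g n) → HasSum g s →
      ∑ m ∈ Finset.range K, g (m + 1) ≤ s := by
    intro g s hg h
    have h1 : ∑ m ∈ Finset.range K, g (m + 1) = ∑ m ∈ Finset.Ico 1 (K + 1), g m := by
      rw [Finset.sum_Ico_eq_sum_range]
      simp [add_comm]
    rw [h1]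
    exact sum_le_hasSum _ (fun n _ => hg n) h
  have hcos : ∀ n : ℕ, 0 ≤ (1 - Real.cos (n * θ)) / (n : ℝ) ^ 2 := fun n =>
    div_nonneg (by linarith [Real.cos_le_one (n * θ)]) (by positivity)
  have h3 : ∑ m ∈ Finset.range K, (1 - Real.cos ((m + 1 : ℕ) * θ)) / ((m + 1 : ℕ) : ℝ) ^ 2 ≤
      Real.pi ^ 2 / 3 := by
    calc _ ≤ ∑ m ∈ Finset.range K, 2 * (1 / ((m + 1 : ℕ) : ℝ) ^ 2) := by
          refine Finset.sum_le_sum fun m _ => ?_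
          rw [mul_one_div]
          gcongr
          linarith [Real.neg_one_le_cos ((m + 1 : ℕ) * θ)]
      _ ≤ 2 * (Real.pi ^ 2 / 6) := hsum (fun n => 2 * (1 / (n : ℝ) ^ 2)) _
          (fun n => by positivity) (hz.mul_left 2)
      _ = _ := by ring
  refine le_min ?_ h3
  rcases le_or_gt |θ| (2 * Real.pi) with hθ | hθ
  · have hx : |θ| / (2 * Real.pi) ∈ Set.Icc (0 : ℝ) 1 :=
      ⟨by positivity, (div_le_one Real.two_pi_pos).mpr hθ⟩
    have hc := hasSum_one_div_nat_pow_mul_cos (k := 1) one_ne_zero hx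
    have hval : (Polynomial.map (algebraMap ℚ ℝ) (Polynomial.bernoulli (2 * 1))).eval
        (|θ| / (2 * Real.pi)) =
        (|θ| / (2 * Real.pi)) ^ 2 - |θ| / (2 * Real.pi) + 1 / 6 := by
      rw [mul_one, Polynomial.bernoulli]
      simp [Finset.sum_range_succ, bernoulli_one, bernoulli_two]
      ring
    rw [hval] at hc
    have hd := hz.sub hc
    refine (hsum (fun n => (1 - Real.cos (n * θ)) / (n : ℝ) ^ 2) _ hcos
      (hd.congr_fun fun n => ?_)).trans ?_
    · have : Real.cos (2 * Real.pi * n * (|θ| / (2 * Real.pi))) = Real.cos (n * θ) := by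
        have e : 2 * Real.pi * n * (|θ| / (2 * Real.pi)) = n * |θ| := by
          field_simp
        rw [e]
        rcases abs_choice θ with h | h <;> rw [h]
        rw [mul_neg, Real.cos_neg]
      rw [this]
      simp only [mul_one]
      ring
    · have e : Real.pi ^ 2 / 6 - (-1) ^ (1 + 1) * (2 * Real.pi) ^ (2 * 1) / 2 /
          ((2 * 1).factorial : ℝ) * ((|θ| / (2 * Real.pi)) ^ 2 - |θ| / (2 * Real.pi) + 1 / 6) =
          Real.pi * |θ| / 2 - |θ| ^ 2 / 4 := by
        have := Real.pi_pos
        simp [Nat.factorial, -sq_abs]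
        field_simp
        ring
      rw [e]
      have : 0 ≤ |θ| ^ 2 := by positivity
      linarith
  · refine h3.trans ?_
    nlinarith [Real.pi_pos]

/-- The number of pairs of sites of the cube with a given difference. -/
def pairCount (L : ℕ) (v : Fin d → ℤ) : ℕ :=
  (Finset.univ.filter fun p : (Fin d → Fin L) × (Fin d → Fin L) =>
    siteVector p.1 - siteVector p.2 = v).card

theorem card_shift_le (L : ℕ) (v : ℤ) :
    ((Finset.univ.filter fun x : Fin L => 0 ≤ (x : ℤ) - v ∧ (x : ℤ) - v < L).card : ℤ) ≤
      L - min |v| L := by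
  have h1 : (Finset.univ.filter fun x : Fin L => 0 ≤ (x : ℤ) - v ∧ (x : ℤ) - v < L).card =
      (Finset.Ico (max 0 v) (min (L : ℤ) (L + v))).card := by
    refine Finset.card_bij (fun x _ => ((x : ℕ) : ℤ)) ?_ ?_ ?_
    · intro x hx
      simp only [Finset.mem_filter, Finset.mem_univ, true_and] at hx
      have := x.2
      simp only [Finset.mem_Ico]
      omega
    · intro x _ y _ h
      exact Fin.ext (by exact_mod_cast h)
    · intro z hz
      simp only [Finset.mem_Ico] at hz
      refine ⟨⟨z.toNat, by omega⟩, ?_, ?_⟩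
      · simp only [Finset.mem_filter, Finset.mem_univ, true_and]
        omega
      · simp only
        omega
  rw [h1, Int.card_Ico]
  rcases abs_cases v with ⟨h, _⟩ | ⟨h, _⟩ <;> rw [h] <;> omega

theorem pairCount_le (L : ℕ) (v : Fin d → ℤ) :
    (pairCount L v : ℝ) ≤ ∏ i, ((L : ℝ) - min |(v i : ℝ)| L) := by
  have h1 : pairCount L v ≤ (Fintype.piFinset fun i => Finset.univ.filter fun x : Fin L =>
      0 ≤ (x : ℤ) - v i ∧ (x : ℤ) - v i < L).card := by
    refine Finset.card_le_card_of_injOn Prod.fst ?_ ?_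
    · intro p hp
      simp only [Finset.coe_filter, Finset.mem_univ, true_and, Set.mem_ofPred_eq] at hp
      simp only [Finset.mem_coe, Fintype.mem_piFinset, Finset.mem_filter, Finset.mem_univ, true_and]
      intro i
      have := congrFun hp i
      simp only [siteVector, Pi.sub_apply] at this
      have := (p.2 i).2
      omega
    · intro p hp q hq hpq
      simp only [Finset.coe_filter, Finset.mem_univ, true_and, Set.mem_ofPred_eq] at hp hq
      refine Prod.ext hpq ?_
      funext i
      have e1 := congrFun hp i
      have e2 := congrFun hq i
      simp only [siteVector, Pi.sub_apply] at e1 e2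
      have e3 : ((p.1 i : ℕ) : ℤ) = (q.1 i : ℕ) := by rw [hpq]
      exact Fin.ext (by omega)
  calc (pairCount L v : ℝ) ≤ ((Fintype.piFinset fun i => Finset.univ.filter fun x : Fin L =>
      0 ≤ (x : ℤ) - v i ∧ (x : ℤ) - v i < L).card : ℝ) := by exact_mod_cast h1
    _ = ∏ i, ((Finset.univ.filter fun x : Fin L =>
      0 ≤ (x : ℤ) - v i ∧ (x : ℤ) - v i < L).card : ℝ) := by
        rw [Fintype.card_piFinset]; push_cast; rfl
    _ ≤ _ := by
        refine Finset.prod_le_prod (fun i _ => by positivity) fun i _ => ?_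
        have := card_shift_le L (v i)
        exact_mod_cast this

theorem one_add_sum_le_prod {ι : Type*} (t : Finset ι) {s : ι → ℝ} (hs : ∀ i ∈ t, 0 ≤ s i) :
    1 + ∑ i ∈ t, s i ≤ ∏ i ∈ t, (1 + s i) := by
  classical
  induction t using Finset.induction_on with
  | empty => simp
  | insert a t ha ih =>
    rw [Finset.sum_insert ha, Finset.prod_insert ha]
    have h1 := ih fun i hi => hs i (Finset.mem_insert_of_mem hi)
    have h2 := hs a (Finset.mem_insert_self a t)
    have h3 : 0 ≤ ∑ i ∈ t, s i := Finset.sum_nonneg fun i hi => hs i (Finset.mem_insert_of_mem hi)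
    nlinarith

/-- With `s_i = min(|v_i|, M)/L` the fraction of pairs is at most `∏(1 - s_i)`, and `∏(1 - s_i) (1 +
∑ s_i) ≤ ∏(1 - s_i²) ≤ 1`. The truncation at `M` keeps `∑ s_i ≤ η`, so linearizing costs only the
factor `1 + η`. -/
theorem pairCount_le_sub {L M : ℕ} (hL : 0 < L) (hd : 0 < d) {η : ℝ} (hη : 0 ≤ η)
    (hM : (d : ℝ) * M ≤ η * L) (hML : M ≤ L) (v : Fin d → ℤ) :
    (L : ℝ) ^ (d - 1) * (1 + η)⁻¹ * ∑ i, min |(v i : ℝ)| M ≤ (L : ℝ) ^ d - pairCount L v := by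
  have hL' : (0 : ℝ) < L := by exact_mod_cast hL
  have hML' : (M : ℝ) ≤ L := by exact_mod_cast hML
  set s : Fin d → ℝ := fun i => min |(v i : ℝ)| M / L with hs
  have hs0 : ∀ i, 0 ≤ s i := fun i => div_nonneg (le_min (abs_nonneg _) (by positivity)) hL'.le
  have hs1 : ∀ i, s i ≤ 1 := fun i => (div_le_one hL').mpr ((min_le_right _ _).trans hML')
  have hsη : ∑ i, s i ≤ η := by
    calc ∑ i, s i ≤ ∑ _i : Fin d, (M : ℝ) / L :=
          Finset.sum_le_sum fun i _ => div_le_div_of_nonneg_right (min_le_right _ _) hL'.le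
      _ = d * M / L := by simp; ring
      _ ≤ η := by rw [div_le_iff₀ hL']; exact hM
  have hS0 : 0 ≤ ∑ i, s i := Finset.sum_nonneg fun i _ => hs0 i
  have h1 : (pairCount L v : ℝ) ≤ L ^ d * ∏ i, (1 - s i) := by
    refine (pairCount_le L v).trans ?_
    have e : (L : ℝ) ^ d = ∏ _i : Fin d, (L : ℝ) := by simp
    rw [e, ← Finset.prod_mul_distrib]
    refine Finset.prod_le_prod (fun i _ => sub_nonneg.mpr (min_le_right _ _)) fun i _ => ?_
    have e2 : (L : ℝ) * (1 - s i) = L - min |(v i : ℝ)| M := by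
      rw [hs]; field_simp
    rw [e2]
    have := min_le_min_left |(v i : ℝ)| hML'
    linarith
  have h2 : (∏ i, (1 - s i)) * (1 + ∑ i, s i) ≤ 1 := by
    calc (∏ i, (1 - s i)) * (1 + ∑ i, s i) ≤ (∏ i, (1 - s i)) * ∏ i, (1 + s i) := by
          refine mul_le_mul_of_nonneg_left ?_ (Finset.prod_nonneg fun i _ => sub_nonneg.mpr (hs1 i))
          exact one_add_sum_le_prod _ fun i _ => hs0 i
      _ = ∏ i, (1 - s i ^ 2) := by
          rw [← Finset.prod_mul_distrib]
          exact Finset.prod_congr rfl fun i _ => by ring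
      _ ≤ 1 := Finset.prod_le_one (fun i _ => by nlinarith [hs0 i, hs1 i])
          fun i _ => by nlinarith [hs0 i]
  have h3 : (∑ i, s i) * (1 + η)⁻¹ ≤ 1 - ∏ i, (1 - s i) := by
    rw [← div_eq_mul_inv, div_le_iff₀ (by linarith)]
    have hp1 : ∏ i, (1 - s i) ≤ 1 :=
      Finset.prod_le_one (fun i _ => sub_nonneg.mpr (hs1 i)) fun i _ => by linarith [hs0 i]
    nlinarith
  have h4 : ∑ i, min |(v i : ℝ)| M = L * ∑ i, s i := by
    rw [Finset.mul_sum]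
    refine Finset.sum_congr rfl fun i _ => ?_
    rw [hs]; field_simp
  have h5 : (L : ℝ) ^ d = L ^ (d - 1) * L := by rw [← pow_succ, Nat.sub_add_cancel hd]
  rw [h4]
  calc (L : ℝ) ^ (d - 1) * (1 + η)⁻¹ * (L * ∑ i, s i) = L ^ d * ((∑ i, s i) * (1 + η)⁻¹) := by
        rw [h5]; ring
    _ ≤ L ^ d * (1 - ∏ i, (1 - s i)) := by gcongr
    _ ≤ _ := by linarith

/-- The boundary sum `∑_v |a_v|² ∑_i min(|v_i|, M)` of the Fourier coefficients. -/
noncomputable def boundarySum (ε : Momentum d → ℂ) (M : ℕ) : ℝ :=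
  ∑' v, ‖fillCoeff ε v‖ ^ 2 * ∑ i, min |(v i : ℝ)| M

theorem summable_min {ε : Momentum d → ℂ} (hs : Summable fun v => ‖fillCoeff ε v‖ ^ 2) (M : ℕ)
    (i : Fin d) : Summable fun v => ‖fillCoeff ε v‖ ^ 2 * min |(v i : ℝ)| M := by
  refine Summable.of_nonneg_of_le (fun v => ?_) (fun v => ?_) (hs.mul_right (M : ℝ))
  · exact mul_nonneg (by positivity) (le_min (abs_nonneg _) (by positivity))
  · exact mul_le_mul_of_nonneg_left (min_le_right _ _) (by positivity)

theorem boundarySum_eq {ε : Momentum d → ℂ} (hs : Summable fun v => ‖fillCoeff ε v‖ ^ 2) (M : ℕ) :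
    boundarySum ε M = ∑ i, ∑' v, ‖fillCoeff ε v‖ ^ 2 * min |(v i : ℝ)| M := by
  rw [boundarySum, ← Summable.tsum_finsetSum fun i _ => summable_min hs M i]
  exact tsum_congr fun v => Finset.mul_sum _ _ _

/-- Parseval writes the zeroth coefficient as `∑ |a_v|²`, and grouping the pairs of sites by their
difference writes the double sum as `∑ |a_v|² pairCount(v)`. The estimate then holds term by term.
-/
theorem sum_pairs_le {ε : Momentum d → ℂ} (hε : Continuous ε)
    (hper : ∀ k i, ε (k + EuclideanSpace.single i (2 * Real.pi)) = ε k)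
    {L M : ℕ} (hL : 0 < L) (hd : 0 < d) {η : ℝ} (hη : 0 ≤ η)
    (hM : (d : ℝ) * M ≤ η * L) (hML : M ≤ L) :
    (L : ℝ) ^ (d - 1) * (1 + η)⁻¹ * boundarySum ε M ≤ (L : ℝ) ^ d * (fillCoeff ε 0).re -
      ∑ x : Fin d → Fin L, ∑ y : Fin d → Fin L,
        ‖fillCoeff ε (siteVector x - siteVector y)‖ ^ 2 := by
  have h := hasSum_sq_fillCoeff hε hper
  have h1 : HasSum (fun v => ‖fillCoeff ε v‖ ^ 2 * (pairCount L v : ℝ))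
      (∑ x : Fin d → Fin L, ∑ y : Fin d → Fin L,
        ‖fillCoeff ε (siteVector x - siteVector y)‖ ^ 2) := by
    rw [← Fintype.sum_prod_type']
    have h2 : ∀ p : (Fin d → Fin L) × (Fin d → Fin L), HasSum (fun v =>
        if v = siteVector p.1 - siteVector p.2 then ‖fillCoeff ε v‖ ^ 2 else 0)
        (‖fillCoeff ε (siteVector p.1 - siteVector p.2)‖ ^ 2) := by
      intro p
      convert hasSum_ite_eq (siteVector p.1 - siteVector p.2)
        (‖fillCoeff ε (siteVector p.1 - siteVector p.2)‖ ^ 2) using 2 with v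
      split_ifs with hv
      · rw [hv]
      · rfl
    refine (hasSum_sum fun p (_ : p ∈ Finset.univ) => h2 p).congr_fun fun v => ?_
    rw [pairCount, Finset.card_filter]
    push_cast
    rw [Finset.mul_sum]
    refine Finset.sum_congr rfl fun p _ => ?_
    simp only [eq_comm (a := v)]
    split_ifs <;> simp
  have h3 := (h.mul_left ((L : ℝ) ^ d)).sub h1
  have hs2 : Summable fun v => ‖fillCoeff ε v‖ ^ 2 * ∑ i, min |(v i : ℝ)| M := by
    simp only [Finset.mul_sum]
    exact summable_sum fun i _ => summable_min h.summable M i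
  refine hasSum_le (fun v => ?_) (hs2.hasSum.mul_left ((L : ℝ) ^ (d - 1) * (1 + η)⁻¹)) h3
  have := pairCount_le_sub hL hd hη hM hML v
  nlinarith [sq_nonneg ‖fillCoeff ε v‖]

theorem trace_toeplitz_sub (E : Fin N → Momentum d → ℂ) (L : ℕ) :
    (toeplitz L fun α => fillCoeff (E α)).trace.re -
      ((toeplitz L fun α => fillCoeff (E α)) * toeplitz L fun α => fillCoeff (E α)).trace.re =
    ∑ α, ((L : ℝ) ^ d * (fillCoeff (E α) 0).re - ∑ x : Fin d → Fin L, ∑ y : Fin d → Fin L,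
        ‖fillCoeff (E α) (siteVector x - siteVector y)‖ ^ 2) := by
  have h1 : (toeplitz L fun α => fillCoeff (E α)).trace.re =
      ∑ α, (L : ℝ) ^ d * (fillCoeff (E α) 0).re := by
    rw [Matrix.trace, Complex.re_sum, Fintype.sum_prod_type_right]
    refine Finset.sum_congr rfl fun α _ => ?_
    simp [toeplitz]
  have h2 : ((toeplitz L fun α => fillCoeff (E α)) * toeplitz L fun α => fillCoeff (E α)).trace.re =
      ∑ α, ∑ x : Fin d → Fin L, ∑ y : Fin d → Fin L,
        ‖fillCoeff (E α) (siteVector x - siteVector y)‖ ^ 2 := by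
    rw [Matrix.trace, Complex.re_sum, Fintype.sum_prod_type_right]
    refine Finset.sum_congr rfl fun α _ => Finset.sum_congr rfl fun x _ => ?_
    rw [Matrix.diag_apply, Matrix.mul_apply, Complex.re_sum, Fintype.sum_prod_type]
    refine Finset.sum_congr rfl fun y _ => ?_
    rw [Finset.sum_eq_single α]
    · simp only [toeplitz, Matrix.of_apply, if_true]
      rw [← neg_sub (siteVector x) (siteVector y), fillCoeff_neg, Complex.mul_conj,
        Complex.ofReal_re, Complex.normSq_eq_norm_sq]
    · intro β _ hβ
      simp [toeplitz, Ne.symm hβ]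
    · simp
  rw [h1, h2, ← Finset.sum_sub_distrib]

theorem limitEntropy_ge_boundarySum {E : Fin N → Momentum d → ℂ} (hE : ∀ α, Continuous (E α))
    (hper : ∀ α k i, E α (k + EuclideanSpace.single i (2 * Real.pi)) = E α k)
    (hfr : ∀ α, volume (frontier (filledRegion (E α))) = 0)
    {L M : ℕ} (hL : 0 < L) (hd : 0 < d) {η : ℝ} (hη : 0 ≤ η)
    (hM : (d : ℝ) * M ≤ η * L) (hML : M ≤ L) :
    5 / 2 * ((L : ℝ) ^ (d - 1) * (1 + η)⁻¹ * ∑ α, boundarySum (E α) M) ≤ limitEntropy E L := by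
  refine le_trans ?_ (limitEntropy_ge hE hfr L)
  rw [trace_toeplitz_sub, Finset.mul_sum]
  gcongr with α
  exact sum_pairs_le (hE α) (hper α) hL hd hη hM hML

/-- The changes of the occupation under all small translations bound the boundary sum from below. -/
theorem sum_change_le_boundarySum {ε : Momentum d → ℂ} (hε : Continuous ε)
    (hper : ∀ k i, ε (k + EuclideanSpace.single i (2 * Real.pi)) = ε k) (b : ℝ) {M : ℕ}
    (hM : 0 < M) (K : ℕ) :
    ∑ m ∈ Finset.range K, (((m + 1 : ℕ) : ℝ) ^ 2)⁻¹ * (((2 * Real.pi) ^ d)⁻¹ * ∑ i,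
      (volume (changeSet ε ((((m + 1 : ℕ) : ℝ) * (2 * Real.pi / (3 * M))) •
        EuclideanSpace.single i (1 : ℝ)) ∩ periodBox b)).toReal) ≤
      Real.pi * (2 * Real.pi / (3 * M)) * boundarySum ε M := by
  have hs := (hasSum_sq_fillCoeff hε hper).summable
  have hM' : (0 : ℝ) < M := by exact_mod_cast hM
  have hpi := Real.pi_pos
  set h : ℝ := 2 * Real.pi / (3 * M) with hh
  have hh0 : 0 < h := by positivity
  have h1 : ∀ i : Fin d, ∑ m ∈ Finset.range K, (((m + 1 : ℕ) : ℝ) ^ 2)⁻¹ *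
      (((2 * Real.pi) ^ d)⁻¹ * (volume (changeSet ε ((((m + 1 : ℕ) : ℝ) * h) •
        EuclideanSpace.single i (1 : ℝ)) ∩ periodBox b)).toReal) ≤
      Real.pi * h * ∑' v, ‖fillCoeff ε v‖ ^ 2 * min |(v i : ℝ)| M := by
    intro i
    have h2 := hasSum_sum fun m (_ : m ∈ Finset.range K) =>
      (hasSum_change hε hper i (((m + 1 : ℕ) : ℝ) * h) b).mul_left (((m + 1 : ℕ) : ℝ) ^ 2)⁻¹
    refine hasSum_le (fun v => ?_) h2 ((summable_min hs M i).hasSum.mul_left (Real.pi * h))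
    have h3 := sum_one_sub_cos_le K (h * v i)
    -- The step `h = 2π/(3M)` is chosen so that the two branches of the minimum meet exactly at
    -- `|v_i| = M`.
    have h4 : min (Real.pi * |h * v i| / 2) (Real.pi ^ 2 / 3) =
        Real.pi * h / 2 * min |(v i : ℝ)| M := by
      rw [mul_min_of_nonneg _ _ (by positivity : 0 ≤ Real.pi * h / 2)]
      rw [abs_mul, abs_of_pos hh0]
      congr 1
      · ring
      · rw [hh]; field_simp
    rw [h4] at h3
    calc ∑ m ∈ Finset.range K, (((m + 1 : ℕ) : ℝ) ^ 2)⁻¹ * (‖fillCoeff ε v‖ ^ 2 *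
          (2 - 2 * Real.cos (((m + 1 : ℕ) : ℝ) * h * v i)))
        = 2 * ‖fillCoeff ε v‖ ^ 2 * ∑ m ∈ Finset.range K,
          (1 - Real.cos ((m + 1 : ℕ) * (h * v i))) / ((m + 1 : ℕ) : ℝ) ^ 2 := by
          rw [Finset.mul_sum]
          refine Finset.sum_congr rfl fun m _ => ?_
          rw [mul_assoc ((m + 1 : ℕ) : ℝ) h]
          ring
      _ ≤ 2 * ‖fillCoeff ε v‖ ^ 2 * (Real.pi * h / 2 * min |(v i : ℝ)| M) := by gcongr
      _ = _ := by ring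
  rw [boundarySum_eq hs, Finset.mul_sum]
  refine le_trans (le_of_eq ?_) (Finset.sum_le_sum fun i _ => h1 i)
  rw [Finset.sum_comm]
  refine Finset.sum_congr rfl fun m _ => ?_
  rw [Finset.mul_sum, Finset.mul_sum]

/-- If the sign of `f` changes under a translation, the occupation of at least one of the two bands
changes, so the area bound for `f` passes to the sum over both. With volumes at least `(1-η) A m h`
and weights `1/m²`, the sum over `m` is harmonic. -/
theorem boundarySum_pair_ge (hd : 0 < d) {f : Momentum d → ℝ} (hreg : RegularZeros f)
    (hf : Continuous f) {ε₁ ε₂ : Momentum d → ℂ} (hε₁ : Continuous ε₁) (hε₂ : Continuous ε₂)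
    (hper₁ : ∀ k i, ε₁ (k + EuclideanSpace.single i (2 * Real.pi)) = ε₁ k)
    (hper₂ : ∀ k i, ε₂ (k + EuclideanSpace.single i (2 * Real.pi)) = ε₂ k)
    (hfε : ∀ k, 0 < f k ↔ (ε₁ k).re < 0 ∨ (ε₂ k).re < 0) {η : ℝ} (hη : 0 < η) (hη1 : η ≤ 1) :
    ∃ c : ℝ, 0 < c ∧ ∀ M : ℕ, 0 < M →
      2 * ((1 - η) * (μHE[d - 1] ({k | f k = 0} ∩ brillouinZone d)).toReal) /
        (2 * Real.pi) ^ (d + 1) * Real.log (c * M) ≤ boundarySum ε₁ M + boundarySum ε₂ M := by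
  obtain ⟨t₀, ht₀, b, hb⟩ := hreg.shift_ge hd hf hη
  set A := (μHE[d - 1] ({k | f k = 0} ∩ brillouinZone d)).toReal with hA
  have hpi := Real.pi_pos
  refine ⟨3 * t₀ / (2 * Real.pi), by positivity, fun M hM => ?_⟩
  have hM' : (0 : ℝ) < M := by exact_mod_cast hM
  set h : ℝ := 2 * Real.pi / (3 * M) with hh
  have hh0 : 0 < h := by positivity
  have hAη : ∀ t, 0 < t → t < t₀ → (1 - η) * A * t ≤
      ∑ i, (volume (changeSet ε₁ (t • EuclideanSpace.single i (1 : ℝ)) ∩ periodBox b)).toReal +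
      ∑ i, (volume (changeSet ε₂ (t • EuclideanSpace.single i (1 : ℝ)) ∩ periodBox b)).toReal := by
    intro t h1 h2
    refine (hb t h1 h2).trans ?_
    rw [← Finset.sum_add_distrib]
    refine Finset.sum_le_sum fun i _ => ?_
    set w := t • EuclideanSpace.single i (1 : ℝ)
    have hfin : ∀ S : Set (Momentum d), volume (S ∩ periodBox b) ≠ ⊤ := fun S =>
      ((measure_mono Set.inter_subset_right).trans_lt (volume_periodBox_lt_top b)).ne
    rw [← ENNReal.toReal_add (hfin _) (hfin _)]
    refine ENNReal.toReal_mono (ENNReal.add_ne_top.mpr ⟨hfin _, hfin _⟩) ?_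
    refine le_trans (measure_mono ?_) (measure_union_le _ _)
    rw [← Set.union_inter_distrib_right]
    refine Set.inter_subset_inter_left _ fun k hk => ?_
    simp only [shiftSet, Set.mem_ofPred_eq, hfε, changeSet, Set.mem_union] at hk ⊢
    tauto
  -- This is the number of multiples `m h`, `m ≥ 1`, strictly below `t₀`; the harmonic sum up to `K`
  -- is at least `log (K+1) ≥ log (t₀/h)`, and `t₀/h` is a constant times `M`.
  set K := ⌈t₀ / h⌉₊ - 1 with hK
  have hceil : 0 < ⌈t₀ / h⌉₊ := Nat.ceil_pos.mpr (by positivity)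
  have hK1 : K + 1 = ⌈t₀ / h⌉₊ := by omega
  have hK2 : (K : ℝ) * h < t₀ := by
    rw [← lt_div_iff₀ hh0]
    exact Nat.lt_ceil.mp (by omega)
  have hlog : Real.log (3 * t₀ / (2 * Real.pi) * M) ≤ ∑ m ∈ Finset.range K, (((m + 1 : ℕ) : ℝ))⁻¹ := by
    have h1 : Real.log ((K + 1 : ℕ) : ℝ) ≤ (harmonic K : ℝ) := log_add_one_le_harmonic K
    have h2 : (harmonic K : ℝ) = ∑ m ∈ Finset.range K, (((m + 1 : ℕ) : ℝ))⁻¹ := by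
      rw [harmonic]; push_cast; rfl
    rw [h2, hK1] at h1
    refine le_trans (Real.log_le_log (by positivity) ?_) h1
    have h3 : 3 * t₀ / (2 * Real.pi) * M = t₀ / h := by rw [hh]; field_simp
    rw [h3]
    exact Nat.le_ceil _
  have e1 := sum_change_le_boundarySum hε₁ hper₁ b hM K
  have e2 := sum_change_le_boundarySum hε₂ hper₂ b hM K
  rw [← hh] at e1 e2
  have e3 : ((2 * Real.pi) ^ d)⁻¹ * ((1 - η) * A) * h *
      ∑ m ∈ Finset.range K, (((m + 1 : ℕ) : ℝ))⁻¹ ≤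
      Real.pi * h * (boundarySum ε₁ M + boundarySum ε₂ M) := by
    rw [mul_add]
    refine le_trans ?_ (add_le_add e1 e2)
    rw [Finset.mul_sum, ← Finset.sum_add_distrib]
    refine Finset.sum_le_sum fun m hm => ?_
    have hm1 : (0 : ℝ) < ((m + 1 : ℕ) : ℝ) := by positivity
    have hm2 : ((m + 1 : ℕ) : ℝ) * h < t₀ := by
      refine lt_of_le_of_lt (mul_le_mul_of_nonneg_right ?_ hh0.le) hK2
      exact_mod_cast Finset.mem_range.mp hm
    have h1 := hAη _ (mul_pos hm1 hh0) hm2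
    rw [← mul_add, ← mul_add]
    calc ((2 * Real.pi) ^ d)⁻¹ * ((1 - η) * A) * h * ((m + 1 : ℕ) : ℝ)⁻¹
        = (((m + 1 : ℕ) : ℝ) ^ 2)⁻¹ * (((2 * Real.pi) ^ d)⁻¹ *
          ((1 - η) * A * (((m + 1 : ℕ) : ℝ) * h))) := by field_simp
      _ ≤ _ := by gcongr
  have hpos : 0 ≤ (1 - η) * A := mul_nonneg (by linarith) ENNReal.toReal_nonneg
  have e4 : ((2 * Real.pi) ^ d)⁻¹ * ((1 - η) * A) * h * Real.log (3 * t₀ / (2 * Real.pi) * M) ≤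
      Real.pi * h * (boundarySum ε₁ M + boundarySum ε₂ M) :=
      (mul_le_mul_of_nonneg_left hlog (by positivity)).trans e3
  have e5 : 2 * ((1 - η) * A) / (2 * Real.pi) ^ (d + 1) * Real.log (3 * t₀ / (2 * Real.pi) * M) *
        (Real.pi * h) = ((2 * Real.pi) ^ d)⁻¹ * ((1 - η) * A) * h *
          Real.log (3 * t₀ / (2 * Real.pi) * M) := by
      rw [pow_succ]; field_simp
  refine le_of_mul_le_mul_right ?_ (by positivity : 0 < Real.pi * h)
  rw [e5, mul_comm (boundarySum ε₁ M + boundarySum ε₂ M)]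
  exact e4

end Growth

end FreeFermion

namespace FreeFermion

open Filter Topology MeasureTheory
open scoped ENNReal NNReal

/-! ## Entropy of the gapless phase -/

section Gapless

variable {d N : ℕ} {H : LocalPTHamiltonian d N} {E : Fin N → Momentum d → ℂ}

theorem boundarySum_nonneg (ε : Momentum d → ℂ) (M : ℕ) : 0 ≤ boundarySum ε M :=
  tsum_nonneg fun v => mul_nonneg (by positivity)
    (Finset.sum_nonneg fun i _ => le_min (abs_nonneg _) (by positivity))

namespace IsGaplessBroken

theorem eq_zero_of_rev_eq (h : IsGaplessBroken H E) {α : Fin N} (hα : Fin.rev α = α)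
    (k : Momentum d) : E α k = 0 := by
  have := h.pairing α k
  rw [hα] at this
  exact self_eq_neg.mp this

theorem re_eq_zero_or_im_eq_zero (h : IsGaplessBroken H E) (α : Fin N) (k : Momentum d) :
    (E α k).re = 0 ∨ (E α k).im = 0 := by
  have h1 := h.real_or_imaginary α k
  rw [pow_two, Complex.mul_im] at h1
  have : (E α k).re * (E α k).im = 0 := by linarith
  exact mul_eq_zero.mp this

theorem sq_re_eq_zero_iff (h : IsGaplessBroken H E) (α : Fin N) (k : Momentum d) :
    (E α k ^ 2).re = 0 ↔ E α k = 0 := by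
  constructor
  · intro h1
    have : E α k ^ 2 = 0 := Complex.ext h1 (h.real_or_imaginary α k)
    exact pow_eq_zero_iff two_ne_zero |>.mp this
  · intro h1; simp [h1]

/-- Where `E²` is positive, `E` is real and non-zero, and one of `±E` is negative; where it is not
positive, `E` is imaginary or zero and neither band is filled. -/
theorem sq_re_pos_iff (h : IsGaplessBroken H E) (α : Fin N) (k : Momentum d) :
    0 < (E α k ^ 2).re ↔ (E α k).re < 0 ∨ (E (Fin.rev α) k).re < 0 := by
  rw [h.pairing, Complex.neg_re, neg_lt_zero, pow_two, Complex.mul_re]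
  rcases h.re_eq_zero_or_im_eq_zero α k with h1 | h1
  · simp only [h1, mul_zero, lt_self_iff_false, or_self, iff_false, not_lt, zero_sub]
    nlinarith
  · rw [h1, mul_zero, sub_zero, mul_self_pos]
    exact ⟨lt_or_gt_of_ne, by rintro (h2 | h2); exacts [h2.ne, h2.ne']⟩

theorem regularZeros (h : IsGaplessBroken H E) {α : Fin N} (hα : Fin.rev α ≠ α) :
    RegularZeros fun k => (E α k ^ 2).re :=
  fun k hk => h.square_root α hα k ((h.sq_re_eq_zero_iff α k).mp hk)

theorem continuous_sq_re (h : IsGaplessBroken H E) (α : Fin N) :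
    Continuous fun k => (E α k ^ 2).re :=
  Complex.continuous_re.comp ((h.bands.continuous α).pow 2)

theorem ringArea_eq (h : IsGaplessBroken H E) (α : Fin N) : ringArea E α =
    (μHE[d - 1] ({k | (E α k ^ 2).re = 0} ∩ brillouinZone d)).toReal := by
  rw [ringArea]
  congr 2
  ext k
  simp only [Set.mem_inter_iff, Set.mem_ofPred_eq, h.sq_re_eq_zero_iff]
  exact and_comm

theorem ringArea_rev (h : IsGaplessBroken H E) (α : Fin N) :
    ringArea E (Fin.rev α) = ringArea E α := by
  simp only [ringArea, h.pairing, neg_eq_zero]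

theorem volume_frontier (hd : 0 < d) (h : IsGaplessBroken H E) (α : Fin N) :
    volume (frontier (filledRegion (E α))) = 0 := by
  by_cases hα : Fin.rev α = α
  · have : filledRegion (E α) = ∅ := by
      ext x
      simp [filledRegion, h.eq_zero_of_rev_eq hα]
    rw [this]; simp
  · exact volume_frontier_filledRegion hd (h.bands.continuous α) (h.real_or_imaginary α)
      (h.regularZeros hα)

/-- A band with imaginary energies is not the middle band and has a zero, so its ring has positive
area. If it is the upper index of its pair, the partner carries the same ring. -/
theorem fermiArea_pos (hd : 0 < d) (h : IsGaplessBroken H E) : 0 < fermiArea E := by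
  obtain ⟨α, k, hk1, hk2⟩ := h.broken
  obtain ⟨p, hp⟩ := h.surrounded α ⟨k, hk1, hk2⟩
  have hα : Fin.rev α ≠ α := by
    intro hα
    exact hk2 (by rw [h.eq_zero_of_rev_eq hα]; rfl)
  have hpos : 0 < ringArea E α := by
    rw [h.ringArea_eq]
    refine ENNReal.toReal_pos ?_ ((h.regularZeros hα).zone_lt_top hd (h.continuous_sq_re α)).ne
    exact ((h.regularZeros hα).zone_pos hd (h.continuous_sq_re α)
      (fun k i => by simp only [h.bands.periodic]) ((h.sq_re_eq_zero_iff α p).mpr hp)).ne'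
  have hnn : ∀ β ∈ Finset.univ.filter fun β : Fin N => β < Fin.rev β, 0 ≤ ringArea E β :=
    fun β _ => ENNReal.toReal_nonneg
  rcases lt_or_gt_of_ne hα with h1 | h1
  · refine lt_of_lt_of_le ?_ (Finset.single_le_sum hnn (Finset.mem_filter.mpr
      ⟨Finset.mem_univ (Fin.rev α), by rwa [Fin.rev_rev]⟩))
    rwa [h.ringArea_rev]
  · exact hpos.trans_le (Finset.single_le_sum hnn (Finset.mem_filter.mpr ⟨Finset.mem_univ α, h1⟩))

end IsGaplessBroken

theorem sum_pairs_le_sum {g : Fin N → ℝ} (hg : ∀ α, 0 ≤ g α) :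
    ∑ α with α < Fin.rev α, (g α + g (Fin.rev α)) ≤ ∑ α, g α := by
  rw [Finset.sum_add_distrib]
  have h1 : ∑ α with α < Fin.rev α, g (Fin.rev α) = ∑ α with Fin.rev α < α, g α := by
    refine Finset.sum_bij (fun α _ => Fin.rev α) ?_ ?_ ?_ ?_
    · intro α hα
      simp only [Finset.mem_filter, Finset.mem_univ, true_and, Fin.rev_rev] at hα ⊢
      exact hα
    · intro α _ β _ h; exact Fin.rev_injective h
    · intro β hβ
      refine ⟨Fin.rev β, ?_, Fin.rev_rev β⟩
      simp only [Finset.mem_filter, Finset.mem_univ, true_and, Fin.rev_rev] at hβ ⊢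
      exact hβ
    · intro α _; rfl
  rw [h1, ← Finset.sum_union]
  · exact Finset.sum_le_univ_sum_of_nonneg hg
  · rw [Finset.disjoint_filter]
    intro α _ h2 h3
    exact lt_asymm h2 h3

theorem card_pairs (N : ℕ) : (Finset.univ.filter fun α : Fin N => α < Fin.rev α).card = N / 2 := by
  have : (Finset.univ.filter fun α : Fin N => α < Fin.rev α) =
      Finset.univ.filter fun α : Fin N => (α : ℕ) < N / 2 := by
    ext α
    simp only [Finset.mem_filter, Finset.mem_univ, true_and, Fin.lt_def, Fin.val_rev]
    have := α.2
    omega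
  rw [this, Fin.card_filter_val_lt]
  omega

/-- Rescaling the argument changes the logarithm by a constant, which is eventually absorbed by `η
log L`. -/
theorem eventually_log_floor_ge {c η x : ℝ} (hc : 0 < c) (hη : 0 < η) (hx : 0 < x) :
    ∀ᶠ L : ℕ in atTop, 0 < ⌊x * L⌋₊ ∧ (1 - η) * Real.log L ≤ Real.log (c * (⌊x * L⌋₊ : ℝ)) := by
  have h1 : Tendsto (fun L : ℕ => x * (L : ℝ)) atTop atTop :=
    tendsto_natCast_atTop_atTop.const_mul_atTop hx
  have h2 : Tendsto (fun L : ℕ => η * Real.log (L : ℝ)) atTop atTop :=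
    (Real.tendsto_log_atTop.comp tendsto_natCast_atTop_atTop).const_mul_atTop hη
  filter_upwards [h1.eventually_ge_atTop 2, h2.eventually_ge_atTop (-Real.log (c * x / 2)),
    eventually_gt_atTop 0] with L h3 h4 h5
  have h6 : x * L / 2 ≤ (⌊x * L⌋₊ : ℝ) := by
    have := Nat.lt_floor_add_one (x * L)
    linarith
  have hL : (0 : ℝ) < L := by exact_mod_cast h5
  refine ⟨?_, ?_⟩
  · rw [Nat.floor_pos]; linarith
  · calc (1 - η) * Real.log L ≤ Real.log (c * x / 2) + Real.log L := by linarith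
      _ = Real.log (c * (x * L / 2)) := by
        rw [← Real.log_mul (by positivity) hL.ne']; congr 1; ring
      _ ≤ _ := Real.log_le_log (by positivity) (by gcongr)

theorem exists_eta {B A : ℝ} (h : B < 5 * A) :
    ∃ η : ℝ, 0 < η ∧ η ≤ 1 ∧ B < 5 * A * ((1 - η) ^ 2 * (1 + η)⁻¹) := by
  have hc : ContinuousAt (fun η : ℝ => 5 * A * ((1 - η) ^ 2 * (1 + η)⁻¹)) 0 := by
    refine continuousAt_const.mul (ContinuousAt.mul (by fun_prop) (ContinuousAt.inv₀ (by fun_prop)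
      (by simp)))
  have h1 : ∀ᶠ η in 𝓝 (0 : ℝ), B < 5 * A * ((1 - η) ^ 2 * (1 + η)⁻¹) :=
    hc.tendsto.eventually (lt_mem_nhds (by simpa using h))
  obtain ⟨η, h2, h3⟩ := ((h1.filter_mono nhdsWithin_le_nhds).and
    (Ioo_mem_nhdsGT (zero_lt_one' ℝ))).exists
  exact ⟨η, h3.1, h3.2.le, h2⟩

/-- The cut-off `M = ⌊ηL/d⌋` satisfies `d M ≤ η L` and is still proportional to `L`. The variance
factor `5/2` times the factor 2 from the boundary sums gives 5; the losses `(1-η)²/(1+η)` fit into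
the strict gap between `B` and the limiting constant. -/
theorem IsGaplessBroken.eventually_lt_limitEntropy (hd : 0 < d) (h : IsGaplessBroken H E) {B : ℝ}
    (hB : B < 5 * (fermiArea E / (2 * Real.pi) ^ (d + 1))) :
    ∀ᶠ L : ℕ in atTop, B * (L : ℝ) ^ (d - 1) * Real.log L < limitEntropy E L := by
  obtain ⟨η, hη0, hη1, hBη⟩ := exists_eta hB
  have hd' : (0 : ℝ) < d := by exact_mod_cast hd
  have hpi := Real.pi_pos
  have hpair : ∀ α : Fin N, α < Fin.rev α → ∃ c : ℝ, 0 < c ∧ ∀ M : ℕ, 0 < M →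
      2 * ((1 - η) * ringArea E α) / (2 * Real.pi) ^ (d + 1) * Real.log (c * M) ≤
        boundarySum (E α) M + boundarySum (E (Fin.rev α)) M := by
    intro α hα
    rw [h.ringArea_eq]
    exact boundarySum_pair_ge hd (h.regularZeros hα.ne') (h.continuous_sq_re α)
      (h.bands.continuous α) (h.bands.continuous _) (h.bands.periodic α) (h.bands.periodic _)
      (h.sq_re_pos_iff α) hη0 hη1
  choose! c hc0 hc using hpair
  have hev : ∀ᶠ L : ℕ in atTop, ∀ α : Fin N, α < Fin.rev α → 0 < ⌊η / d * L⌋₊ ∧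
      (1 - η) * Real.log L ≤ Real.log (c α * (⌊η / d * L⌋₊ : ℝ)) := by
    rw [eventually_all]
    intro α
    by_cases hα : α < Fin.rev α
    · filter_upwards [eventually_log_floor_ge (hc0 α hα) hη0 (div_pos hη0 hd')] with L hL _
      exact hL
    · exact Eventually.of_forall fun L h1 => absurd h1 hα
  filter_upwards [hev, eventually_gt_atTop 1] with L hL hL1
  have hL0 : (0 : ℝ) < L := by exact_mod_cast (zero_lt_one.trans hL1)
  have hlog : 0 < Real.log L := Real.log_pos (by exact_mod_cast hL1)
  set M := ⌊η / d * L⌋₊ with hM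
  have hMle : (M : ℝ) ≤ η / d * L := Nat.floor_le (by positivity)
  have hdM : (d : ℝ) * M ≤ η * L := by
    calc (d : ℝ) * M ≤ d * (η / d * L) := by gcongr
      _ = η * L := by field_simp
  have hML : M ≤ L := by
    have h1 : (1 : ℝ) ≤ d := by exact_mod_cast hd
    have : (M : ℝ) ≤ L := by nlinarith [(Nat.cast_nonneg M : (0 : ℝ) ≤ M)]
    exact_mod_cast this
  have h1 := limitEntropy_ge_boundarySum h.bands.continuous h.bands.periodic (h.volume_frontier hd)
    (zero_lt_one.trans hL1) hd hη0.le hdM hML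
  refine lt_of_lt_of_le ?_ h1
  have h2 : 2 * (1 - η) ^ 2 * (fermiArea E / (2 * Real.pi) ^ (d + 1)) * Real.log L ≤
      ∑ α, boundarySum (E α) M := by
    refine le_trans ?_ (sum_pairs_le_sum fun α => boundarySum_nonneg (E α) M)
    rw [fermiArea, Finset.sum_div, Finset.mul_sum, Finset.sum_mul]
    refine Finset.sum_le_sum fun α hα => ?_
    have hα' : α < Fin.rev α := (Finset.mem_filter.mp hα).2
    refine le_trans ?_ (hc α hα' M (hL α hα').1)
    have hr : 0 ≤ ringArea E α := ENNReal.toReal_nonneg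
    have hη2 : 0 ≤ 1 - η := by linarith
    calc 2 * (1 - η) ^ 2 * (ringArea E α / (2 * Real.pi) ^ (d + 1)) * Real.log L
        = 2 * ((1 - η) * ringArea E α) / (2 * Real.pi) ^ (d + 1) * ((1 - η) * Real.log L) := by ring
      _ ≤ _ := mul_le_mul_of_nonneg_left (hL α hα').2 (by positivity)
  calc B * (L : ℝ) ^ (d - 1) * Real.log L
      < 5 * (fermiArea E / (2 * Real.pi) ^ (d + 1)) * ((1 - η) ^ 2 * (1 + η)⁻¹) *
        (L : ℝ) ^ (d - 1) * Real.log L := by gcongr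
    _ = 5 / 2 * ((L : ℝ) ^ (d - 1) * (1 + η)⁻¹ * (2 * (1 - η) ^ 2 *
        (fermiArea E / (2 * Real.pi) ^ (d + 1)) * Real.log L)) := by ring
    _ ≤ _ := by gcongr

/-- The constant is `min(√d, 4)` times `A/(2π)^(d+1)`; the cap keeps this factor below the available
5 in every dimension. -/
theorem cMinus_lt {A : ℝ} (hA : 0 < A) : cMinus d A < 5 * (A / (2 * Real.pi) ^ (d + 1)) := by
  have hpi := Real.pi_pos
  have h4 : min (Real.sqrt d) 4 ≤ 4 := min_le_right _ _
  have e : cMinus d A = min (Real.sqrt d) 4 * (A / (2 * Real.pi) ^ (d + 1)) := by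
    rw [cMinus]; ring
  rw [e]
  refine mul_lt_mul_of_pos_right (by linarith) (by positivity)

theorem cMinus_pos (hd : 0 < d) {A : ℝ} (hA : 0 < A) : 0 < cMinus d A := by
  have hpi := Real.pi_pos
  have hd' : (0 : ℝ) < d := by exact_mod_cast hd
  have : 0 < min (Real.sqrt d) 4 := lt_min (Real.sqrt_pos.mpr hd') (by norm_num)
  rw [cMinus]
  positivity

theorem mul_cMinus_le {A : ℝ} (hA : ∀ α : Fin N, α < Fin.rev α → A ≤ ringArea E α) :
    ((N / 2 : ℕ) : ℝ) * cMinus d A ≤ cMinus d (fermiArea E) := by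
  have hpi := Real.pi_pos
  have h1 : ((N / 2 : ℕ) : ℝ) * A ≤ fermiArea E := by
    rw [← card_pairs N, ← nsmul_eq_mul, fermiArea]
    exact Finset.card_nsmul_le_sum _ _ _ fun α hα => hA α (Finset.mem_filter.mp hα).2
  have h2 : (0 : ℝ) ≤ min (Real.sqrt d) 4 := le_min (Real.sqrt_nonneg _) (by norm_num)
  calc ((N / 2 : ℕ) : ℝ) * cMinus d A = cMinus d (((N / 2 : ℕ) : ℝ) * A) := by
        rw [cMinus, cMinus]; ring
    _ ≤ _ := by
        rw [cMinus, cMinus]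
        gcongr

end Gapless

end FreeFermion

namespace FreeFermion

open Filter Topology MeasureTheory

/-! ## Yang-Lee zeros and the area law -/

section YangLee

variable {d N : ℕ} {H : LocalPTHamiltonian d N} {E : Fin N → Momentum d → ℂ}

theorem IsBandStructure.partitionFactor_eq (h : IsBandStructure H E) (β : ℝ) (k : Momentum d) :
    partitionFactor H β k = ∏ α, (1 + Complex.exp (-(β : ℂ) * E α k)) := by
  have h1 : (H.bloch k).charpoly.roots = Finset.univ.val.map fun α => E α k := by
    rw [h.charpoly_eq, ← Polynomial.roots_multiset_prod_X_sub_C (Finset.univ.val.map fun α => E α k),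
      Multiset.map_map]
    rfl
  rw [partitionFactor, h1, Multiset.map_map]
  rfl

theorem IsBandStructure.hasYangLeeZero (h : IsBandStructure H E) {β : ℝ} {α : Fin N}
    {k : Momentum d} (hk : 1 + Complex.exp (-(β : ℂ) * E α k) = 0) : HasYangLeeZero H β := by
  obtain ⟨m, hm⟩ := exists_lattice_mem_brillouinZone k
  refine ⟨_, hm, ?_⟩
  rw [h.partitionFactor_eq]
  refine Finset.prod_eq_zero (Finset.mem_univ α) ?_
  rw [periodic_lattice (h.periodic α)]
  exact hk

theorem IsGappedUnbroken.not_hasYangLeeZero (h : IsGappedUnbroken H E) (β : ℝ) :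
    ¬ HasYangLeeZero H β := by
  rintro ⟨k, -, hk⟩
  rw [h.bands.partitionFactor_eq, Finset.prod_eq_zero_iff] at hk
  obtain ⟨α, -, hα⟩ := hk
  have h1 : E α k = ((E α k).re : ℂ) := Complex.ext rfl (by simp [h.real α k])
  rw [h1] at hα
  have h2 : ((1 + Real.exp (-β * (E α k).re) : ℝ) : ℂ) = 0 := by
    push_cast
    exact hα
  have h3 := Complex.ofReal_eq_zero.mp h2
  have := Real.exp_pos (-β * (E α k).re)
  linarith

/-- The function `E²` is real and continuous, vanishes somewhere and is negative elsewhere. For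
large `β` it therefore takes the value `-(π/β)²`, where `E = ± iπ/β` and the Boltzmann factor is
`-1`. -/
theorem IsGaplessBroken.hasYangLeeZeroAtAbsoluteZero (h : IsGaplessBroken H E) :
    HasYangLeeZeroAtAbsoluteZero H := by
  obtain ⟨α, k, hk1, hk2⟩ := h.broken
  obtain ⟨p, hp⟩ := h.surrounded α ⟨k, hk1, hk2⟩
  have hpi := Real.pi_pos
  have hy : 0 < |(E α k).im| := abs_pos.mpr hk2
  rw [HasYangLeeZeroAtAbsoluteZero]
  filter_upwards [eventually_gt_atTop (Real.pi / |(E α k).im|), eventually_gt_atTop 0] with β hβ hβ0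
  have h1 : Real.pi / β ≤ |(E α k).im| := by
    rw [div_lt_iff₀ hy] at hβ
    rw [div_le_iff₀ hβ0]
    linarith
  have h2 : (E α k ^ 2).re ≤ -(Real.pi / β) ^ 2 := by
    rw [pow_two (E α k), Complex.mul_re, hk1]
    have : (Real.pi / β) ^ 2 ≤ (E α k).im ^ 2 := by
      rw [← sq_abs (E α k).im]
      exact pow_le_pow_left₀ (by positivity) h1 2
    nlinarith
  have h3 : -(Real.pi / β) ^ 2 ≤ (E α p ^ 2).re := by
    rw [hp]
    simp only [ne_eq, OfNat.ofNat_ne_zero, not_false_eq_true, zero_pow, Complex.zero_re]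
    have := sq_nonneg (Real.pi / β)
    linarith
  obtain ⟨q, hq⟩ := mem_range_of_exists_le_of_exists_ge (h.continuous_sq_re α) ⟨k, h2⟩ ⟨p, h3⟩
  have h4 : E α q ^ 2 = (Complex.I * (Real.pi / β : ℝ)) ^ 2 := by
    rw [mul_pow, Complex.I_sq]
    refine Complex.ext ?_ ?_
    · simp only [hq]
      rw [← Complex.ofReal_pow, neg_one_mul, Complex.neg_re, Complex.ofReal_re]
    · rw [h.real_or_imaginary, ← Complex.ofReal_pow, neg_one_mul, Complex.neg_im,
        Complex.ofReal_im, neg_zero]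
  have hβc : (β : ℂ) ≠ 0 := by exact_mod_cast hβ0.ne'
  refine h.bands.hasYangLeeZero (α := α) (k := q) ?_
  rcases sq_eq_sq_iff_eq_or_eq_neg.mp h4 with h5 | h5
  · have : -(β : ℂ) * E α q = -(Real.pi * Complex.I) := by
      rw [h5]; push_cast; field_simp
    rw [this, Complex.exp_neg, Complex.exp_pi_mul_I]; norm_num
  · have : -(β : ℂ) * E α q = Real.pi * Complex.I := by
      rw [h5]; push_cast; field_simp
    rw [this, Complex.exp_pi_mul_I]; norm_num

theorem IsGappedUnbroken.groundEntropy_eq_zero (h : IsGappedUnbroken H E) {Λ L : ℕ} (hΛ : 0 < Λ)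
    (hL : L ≤ Λ) : groundEntropy E Λ L = 0 :=
  FreeFermion.groundEntropy_eq_zero (fun α => h.sign_const α) hΛ hL

theorem IsGappedUnbroken.obeysAreaLaw (h : IsGappedUnbroken H E) : ObeysAreaLaw E := by
  refine ⟨0, fun L hL => ?_⟩
  filter_upwards [eventually_ge_atTop L] with Λ hΛ
  rw [h.groundEntropy_eq_zero (by omega) hΛ]
  simp

theorem IsGaplessBroken.tendsto_groundEntropy (hd : 0 < d) (h : IsGaplessBroken H E) (L : ℕ) :
    Tendsto (fun Λ => groundEntropy E Λ L) atTop (𝓝 (limitEntropy E L : ℂ)) :=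
  FreeFermion.tendsto_groundEntropy h.bands.continuous (h.volume_frontier hd) L

/-- An area law bound at fixed `L` survives the limit of large `Λ`, and the limit entropy exceeds it
once `c₋ log L ≥ C`. -/
theorem IsGaplessBroken.not_obeysAreaLaw (hd : 0 < d) (h : IsGaplessBroken H E) :
    ¬ ObeysAreaLaw E := by
  rintro ⟨C, hC⟩
  have hA := h.fermiArea_pos hd
  have hc := cMinus_pos hd hA
  have hlog : Tendsto (fun L : ℕ => cMinus d (fermiArea E) * Real.log (L : ℝ)) atTop atTop :=
    (Real.tendsto_log_atTop.comp tendsto_natCast_atTop_atTop).const_mul_atTop hc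
  obtain ⟨L, h1, h2, h3⟩ := ((h.eventually_lt_limitEntropy hd (cMinus_lt hA)).and
    ((hlog.eventually_ge_atTop C).and (eventually_ge_atTop 1))).exists
  have h4 : ‖(limitEntropy E L : ℂ)‖ ≤ C * (L : ℝ) ^ (d - 1) :=
    le_of_tendsto (h.tendsto_groundEntropy hd L).norm (hC L h3)
  rw [Complex.norm_real, Real.norm_eq_abs] at h4
  have h5 := (le_abs_self _).trans h4
  have h6 : (0 : ℝ) ≤ (L : ℝ) ^ (d - 1) := by positivity
  have h7 := mul_le_mul_of_nonneg_right h2 h6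
  nlinarith

theorem transitionPoints_congr {X : Type*} [TopologicalSpace X] {R Y Z : Set X}
    (h : R ∩ Y = R ∩ Z) : transitionPoints R Y = transitionPoints R Z := by
  rw [transitionPoints, transitionPoints, h, ← Set.sdiff_inter_self_eq_sdiff (s := R) (t := Y),
    Set.inter_comm Y R, h, Set.inter_comm R Z, Set.sdiff_inter_self_eq_sdiff]

theorem phaseSet_inter_zeroSet (hd : 0 < d) {X : Type*} (H : X → LocalPTHamiltonian d N)
    (E : X → Fin N → Momentum d → ℂ) :
    phaseSet H E ∩ zeroSet H = phaseSet H E ∩ violationSet E := by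
  ext s
  refine and_congr_right fun hs => ?_
  rcases hs with hs | hs
  · exact iff_of_true hs.hasYangLeeZeroAtAbsoluteZero (hs.not_obeysAreaLaw hd)
  · refine iff_of_false (fun h => ?_) (fun h => h hs.obeysAreaLaw)
    obtain ⟨β, hβ⟩ := Eventually.exists (h : ∀ᶠ β : ℝ in atTop, HasYangLeeZero (H s) β)
    exact hs.not_hasYangLeeZero β hβ

end YangLee

end FreeFermion

namespace FreeFermion

open Filter Topology MeasureTheory

/-! ## Eigenvalues and row sums of a matrix -/

section RowSums

variable {ι : Type*} [Fintype ι] [DecidableEq ι]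

/-- Expanding the product of the row sums gives one non-negative term for each self-map of the index
set; the permutations among them bound the Leibniz expansion. -/
theorem norm_det_le_prod_sum (M : Matrix ι ι ℂ) : ‖M.det‖ ≤ ∏ i, ∑ j, ‖M i j‖ := by
  rw [Finset.prod_univ_sum, ← Matrix.det_transpose, Matrix.det_apply]
  refine (norm_sum_le _ _).trans ?_
  have h1 : ∀ σ : Equiv.Perm ι, ‖Equiv.Perm.sign σ • ∏ i, M.transpose (σ i) i‖ =
      ∏ i, ‖M i (σ i)‖ := by
    intro σ
    rw [Units.smul_def, zsmul_eq_mul, norm_mul, norm_prod]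
    have : ‖((Equiv.Perm.sign σ : ℤ) : ℂ)‖ = 1 := by
      rcases Int.units_eq_one_or (Equiv.Perm.sign σ) with h | h <;> simp [h]
    rw [this, one_mul]
    rfl
  simp only [h1]
  refine (Finset.sum_map Finset.univ ⟨fun σ : Equiv.Perm ι => (σ : ι → ι), DFunLike.coe_injective⟩
    fun p => ∏ i, ‖M i (p i)‖).symm.trans_le ?_
  refine Finset.sum_le_sum_of_subset_of_nonneg (fun p _ => ?_) fun p _ _ =>
    Finset.prod_nonneg fun i _ => norm_nonneg _
  simp

theorem circleIntegrable_log_norm_multiset (s : Multiset ℂ) :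
    CircleIntegrable (fun z => Real.log ‖(s.map fun a => z + a).prod‖) 0 1 := by
  refine MeromorphicOn.circleIntegrable_log_norm (f := fun z => (s.map fun a => z + a).prod)
    fun z _ => ?_
  have : AnalyticAt ℂ (fun z : ℂ => (s.map fun a => z + a).prod) z := by
    induction s using Multiset.induction_on with
    | empty => simpa using analyticAt_const
    | cons a s ih =>
      simp only [Multiset.map_cons, Multiset.prod_cons]
      exact (analyticAt_id.add analyticAt_const).mul ih
  exact this.meromorphicAt

/-- Jensen's formula factor by factor: the mean of `log |z + a|` over the unit circle is `log⁺ |a|`.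
-/
theorem circleAverage_log_norm_multiset (s : Multiset ℂ) :
    Real.circleAverage (fun z => Real.log ‖(s.map fun a => z + a).prod‖) 0 1 =
      (s.map fun a => Real.posLog ‖a‖).sum := by
  classical
  induction s using Multiset.induction_on with
  | empty => simp [Real.circleAverage_const]
  | cons a s ih =>
    rw [Multiset.map_cons, Multiset.sum_cons, ← ih, ← circleAverage_log_norm_add_const_eq_posLog]
    have h1 := circleIntegrable_log_norm_multiset s
    have h2 : CircleIntegrable (fun z => Real.log ‖z + a‖) 0 1 := by
      simpa using circleIntegrable_log_norm_multiset {a}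
    rw [← Real.circleAverage_fun_add h2 h1]
    -- The finitely many roots are excluded, since the convention `log 0 = 0` breaks additivity of
    -- the logarithm there.
    refine Real.circleAverage_congr_codiscreteWithin ?_ one_ne_zero
    have hfin : (((a ::ₘ s).map fun b => -b).toFinset : Set ℂ).Finite := Finset.finite_toSet _
    filter_upwards [compl_finite_mem_codiscreteWithin hfin] with z hz
    have hz' : ∀ b ∈ a ::ₘ s, z + b ≠ 0 := by
      intro b hb h0
      refine hz ?_
      simp only [Finset.mem_coe, Multiset.mem_toFinset, Multiset.mem_map]
      exact ⟨b, hb, (eq_neg_of_add_eq_zero_left h0).symm⟩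
    rw [Multiset.map_cons, Multiset.prod_cons, norm_mul, Real.log_mul]
    · exact norm_ne_zero_iff.mpr (hz' a (Multiset.mem_cons_self a s))
    · rw [norm_ne_zero_iff]
      intro h0
      obtain ⟨b, hb, hb0⟩ := Multiset.mem_map.mp (Multiset.prod_eq_zero_iff.mp h0)
      exact hz' b (Multiset.mem_cons_of_mem hb) hb0

theorem det_scalar_sub (M : Matrix ι ι ℂ) (s : ℂ) :
    (s • (1 : Matrix ι ι ℂ) - M).det = (M.charpoly.roots.map fun z => s - z).prod := by
  have h1 : (s • (1 : Matrix ι ι ℂ) - M).det = M.charpoly.eval s := by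
    rw [Matrix.eval_charpoly, Matrix.scalar_apply, ← Matrix.smul_one_eq_diagonal]
  have h2 : M.charpoly = (M.charpoly.roots.map fun z => Polynomial.X - Polynomial.C z).prod :=
    (IsAlgClosed.splits M.charpoly).eq_prod_roots_of_monic M.charpoly_monic
  rw [h1, h2, Polynomial.eval_multiset_prod, Multiset.map_map, ← h2]
  simp

theorem det_scalar_add (M : Matrix ι ι ℂ) (s : ℂ) :
    (s • (1 : Matrix ι ι ℂ) + M).det = (M.charpoly.roots.map fun z => s + z).prod := by
  have h1 : s • (1 : Matrix ι ι ℂ) + M = -((-s) • (1 : Matrix ι ι ℂ) - M) := by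
    rw [neg_smul]; abel
  have h2 : M.charpoly.roots.card = Fintype.card ι := by
    rw [← (IsAlgClosed.splits M.charpoly).natDegree_eq_card_roots, M.charpoly_natDegree_eq_dim]
  rw [h1, Matrix.det_neg, det_scalar_sub, ← h2]
  have h3 : (fun z => s + z) = fun z : ℂ => (-1) * (-s - z) := by
    funext z; ring
  rw [h3, Multiset.prod_map_mul]
  simp

/-- A complex `s` with `r s² = z + r` factors the matrix as `r (s - M)(s + M)`, so its determinant
is read off from the eigenvalues of `M`; the matrix `M` need not be diagonalizable. -/
theorem det_add_one_sub_sq (M : Matrix ι ι ℂ) {r : ℝ} (hr : 0 < r) (z : ℂ) :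
    (z • (1 : Matrix ι ι ℂ) + (r : ℂ) • (1 - M * M)).det =
      ((M.charpoly.roots.map fun l => (r : ℂ) * (1 - l ^ 2)).map fun a => z + a).prod := by
  obtain ⟨s, hs⟩ := IsAlgClosed.exists_pow_nat_eq ((z + r) / r) two_pos
  have hr' : (r : ℂ) ≠ 0 := by exact_mod_cast hr.ne'
  have hs' : (r : ℂ) * s ^ 2 = z + r := by rw [hs]; field_simp
  have h1 : z • (1 : Matrix ι ι ℂ) + (r : ℂ) • (1 - M * M) =
      (r : ℂ) • ((s • (1 : Matrix ι ι ℂ) - M) * (s • (1 : Matrix ι ι ℂ) + M)) := by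
    have : (s • (1 : Matrix ι ι ℂ) - M) * (s • (1 : Matrix ι ι ℂ) + M) =
        (s ^ 2) • (1 : Matrix ι ι ℂ) - M * M := by
      simp only [sub_mul, mul_add, smul_mul_assoc, mul_smul_comm, one_mul, mul_one]
      rw [smul_sub, smul_smul, pow_two]
      abel
    rw [this, smul_sub, smul_sub, smul_smul, hs', add_smul]
    abel
  have h2 : M.charpoly.roots.card = Fintype.card ι := by
    rw [← (IsAlgClosed.splits M.charpoly).natDegree_eq_card_roots, M.charpoly_natDegree_eq_dim]
  rw [h1, Matrix.det_smul, Matrix.det_mul, det_scalar_sub, det_scalar_add, ← h2,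
    ← Multiset.prod_map_mul, Multiset.map_map]
  have h3 : ((fun a => z + a) ∘ fun l => (r : ℂ) * (1 - l ^ 2)) =
      fun l : ℂ => (r : ℂ) * ((s - l) * (s + l)) := by
    funext l
    simp only [Function.comp_apply]
    linear_combination -hs'
  rw [h3, Multiset.prod_map_mul]
  simp

/-- A form of Weyl's inequality: the eigenvalues of `1 - M²` are controlled by its row sums. -/
theorem sum_posLog_le (M : Matrix ι ι ℂ) {r : ℝ} (hr : 0 < r) :
    (M.charpoly.roots.map fun l => Real.posLog (r * ‖1 - l ^ 2‖)).sum ≤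
      ∑ i, Real.log (1 + r * ∑ j, ‖(1 - M * M) i j‖) := by
  -- The left side is the mean over `|z| = 1` of `log |det (z + r(1 - M²))|`, and the determinant is
  -- bounded at each `z` by the product of the row sums.
  have h1 := circleAverage_log_norm_multiset (M.charpoly.roots.map fun l => (r : ℂ) * (1 - l ^ 2))
  have h2 : ((M.charpoly.roots.map fun l => (r : ℂ) * (1 - l ^ 2)).map
      fun a => Real.posLog ‖a‖).sum =
      (M.charpoly.roots.map fun l => Real.posLog (r * ‖1 - l ^ 2‖)).sum := by
    rw [Multiset.map_map]
    congr 2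
    funext l
    simp [abs_of_pos hr]
  rw [← h2, ← h1]
  have hpos : ∀ i, 0 ≤ r * ∑ j, ‖(1 - M * M) i j‖ := fun i =>
    mul_nonneg hr.le (Finset.sum_nonneg fun j _ => norm_nonneg _)
  refine Real.circleAverage_mono_on_of_le_circle (circleIntegrable_log_norm_multiset _)
    fun z hz => ?_
  have hz1 : ‖z‖ = 1 := by simpa using hz
  rw [← det_add_one_sub_sq M hr]
  -- Where the determinant vanishes, `log 0 = 0` is still at most the non-negative right side.
  rcases eq_or_ne (z • (1 : Matrix ι ι ℂ) + (r : ℂ) • (1 - M * M)).det 0 with h0 | h0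
  · rw [h0, norm_zero, Real.log_zero]
    exact Finset.sum_nonneg fun i _ => Real.log_nonneg (by linarith [hpos i])
  · rw [← Real.log_prod fun i _ => by linarith [hpos i]]
    refine Real.log_le_log (norm_pos_iff.mpr h0) ((norm_det_le_prod_sum _).trans ?_)
    refine Finset.prod_le_prod (fun i _ => Finset.sum_nonneg fun j _ => norm_nonneg _) fun i _ => ?_
    calc ∑ j, ‖(z • (1 : Matrix ι ι ℂ) + (r : ℂ) • (1 - M * M)) i j‖
        ≤ ∑ j, (‖(z • (1 : Matrix ι ι ℂ)) i j‖ + r * ‖(1 - M * M) i j‖) := by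
          refine Finset.sum_le_sum fun j _ => ?_
          rw [Matrix.add_apply]
          refine (norm_add_le _ _).trans (le_of_eq ?_)
          congr 1
          rw [Matrix.smul_apply, norm_smul]
          simp [abs_of_pos hr]
      _ = 1 + r * ∑ j, ‖(1 - M * M) i j‖ := by
          rw [Finset.sum_add_distrib, ← Finset.mul_sum]
          congr 1
          rw [Finset.sum_eq_single i]
          · simp [hz1]
          · intro j _ hj; simp [Matrix.one_apply_ne hj.symm]
          · simp

end RowSums

end FreeFermion

namespace FreeFermion

open Filter Topology MeasureTheory

/-! ## Entropy and row sums -/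

section EntropyBound

theorem multiset_sum_map_finset_sum {α κ : Type*} (s : Multiset α) (F : Finset κ)
    (g : κ → α → ℝ) : (s.map fun t => ∑ k ∈ F, g k t).sum = ∑ k ∈ F, (s.map (g k)).sum := by
  induction s using Multiset.induction_on with
  | empty => simp
  | cons a s ih => simp [ih, Finset.sum_add_distrib]

/-- For the least `k` with `2^k t ≥ 2`, the logarithm is at least `log 2`; if `k > 0`, minimality
gives `2^k t ≤ 4`, so `√t` is at most `2 · 2^(-k/2)`. The case `k = 0` is covered by `√B`. A square
root is thus dominated by weighted `log⁺` terms, which the Weyl estimate controls. -/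
theorem exists_dyadic {B t : ℝ} (ht : 0 < t) (htB : t ≤ B) : ∃ k : ℕ,
    Real.sqrt t ≤ max 2 (Real.sqrt B) / Real.log 2 *
      ((Real.sqrt 2)⁻¹ ^ k * Real.posLog (2 ^ k * t)) := by
  have hlog2 : 0 < Real.log 2 := Real.log_pos one_lt_two
  have hex : ∃ k : ℕ, 2 ≤ 2 ^ k * t := by
    obtain ⟨k, hk⟩ := pow_unbounded_of_one_lt (2 / t) one_lt_two
    exact ⟨k, by rw [div_lt_iff₀ ht] at hk; exact hk.le⟩
  classical
  set k := Nat.find hex with hk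
  have h1 : 2 ≤ 2 ^ k * t := Nat.find_spec hex
  refine ⟨k, ?_⟩
  have h2 : Real.log 2 ≤ Real.posLog (2 ^ k * t) :=
    (Real.log_le_log two_pos h1).trans (le_max_right _ _)
  have h3 : Real.sqrt t ≤ max 2 (Real.sqrt B) * (Real.sqrt 2)⁻¹ ^ k := by
    rcases Nat.eq_zero_or_pos k with h0 | h0
    · rw [h0, pow_zero, mul_one]
      exact (Real.sqrt_le_sqrt htB).trans (le_max_right _ _)
    · have h4 : ¬ 2 ≤ 2 ^ (k - 1) * t := Nat.find_min hex (by omega)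
      have h5 : 2 ^ k * t ≤ 4 := by
        have : (2 : ℝ) ^ k = 2 * 2 ^ (k - 1) := by rw [← pow_succ', Nat.sub_add_cancel h0]
        rw [this]; linarith [not_le.mp h4]
      have h6 : Real.sqrt t * Real.sqrt 2 ^ k ≤ 2 := by
        refine (sq_le_sq₀ (by positivity) zero_le_two).mp ?_
        rw [mul_pow, Real.sq_sqrt ht.le, ← pow_mul, mul_comm k 2, pow_mul, Real.sq_sqrt zero_le_two]
        linarith
      have h7 : 0 < Real.sqrt 2 ^ k := by positivity
      rw [inv_pow, ← div_eq_mul_inv, le_div_iff₀ h7]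
      exact h6.trans (le_max_left _ _)
  calc Real.sqrt t ≤ max 2 (Real.sqrt B) * (Real.sqrt 2)⁻¹ ^ k := h3
    _ = max 2 (Real.sqrt B) / Real.log 2 * ((Real.sqrt 2)⁻¹ ^ k * Real.log 2) := by field_simp
    _ ≤ _ := by gcongr

theorem log_one_add_pow_four_le {x : ℝ} (hx : 0 ≤ x) : Real.log (1 + x ^ 4) ≤ 4 * x := by
  calc Real.log (1 + x ^ 4) ≤ Real.log ((1 + x) ^ 4) := by
        refine Real.log_le_log (by positivity) ?_
        nlinarith [mul_nonneg hx hx, mul_nonneg (mul_nonneg hx hx) hx]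
    _ = 4 * Real.log (1 + x) := by rw [Real.log_pow]; norm_num
    _ ≤ 4 * x := by
        have := Real.log_le_sub_one_of_pos (show 0 < 1 + x by linarith)
        linarith

/-- The hypothesis is used at `r = 2^m` with weight `2^(-m/2)`. Writing `w = 2^(1/4)`, the bound
`log(1 + x⁴) ≤ 4x` with `x = w^m s_i` gives growth only `w^m` against the weight `w^(-2m)`, and the
geometric series converges. This is why the row sums are measured by fourth powers. -/
theorem sum_sqrt_le (B : ℝ) : ∃ C : ℝ, 0 ≤ C ∧ ∀ (T : Multiset ℝ) {ι : Type} [Fintype ι]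
    (ρ s : ι → ℝ), (∀ t ∈ T, 0 ≤ t ∧ t ≤ B) → (∀ i, 0 ≤ s i) → (∀ i, 0 ≤ ρ i ∧ ρ i ≤ s i ^ 4) →
    (∀ r : ℝ, 0 < r → (T.map fun t => Real.posLog (r * t)).sum ≤ ∑ i, Real.log (1 + r * ρ i)) →
    (T.map Real.sqrt).sum ≤ C * ∑ i, s i := by
  obtain ⟨w, hw1, hw⟩ : ∃ w : ℝ, 1 < w ∧ w ^ 4 = 2 := by
    refine ⟨Real.sqrt (Real.sqrt 2), ?_, ?_⟩
    · rw [Real.lt_sqrt zero_le_one, one_pow, Real.lt_sqrt zero_le_one]; norm_num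
    · rw [show (4 : ℕ) = 2 * 2 from rfl, pow_mul, Real.sq_sqrt (Real.sqrt_nonneg 2),
        Real.sq_sqrt zero_le_two]
  have hw0 : 0 < w := zero_lt_one.trans hw1
  have hw2 : Real.sqrt 2 = w ^ 2 := by
    rw [← hw, show (4 : ℕ) = 2 * 2 from rfl, pow_mul, Real.sqrt_sq (by positivity)]
  have hq1 : w⁻¹ < 1 := inv_lt_one_of_one_lt₀ hw1
  have hlog2 : 0 < Real.log 2 := Real.log_pos one_lt_two
  set C₁ := max 2 (Real.sqrt B) / Real.log 2 with hC₁
  have hC₁0 : 0 ≤ C₁ := by positivity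
  refine ⟨C₁ * (4 * (1 - w⁻¹)⁻¹), mul_nonneg hC₁0 (mul_nonneg (by norm_num)
    (inv_nonneg.mpr (by linarith))), fun T ι _ ρ s hT hs hρ h => ?_⟩
  have hdy : ∀ t : ℝ, ∃ k : ℕ, 0 < t → t ≤ B →
      Real.sqrt t ≤ C₁ * ((Real.sqrt 2)⁻¹ ^ k * Real.posLog (2 ^ k * t)) := by
    intro t
    by_cases ht : 0 < t ∧ t ≤ B
    · obtain ⟨k, hk⟩ := exists_dyadic ht.1 ht.2
      exact ⟨k, fun _ _ => hk⟩
    · exact ⟨0, fun h1 h2 => absurd ⟨h1, h2⟩ ht⟩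
  choose k hk using hdy
  classical
  set K := T.toFinset.sup k + 1 with hK
  have hkK : ∀ t ∈ T, k t < K := fun t ht =>
    Nat.lt_succ_of_le (Finset.le_sup (f := k) (Multiset.mem_toFinset.mpr ht))
  have h1 : (T.map Real.sqrt).sum ≤ (T.map fun t => ∑ m ∈ Finset.range K,
      C₁ * ((Real.sqrt 2)⁻¹ ^ m * Real.posLog (2 ^ m * t))).sum := by
    refine Multiset.sum_map_le_sum_map _ _ fun t ht => ?_
    have hnn : ∀ m ∈ Finset.range K,
        0 ≤ C₁ * ((Real.sqrt 2)⁻¹ ^ m * Real.posLog (2 ^ m * t)) := fun m _ =>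
      mul_nonneg hC₁0 (mul_nonneg (by positivity) Real.posLog_nonneg)
    rcases (hT t ht).1.eq_or_lt with h0 | h0
    · rw [← h0, Real.sqrt_zero]
      rw [← h0] at hnn
      exact Finset.sum_nonneg hnn
    · exact (hk t h0 (hT t ht).2).trans
        (Finset.single_le_sum hnn (Finset.mem_range.mpr (hkK t ht)))
  rw [multiset_sum_map_finset_sum] at h1
  refine h1.trans ?_
  have hgeo : ∑ m ∈ Finset.range K, w⁻¹ ^ m ≤ (1 - w⁻¹)⁻¹ := by
    rw [← tsum_geometric_of_lt_one (by positivity) hq1]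
    exact (summable_geometric_of_lt_one (by positivity) hq1).sum_le_tsum _
      fun m _ => by positivity
  calc ∑ m ∈ Finset.range K, (T.map fun t =>
        C₁ * ((Real.sqrt 2)⁻¹ ^ m * Real.posLog (2 ^ m * t))).sum
      ≤ ∑ m ∈ Finset.range K, C₁ * (4 * w⁻¹ ^ m * ∑ i, s i) := by
        refine Finset.sum_le_sum fun m _ => ?_
        rw [Multiset.sum_map_mul_left, Multiset.sum_map_mul_left]
        refine mul_le_mul_of_nonneg_left ?_ hC₁0
        calc (Real.sqrt 2)⁻¹ ^ m * (T.map fun t => Real.posLog (2 ^ m * t)).sum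
            ≤ (Real.sqrt 2)⁻¹ ^ m * ∑ i, 4 * (w ^ m * s i) := by
              refine mul_le_mul_of_nonneg_left ((h _ (by positivity)).trans ?_) (by positivity)
              refine Finset.sum_le_sum fun i _ => ?_
              refine le_trans (Real.log_le_log ?_ ?_)
                (log_one_add_pow_four_le (mul_nonneg (by positivity) (hs i)))
              · have := mul_nonneg (show (0 : ℝ) ≤ 2 ^ m by positivity) (hρ i).1
                linarith
              · rw [mul_pow, ← pow_mul, mul_comm m 4, pow_mul, hw]
                have := mul_le_mul_of_nonneg_left (hρ i).2 (show (0 : ℝ) ≤ 2 ^ m by positivity)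
                linarith
          _ = 4 * w⁻¹ ^ m * ∑ i, s i := by
              rw [← Finset.mul_sum, ← Finset.mul_sum, hw2]
              have : (w ^ 2)⁻¹ ^ m * w ^ m = w⁻¹ ^ m := by
                rw [← mul_pow]; congr 1; field_simp
              rw [← this]; ring
    _ = C₁ * (4 * (∑ m ∈ Finset.range K, w⁻¹ ^ m) * ∑ i, s i) := by
        rw [← Finset.mul_sum, ← Finset.sum_mul, ← Finset.mul_sum]
    _ ≤ C₁ * (4 * (1 - w⁻¹)⁻¹ * ∑ i, s i) := by
        have := Finset.sum_nonneg fun i (_ : i ∈ Finset.univ) => hs i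
        gcongr
    _ = _ := by ring

theorem norm_mul_log_le {B : ℝ} (hB : 1 ≤ B) {u : ℂ} (hu : ‖u‖ ≤ B) :
    ‖u * Complex.log u‖ ≤ (2 + Real.pi + B) * B * Real.sqrt ‖u‖ := by
  rcases eq_or_ne u 0 with rfl | h0
  · simp
  have hpi := Real.pi_pos
  have hpos : 0 < ‖u‖ := norm_pos_iff.mpr h0
  set x := ‖u‖ with hx
  have h1 : ‖Complex.log u‖ ≤ |Real.log x| + Real.pi := by
    refine (Complex.norm_le_abs_re_add_abs_im _).trans ?_
    rw [Complex.log_re, Complex.log_im]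
    exact add_le_add le_rfl (Complex.abs_arg_le_pi u)
  have hs : Real.sqrt x * Real.sqrt x = x := Real.mul_self_sqrt hpos.le
  have hsB : Real.sqrt x ≤ B := by
    rw [Real.sqrt_le_left (by linarith)]
    nlinarith
  have h2 : Real.sqrt x * |Real.log x| ≤ (2 + B) * B := by
    rcases le_total x 1 with hx1 | hx1
    · have h3 := Real.abs_log_mul_self_rpow_lt x (1 / 2) hpos hx1 (by norm_num)
      rw [← Real.sqrt_eq_rpow, abs_mul, abs_of_nonneg (Real.sqrt_nonneg x)] at h3
      nlinarith
    · rw [abs_of_nonneg (Real.log_nonneg hx1)]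
      have h3 := Real.log_le_sub_one_of_pos hpos
      have h4 : Real.log x ≤ B := by linarith
      have h5 := Real.log_nonneg hx1
      nlinarith [Real.sqrt_nonneg x]
  rw [norm_mul]
  calc x * ‖Complex.log u‖ ≤ x * (|Real.log x| + Real.pi) := by gcongr
    _ = Real.sqrt x * Real.sqrt x * (|Real.log x| + Real.pi) := by rw [hs]
    _ = (Real.sqrt x * |Real.log x| + Real.sqrt x * Real.pi) * Real.sqrt x := by ring
    _ ≤ ((2 + B) * B + B * Real.pi) * Real.sqrt x := by gcongr
    _ = _ := by ring

/-- The function `u log u` vanishes linearly at `u = 1`; away from this point `√|1 - u|` is bounded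
below, and `norm_mul_log_le` suffices. -/
theorem norm_mul_log_le' {B : ℝ} (hB : 1 ≤ B) {u : ℂ} (hu : ‖u‖ ≤ B) :
    ‖u * Complex.log u‖ ≤ 2 * ((2 + Real.pi + B) * B * B) * Real.sqrt ‖1 - u‖ := by
  have hpi := Real.pi_pos
  rcases le_or_gt ‖1 - u‖ (1 / 2) with h | h
  · have h1 : ‖Complex.log u‖ ≤ 3 / 2 * ‖1 - u‖ := by
      have := Complex.norm_log_one_add_half_le_self (z := u - 1) (by rwa [norm_sub_rev])
      rwa [norm_sub_rev, add_sub_cancel] at this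
    have h2 : ‖1 - u‖ ≤ Real.sqrt ‖1 - u‖ := by
      refine Real.le_sqrt_of_sq_le ?_
      nlinarith [norm_nonneg (1 - u)]
    rw [norm_mul]
    calc ‖u‖ * ‖Complex.log u‖ ≤ B * (3 / 2 * Real.sqrt ‖1 - u‖) := by gcongr; linarith
      _ ≤ _ := by
        rw [← mul_assoc]
        refine mul_le_mul_of_nonneg_right ?_ (Real.sqrt_nonneg _)
        have h3 : B ≤ B * B := by nlinarith
        have h4 : 3 * (B * B) ≤ (2 + Real.pi + B) * (B * B) := by gcongr; linarith
        rw [mul_assoc (2 + Real.pi + B)]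
        linarith
  · have h1 : (1 : ℝ) / 2 ≤ Real.sqrt ‖1 - u‖ := by
      refine Real.le_sqrt_of_sq_le ?_
      linarith
    have h2 : Real.sqrt ‖u‖ ≤ B := by
      rw [Real.sqrt_le_left (by linarith)]
      nlinarith
    calc ‖u * Complex.log u‖ ≤ (2 + Real.pi + B) * B * Real.sqrt ‖u‖ := norm_mul_log_le hB hu
      _ ≤ (2 + Real.pi + B) * B * B := by gcongr
      _ ≤ _ := by
        have : 0 ≤ (2 + Real.pi + B) * B * B := by positivity
        nlinarith

/-- For `u = (1 ± x)/2` one has `u(1 - u) = (1 - x²)/4`. At least one of `|u|`, `|1 - u|` is at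
least `1/2`, so the bounds of `u log u` near 0 and near 1 combine to `√|u(1 - u)|`. -/
theorem exists_norm_entropyFunction_le (B : ℝ) : ∃ C : ℝ, 0 ≤ C ∧ ∀ x : ℂ, ‖x‖ ≤ B →
    ‖entropyFunction x‖ ≤ C * Real.sqrt ‖1 - x ^ 2‖ := by
  have hpi := Real.pi_pos
  set B' := 1 + |B| with hB'
  have hB1 : 1 ≤ B' := by have := abs_nonneg B; linarith
  set K := 2 * ((2 + Real.pi + B') * B' * B') with hK
  have hK0 : 0 ≤ K := by positivity
  have hKle : (2 + Real.pi + B') * B' ≤ K := by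
    have : 0 ≤ (2 + Real.pi + B') * B' := by positivity
    rw [hK]; nlinarith
  have key : ∀ u : ℂ, ‖u‖ ≤ B' → ‖u * Complex.log u‖ ≤ K * (2 * Real.sqrt ‖u * (1 - u)‖) := by
    intro u hu
    have h1 : ‖u * Complex.log u‖ ≤ K * Real.sqrt ‖u‖ :=
      (norm_mul_log_le hB1 hu).trans (mul_le_mul_of_nonneg_right hKle (Real.sqrt_nonneg _))
    have h2 := norm_mul_log_le' hB1 hu
    rw [norm_mul u (1 - u), Real.sqrt_mul (norm_nonneg u)]
    have h3 : 1 ≤ ‖u‖ + ‖1 - u‖ := by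
      have := norm_add_le u (1 - u)
      rwa [add_sub_cancel, norm_one] at this
    rcases le_total (1 / 2) ‖u‖ with h | h
    · have h4 : (1 : ℝ) / 2 ≤ Real.sqrt ‖u‖ := Real.le_sqrt_of_sq_le (by linarith)
      refine h2.trans (mul_le_mul_of_nonneg_left ?_ hK0)
      nlinarith [Real.sqrt_nonneg ‖1 - u‖]
    · have h4 : (1 : ℝ) / 2 ≤ Real.sqrt ‖1 - u‖ := Real.le_sqrt_of_sq_le (by linarith)
      refine h1.trans (mul_le_mul_of_nonneg_left ?_ hK0)
      nlinarith [Real.sqrt_nonneg ‖u‖]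
  refine ⟨2 * K, by positivity, fun x hx => ?_⟩
  have hxB : ‖x‖ ≤ |B| := hx.trans (le_abs_self B)
  have hu : ‖(1 + x) / 2‖ ≤ B' := by
    rw [norm_div]
    have := norm_add_le 1 x
    rw [norm_one] at this
    simp only [RCLike.norm_ofNat]
    have := abs_nonneg B
    linarith
  have hv : ‖(1 - x) / 2‖ ≤ B' := by
    rw [norm_div]
    have := norm_sub_le 1 x
    rw [norm_one] at this
    simp only [RCLike.norm_ofNat]
    have := abs_nonneg B
    linarith
  have e1 : Real.sqrt ‖(1 + x) / 2 * (1 - (1 + x) / 2)‖ = Real.sqrt ‖1 - x ^ 2‖ / 2 := by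
    rw [show (1 + x) / 2 * (1 - (1 + x) / 2) = (1 - x ^ 2) / 2 ^ 2 by ring, norm_div,
      Real.sqrt_div (norm_nonneg _), norm_pow, Real.sqrt_sq (norm_nonneg _)]
    simp
  have e2 : Real.sqrt ‖(1 - x) / 2 * (1 - (1 - x) / 2)‖ = Real.sqrt ‖1 - x ^ 2‖ / 2 := by
    rw [show (1 - x) / 2 * (1 - (1 - x) / 2) = (1 - x ^ 2) / 2 ^ 2 by ring, norm_div,
      Real.sqrt_div (norm_nonneg _), norm_pow, Real.sqrt_sq (norm_nonneg _)]
    simp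
  have k1 := key _ hu
  have k2 := key _ hv
  rw [e1] at k1
  rw [e2] at k2
  rw [entropyFunction, neg_mul]
  refine (norm_sub_le _ _).trans ?_
  rw [norm_neg]
  linarith

theorem norm_le_of_mem_roots_charpoly {ι : Type*} [Fintype ι] [DecidableEq ι] {M : Matrix ι ι ℂ}
    {B : ℝ} (hM : ∀ i, ∑ j, ‖M i j‖ ≤ B) {z : ℂ} (hz : z ∈ M.charpoly.roots) :
    ‖z‖ ≤ B := by
  have h1 : Module.End.HasEigenvalue (Matrix.toLin' M) z := by
    rw [Module.End.hasEigenvalue_iff_isRoot_charpoly, Matrix.charpoly_toLin']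
    exact (Polynomial.mem_roots'.mp hz).2
  obtain ⟨k, hk⟩ := eigenvalue_mem_ball h1
  rw [mem_closedBall_iff_norm] at hk
  have h2 : ‖z‖ ≤ ‖z - M k k‖ + ‖M k k‖ := by
    have := norm_add_le (z - M k k) (M k k)
    rwa [sub_add_cancel] at this
  have h3 := Finset.sum_erase_add Finset.univ (fun j => ‖M k j‖) (Finset.mem_univ k)
  have := hM k
  linarith

/-- The entropy is bounded by row sums which measure how far the matrix is from an involution. -/
theorem exists_norm_sum_entropyFunction_le {B : ℝ} : ∃ C : ℝ, 0 ≤ C ∧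
    ∀ {ι : Type} [Fintype ι] [DecidableEq ι] (M : Matrix ι ι ℂ) (s : ι → ℝ),
    (∀ i, ∑ j, ‖M i j‖ ≤ B) → (∀ i, 0 ≤ s i) → (∀ i, ∑ j, ‖(1 - M * M) i j‖ ≤ s i ^ 4) →
    ‖(M.charpoly.roots.map entropyFunction).sum‖ ≤ C * ∑ i, s i := by
  obtain ⟨C₁, hC₁, h1⟩ := exists_norm_entropyFunction_le B
  obtain ⟨C₂, hC₂, h2⟩ := sum_sqrt_le (1 + B ^ 2)
  refine ⟨C₁ * C₂, by positivity, fun {ι} _ _ M s hM hs hρ => ?_⟩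
  have hroot : ∀ z ∈ M.charpoly.roots, ‖z‖ ≤ B := fun z hz =>
    norm_le_of_mem_roots_charpoly hM hz
  have h3 := h2 (M.charpoly.roots.map fun z => ‖1 - z ^ 2‖) (fun i => ∑ j, ‖(1 - M * M) i j‖) s
    ?_ hs (fun i => ⟨Finset.sum_nonneg fun j _ => norm_nonneg _, hρ i⟩) ?_
  · rw [Multiset.map_map] at h3
    calc ‖(M.charpoly.roots.map entropyFunction).sum‖
        ≤ ((M.charpoly.roots.map entropyFunction).map fun z => ‖z‖).sum :=
          norm_multiset_sum_le _
      _ ≤ (M.charpoly.roots.map fun z => C₁ * Real.sqrt ‖1 - z ^ 2‖).sum := by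
          rw [Multiset.map_map]
          exact Multiset.sum_map_le_sum_map _ _ fun z hz => h1 z (hroot z hz)
      _ = C₁ * (M.charpoly.roots.map fun z => Real.sqrt ‖1 - z ^ 2‖).sum :=
          Multiset.sum_map_mul_left
      _ ≤ C₁ * (C₂ * ∑ i, s i) := mul_le_mul_of_nonneg_left h3 hC₁
      _ = _ := by ring
  · intro t ht
    obtain ⟨z, hz, rfl⟩ := Multiset.mem_map.mp ht
    refine ⟨norm_nonneg _, (norm_sub_le _ _).trans ?_⟩
    rw [norm_one, norm_pow]
    have := pow_le_pow_left₀ (norm_nonneg z) (hroot z hz) 2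
    linarith
  · intro r hr
    rw [Multiset.map_map]
    exact sum_posLog_le M hr

end EntropyBound

end FreeFermion

namespace FreeFermion

open Filter Topology MeasureTheory
open scoped ENNReal NNReal

/-! ## The inverse square root of `1 - x` in a Banach algebra -/

section InvSqrt

/-- The Taylor coefficients of `(1 - x)^{-1/2}`. -/
noncomputable def invSqrtCoeff : ℕ → ℝ
  | 0 => 1
  | n + 1 => invSqrtCoeff n * ((2 * n + 1) / (2 * n + 2))

theorem invSqrtCoeff_pos (n : ℕ) : 0 < invSqrtCoeff n := by
  induction n with
  | zero => exact one_pos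
  | succ n ih => rw [invSqrtCoeff]; positivity

theorem invSqrtCoeff_le_one (n : ℕ) : invSqrtCoeff n ≤ 1 := by
  induction n with
  | zero => exact le_rfl
  | succ n ih =>
    rw [invSqrtCoeff]
    refine mul_le_one₀ ih (by positivity) ?_
    rw [div_le_one (by positivity)]
    linarith

/-- The square of `(1-x)^(-1/2)` is the geometric series. The recursion reads `(p+1) a_{p+1} = (p +
1/2) a_p`; by symmetry twice the sum weighted with `p` is `n` times the plain sum, so the Cauchy
squares satisfy `(n+1) c_{n+1} = (n+1) c_n`. -/
theorem sum_invSqrtCoeff (n : ℕ) :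
    ∑ p ∈ Finset.HasAntidiagonal.antidiagonal n, invSqrtCoeff p.1 * invSqrtCoeff p.2 = 1 := by
  have hsymm : ∀ n : ℕ, 2 * ∑ p ∈ Finset.HasAntidiagonal.antidiagonal n, (p.1 : ℝ) * (invSqrtCoeff p.1 *
      invSqrtCoeff p.2) = n * ∑ p ∈ Finset.HasAntidiagonal.antidiagonal n, invSqrtCoeff p.1 * invSqrtCoeff p.2 := by
    intro n
    have h1 : ∑ p ∈ Finset.HasAntidiagonal.antidiagonal n, (p.1 : ℝ) * (invSqrtCoeff p.1 * invSqrtCoeff p.2) =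
        ∑ p ∈ Finset.HasAntidiagonal.antidiagonal n, (p.2 : ℝ) * (invSqrtCoeff p.1 * invSqrtCoeff p.2) := by
      rw [← Finset.Nat.sum_antidiagonal_swap]
      refine Finset.sum_congr rfl fun p _ => ?_
      simp only [Prod.fst_swap, Prod.snd_swap]
      ring
    rw [two_mul]
    nth_rewrite 2 [h1]
    rw [← Finset.sum_add_distrib, Finset.mul_sum]
    refine Finset.sum_congr rfl fun p hp => ?_
    rw [← Finset.HasAntidiagonal.mem_antidiagonal.mp hp]
    push_cast
    ring
  induction n with
  | zero => simp [invSqrtCoeff]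
  | succ n ih =>
    have h1 := hsymm (n + 1)
    have h2 := hsymm n
    rw [ih, mul_one] at h2
    rw [Finset.Nat.sum_antidiagonal_succ (f := fun p => (p.1 : ℝ) * (invSqrtCoeff p.1 *
      invSqrtCoeff p.2))] at h1
    simp only [Nat.cast_zero, zero_mul, zero_add] at h1
    have h3 : ∀ p ∈ Finset.HasAntidiagonal.antidiagonal n, ((p.1 + 1 : ℕ) : ℝ) * (invSqrtCoeff (p.1 + 1) *
        invSqrtCoeff p.2) = p.1 * (invSqrtCoeff p.1 * invSqrtCoeff p.2) +
          1 / 2 * (invSqrtCoeff p.1 * invSqrtCoeff p.2) := by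
      intro p _
      rw [invSqrtCoeff]
      push_cast
      field_simp
    rw [Finset.sum_congr rfl h3, Finset.sum_add_distrib, ← Finset.mul_sum, ih] at h1
    have h4 : ((n + 1 : ℕ) : ℝ) ≠ 0 := by positivity
    refine mul_left_cancel₀ h4 ?_
    rw [← h1]
    push_cast
    linarith

variable {R : Type*} [NormedRing R] [NormedAlgebra ℝ R] [CompleteSpace R]

/-- The power series of `(1 - x)^{-1/2}`. -/
noncomputable def invSqrtSeries (x : R) : R := ∑' n, invSqrtCoeff n • x ^ n

theorem summable_invSqrtSeries {x : R} (hx : Summable fun n => ‖x ^ n‖) :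
    Summable fun n => ‖invSqrtCoeff n • x ^ n‖ := by
  refine hx.of_nonneg_of_le (fun n => norm_nonneg _) fun n => ?_
  rw [norm_smul, Real.norm_eq_abs, abs_of_pos (invSqrtCoeff_pos n)]
  exact mul_le_of_le_one_left (norm_nonneg _) (invSqrtCoeff_le_one n)

theorem hasSum_invSqrtSeries {x : R} (hx : Summable fun n => ‖x ^ n‖) :
    HasSum (fun n => invSqrtCoeff n • x ^ n) (invSqrtSeries x) :=
  (summable_invSqrtSeries hx).of_norm.hasSum

theorem invSqrtSeries_mul_self {x : R} (hx : Summable fun n => ‖x ^ n‖) :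
    invSqrtSeries x * invSqrtSeries x * (1 - x) = 1 := by
  have hs := hx.of_norm
  have h1 : invSqrtSeries x * invSqrtSeries x = ∑' n, x ^ n := by
    rw [invSqrtSeries, tsum_mul_tsum_eq_tsum_sum_antidiagonal_of_summable_norm
      (summable_invSqrtSeries hx) (summable_invSqrtSeries hx)]
    refine tsum_congr fun n => ?_
    have h2 : ∀ p ∈ Finset.HasAntidiagonal.antidiagonal n, (invSqrtCoeff p.1 • x ^ p.1) *
        (invSqrtCoeff p.2 • x ^ p.2) = (invSqrtCoeff p.1 * invSqrtCoeff p.2) • x ^ n := by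
      intro p hp
      rw [smul_mul_smul_comm, ← pow_add, Finset.HasAntidiagonal.mem_antidiagonal.mp hp]
    rw [Finset.sum_congr rfl h2, ← Finset.sum_smul, sum_invSqrtCoeff, one_smul]
  rw [h1, mul_sub, mul_one, ← hs.tsum_mul_right]
  simp only [← pow_succ]
  rw [hs.tsum_eq_zero_add, pow_zero, add_sub_cancel_right]

theorem commute_invSqrtSeries {x y : R} (hx : Summable fun n => ‖x ^ n‖) (h : Commute y x) :
    Commute y (invSqrtSeries x) := by
  have h1 := (hasSum_invSqrtSeries hx).mul_left y
  have h2 := (hasSum_invSqrtSeries hx).mul_right y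
  refine h1.unique (h2.congr_fun fun n => ?_)
  rw [mul_smul_comm, smul_mul_assoc, (h.pow_right n).eq]

theorem norm_invSqrtSeries_sub_le {x : R} {C θ : ℝ} (hθ0 : 0 ≤ θ) (hθ : θ < 1)
    (hx : ∀ n, ‖x ^ n‖ ≤ C * θ ^ n) (n : ℕ) :
    ‖invSqrtSeries x - ∑ j ∈ Finset.range n, invSqrtCoeff j • x ^ j‖ ≤ C * (1 - θ)⁻¹ * θ ^ n := by
  have hgeo := (summable_geometric_of_lt_one hθ0 hθ)
  have hs : Summable fun n => ‖x ^ n‖ :=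
    (hgeo.mul_left C).of_nonneg_of_le (fun n => norm_nonneg _) hx
  have h1 := (summable_invSqrtSeries hs).of_norm.sum_add_tsum_nat_add n
  rw [invSqrtSeries, ← h1, add_sub_cancel_left]
  have h2 : HasSum (fun j => C * θ ^ n * θ ^ j) (C * θ ^ n * (1 - θ)⁻¹) :=
    (hasSum_geometric_of_lt_one hθ0 hθ).mul_left _
  refine (tsum_of_norm_bounded h2 fun j => ?_).trans (le_of_eq (by ring))
  rw [norm_smul, Real.norm_eq_abs, abs_of_pos (invSqrtCoeff_pos _)]
  refine (mul_le_of_le_one_left (norm_nonneg _) (invSqrtCoeff_le_one _)).trans ((hx _).trans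
    (le_of_eq ?_))
  rw [pow_add]; ring

end InvSqrt

/-! ### Uniform exponential decay of powers. -/

section UniformPowers

/-- Powers which tend to zero pointwise on a compact set decay uniformly. -/
theorem exists_norm_pow_le {α R : Type*} [TopologicalSpace α] [NormedRing R] {K : Set α}
    (hK : IsCompact K) {w : α → R} (hw : Continuous w)
    (h0 : ∀ k ∈ K, Tendsto (fun n => w k ^ n) atTop (𝓝 0)) :
    ∃ C θ : ℝ, 0 ≤ C ∧ 0 < θ ∧ θ < 1 ∧ ∀ k ∈ K, ∀ n, ‖w k ^ n‖ ≤ C * θ ^ n := by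
  have h1 : ∀ k ∈ K, ∃ m : ℕ, 0 < m ∧ ‖w k ^ m‖ < 1 / 2 := by
    intro k hk
    have h2 : Tendsto (fun n => ‖w k ^ n‖) atTop (𝓝 0) := by simpa using (h0 k hk).norm
    obtain ⟨m, h3, h4⟩ := ((h2.eventually (gt_mem_nhds (show (0 : ℝ) < 1 / 2 by norm_num))).and
      (eventually_gt_atTop 0)).exists
    exact ⟨m, h4, h3⟩
  choose! m hm0 hm using h1
  obtain ⟨t, ht, hcov⟩ := hK.elim_nhds_subcover (fun k => {q | ‖w q ^ m k‖ < 1 / 2}) fun k hk =>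
    (isOpen_lt ((hw.pow _).norm) continuous_const).mem_nhds (hm k hk)
  set M := t.sup m + 1 with hM
  obtain ⟨B, hB⟩ := hK.exists_bound_of_continuousOn (f := w) hw.continuousOn
  set B' := max 1 B with hB'
  have hB1 : 1 ≤ B' := le_max_left _ _
  set D := (1 + ‖(1 : R)‖) * B' ^ M with hD
  have hD0 : 0 ≤ D := by positivity
  -- Compactness bounds the exponents `m` at which a power has norm below `1/2` by `M`. With `θ^M ≥
  -- 1/2` each such block contributes at most `θ^m`, and blocks are split off by strong induction.
  obtain ⟨θ, hθ0, hθ1, hθ⟩ : ∃ θ : ℝ, 0 < θ ∧ θ < 1 ∧ 1 / 2 ≤ θ ^ M := by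
    have hc : Tendsto (fun x : ℝ => x ^ M) (𝓝 1) (𝓝 1) := by
      simpa using (continuous_pow M).tendsto (1 : ℝ)
    have e1 : ∀ᶠ x in 𝓝[<] (1 : ℝ), 1 / 2 < x ^ M :=
      (hc.eventually (lt_mem_nhds (by norm_num))).filter_mono nhdsWithin_le_nhds
    obtain ⟨θ, h2, h3⟩ := (e1.and (Ioo_mem_nhdsLT (zero_lt_one' ℝ))).exists
    exact ⟨θ, h3.1, h3.2, h2.le⟩
  have hpow : ∀ k ∈ K, ∀ n, n ≤ M → ‖w k ^ n‖ ≤ D := by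
    intro k hk n hn
    rcases Nat.eq_zero_or_pos n with rfl | hn0
    · rw [pow_zero, hD]
      have : 1 ≤ B' ^ M := one_le_pow₀ hB1
      nlinarith [norm_nonneg (1 : R)]
    · calc ‖w k ^ n‖ ≤ ‖w k‖ ^ n := norm_pow_le' _ hn0
        _ ≤ B' ^ n := pow_le_pow_left₀ (norm_nonneg _) ((hB k hk).trans (le_max_right _ _)) n
        _ ≤ B' ^ M := pow_le_pow_right₀ hB1 hn
        _ ≤ D := by
          rw [hD]
          have : 0 ≤ B' ^ M := by positivity
          nlinarith [norm_nonneg (1 : R)]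
  refine ⟨D * (θ ^ M)⁻¹, θ, by positivity, hθ0, hθ1, fun k hk n => ?_⟩
  have hkt := hcov hk
  simp only [Set.mem_iUnion] at hkt
  obtain ⟨q, hq, hkq⟩ := hkt
  have hmq : m q ≤ M := (Finset.le_sup (f := m) hq).trans (Nat.le_succ _)
  have hmq0 := hm0 q (ht q hq)
  induction n using Nat.strong_induction_on with
  | _ n ih =>
    rcases le_total n (m q) with h2 | h2
    · refine (hpow k hk n (h2.trans hmq)).trans ?_
      rw [mul_assoc]
      refine le_mul_of_one_le_right hD0 ?_
      rw [inv_mul_eq_div, one_le_div (by positivity)]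
      exact pow_le_pow_of_le_one hθ0.le hθ1.le (h2.trans hmq)
    · have h3 := ih (n - m q) (by omega)
      calc ‖w k ^ n‖ = ‖w k ^ m q * w k ^ (n - m q)‖ := by
            rw [← pow_add, Nat.add_sub_cancel' h2]
        _ ≤ ‖w k ^ m q‖ * ‖w k ^ (n - m q)‖ := norm_mul_le _ _
        _ ≤ θ ^ m q * (D * (θ ^ M)⁻¹ * θ ^ (n - m q)) := by
            have h4 : ‖w k ^ m q‖ ≤ θ ^ m q :=
              le_trans (le_of_lt hkq) (hθ.trans (pow_le_pow_of_le_one hθ0.le hθ1.le hmq))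
            gcongr
        _ = D * (θ ^ M)⁻¹ * θ ^ n := by
            rw [← Nat.add_sub_cancel' h2, pow_add]
            simp only [Nat.add_sub_cancel_left]
            ring

/-- The spectral radius is attained on the spectrum, hence less than 1, and Gelfand's formula gives
geometric decay. The trivial algebra, which occurs for `N = 0`, is separate. -/
theorem tendsto_pow_of_spectrum {A : Type*} [NormedRing A] [NormedAlgebra ℂ A] [CompleteSpace A]
    {a : A} (h : ∀ z ∈ spectrum ℂ a, ‖z‖ < 1) : Tendsto (fun n => a ^ n) atTop (𝓝 0) := by
  rcases subsingleton_or_nontrivial A with hA | hA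
  · exact tendsto_const_nhds.congr fun n => Subsingleton.elim _ _
  have h1 : spectralRadius ℂ a < 1 := by
    obtain ⟨z, hz, hz2⟩ := spectrum.exists_nnnorm_eq_spectralRadius a
    rw [← hz2]
    exact_mod_cast h z hz
  obtain ⟨r, hr1, hr2⟩ := exists_between h1
  lift r to ℝ≥0 using (hr2.trans ENNReal.one_lt_top).ne
  have h2 := (spectrum.pow_nnnorm_pow_one_div_tendsto_nhds_spectralRadius a).eventually
    (gt_mem_nhds hr1)
  have hr3 : r < 1 := by exact_mod_cast hr2
  rw [tendsto_zero_iff_norm_tendsto_zero]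
  have h3 : Tendsto (fun n : ℕ => (r : ℝ) ^ n) atTop (𝓝 0) :=
    tendsto_pow_atTop_nhds_zero_of_lt_one r.2 hr3
  refine squeeze_zero' (Eventually.of_forall fun n => norm_nonneg _) ?_ h3
  filter_upwards [h2, eventually_gt_atTop 0] with n hn hn0
  have hn' : (n : ℝ) ≠ 0 := by exact_mod_cast hn0.ne'
  have h4 : ((‖a ^ n‖₊ : ℝ≥0∞) ^ (1 / n : ℝ)) ^ n ≤ (r : ℝ≥0∞) ^ n := by gcongr
  rw [← ENNReal.rpow_natCast, ← ENNReal.rpow_mul, one_div_mul_cancel hn', ENNReal.rpow_one] at h4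
  exact_mod_cast h4

end UniformPowers

end FreeFermion

namespace FreeFermion

open Filter Topology MeasureTheory
open scoped ENNReal NNReal

/-! ## The sign of a matrix with real non-zero eigenvalues -/

section Sign

attribute [local instance] Matrix.linftyOpNormedRing Matrix.linftyOpNormedAlgebra

variable {d N : ℕ}

theorem norm_entry_le {ι : Type*} [Fintype ι] [DecidableEq ι] (M : Matrix ι ι ℂ) (a b : ι) :
    ‖M a b‖ ≤ ‖M‖ := by
  have h1 : ‖M a b‖₊ ≤ ∑ j, ‖M a j‖₊ :=
    Finset.single_le_sum (f := fun j => ‖M a j‖₊) (fun _ _ => zero_le) (Finset.mem_univ b)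
  have h2 : ∑ j, ‖M a j‖₊ ≤ ‖M‖₊ := by
    rw [Matrix.linfty_opNNNorm_def]
    exact Finset.le_sup (f := fun i => ∑ j, ‖M i j‖₊) (Finset.mem_univ a)
  exact_mod_cast h1.trans h2

/-- The range and the kernel of `P` are sums of generalized eigenspaces, all invariant under `K`,
and an idempotent commutes with any operator preserving both. -/
theorem IsNegativeProjection.commute {K P : Matrix (Fin N) (Fin N) ℂ}
    (hP : IsNegativeProjection K P) : Commute P K := by
  have hid : IsIdempotentElem (Matrix.toLin' P) := by
    rw [IsIdempotentElem, Module.End.mul_eq_comp, ← Matrix.toLin'_mul, hP.idempotent]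
  have hinv : ∀ s : Set ℂ, (⨆ z : s, Module.End.maxGenEigenspace (Matrix.toLin' K) (z : ℂ)) ∈
      Module.End.invtSubmodule (Matrix.toLin' K) := by
    intro s
    rw [Module.End.mem_invtSubmodule_iff_map_le, Submodule.map_iSup]
    refine iSup_mono fun z => ?_
    rw [Submodule.map_le_iff_le_comap]
    exact Module.End.mapsTo_maxGenEigenspace_of_comm (Commute.refl _) _
  have h1 : Commute (Matrix.toLin' P) (Matrix.toLin' K) := by
    rw [LinearMap.IsIdempotentElem.commute_iff hid, hP.range_eq, hP.ker_eq]
    exact ⟨hinv {z : ℂ | z.re < 0}, hinv {z : ℂ | 0 ≤ z.re}⟩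
  have h2 := h1.eq
  rw [Module.End.mul_eq_comp, Module.End.mul_eq_comp, ← Matrix.toLin'_mul,
    ← Matrix.toLin'_mul] at h2
  exact Matrix.toLin'.injective h2

theorem IsNegativeProjection.mulVec_eq {K P : Matrix (Fin N) (Fin N) ℂ}
    (hP : IsNegativeProjection K P) {w : Fin N → ℂ} {e : ℂ} (hw : Matrix.mulVec K w = e • w) :
    (e.re < 0 → Matrix.mulVec P w = w) ∧ (0 ≤ e.re → Matrix.mulVec P w = 0) := by
  have h1 : w ∈ Module.End.maxGenEigenspace (Matrix.toLin' K) e := by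
    refine Module.End.eigenspace_le_maxGenEigenspace ?_
    rw [Module.End.mem_eigenspace_iff, Matrix.toLin'_apply, hw]
  constructor
  · intro he
    have h2 : w ∈ LinearMap.range (Matrix.toLin' P) := by
      rw [hP.range_eq]
      exact Submodule.mem_iSup_of_mem (⟨e, he⟩ : {z : ℂ // z.re < 0}) h1
    obtain ⟨u, rfl⟩ := h2
    rw [Matrix.toLin'_apply, Matrix.mulVec_mulVec, hP.idempotent]
  · intro he
    have h2 : w ∈ LinearMap.ker (Matrix.toLin' P) := by
      rw [hP.ker_eq]
      exact Submodule.mem_iSup_of_mem (⟨e, he⟩ : {z : ℂ // 0 ≤ z.re}) h1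
    simpa using h2

/-- By spectral mapping the elements are `1 - (e/b)²` with `0 < |e| < b` real, so they lie in `(0,
1)`. -/
theorem norm_lt_one_of_mem_spectrum {K : Matrix (Fin N) (Fin N) ℂ} {b : ℝ} (hb : 0 < b)
    (hK : ∀ e, K.charpoly.IsRoot e → e.im = 0 ∧ e ≠ 0 ∧ ‖e‖ < b) {z : ℂ}
    (hz : z ∈ spectrum ℂ (1 - ((b : ℂ)⁻¹ • K) * ((b : ℂ)⁻¹ • K))) : ‖z‖ < 1 := by
  have hb' : (b : ℂ) ≠ 0 := by exact_mod_cast hb.ne'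
  have h1 : 1 - ((b : ℂ)⁻¹ • K) * ((b : ℂ)⁻¹ • K) =
      Polynomial.aeval K (1 - Polynomial.C ((b : ℂ)⁻¹ ^ 2) * Polynomial.X ^ 2) := by
    simp only [map_sub, map_one, map_mul, Polynomial.aeval_C, map_pow, Polynomial.aeval_X]
    rw [smul_mul_smul_comm, ← pow_two, ← pow_two, ← map_pow, ← Algebra.smul_def]
  rw [h1, spectrum.map_polynomial_aeval_of_degree_pos] at hz
  · obtain ⟨e, he, rfl⟩ := hz
    obtain ⟨h2, h3, h4⟩ := hK e (Matrix.mem_spectrum_iff_isRoot_charpoly.mp he)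
    obtain ⟨x, rfl⟩ : ∃ x : ℝ, (x : ℂ) = e := ⟨e.re, by apply Complex.ext <;> simp [h2]⟩
    have hx : x ≠ 0 := by exact_mod_cast h3
    rw [Complex.norm_real, Real.norm_eq_abs] at h4
    have h5 : Polynomial.eval (x : ℂ) (1 - Polynomial.C ((b : ℂ)⁻¹ ^ 2) * Polynomial.X ^ 2) =
        ((1 - (x / b) ^ 2 : ℝ) : ℂ) := by
      simp
      ring
    simp only [h5]
    rw [Complex.norm_real, Real.norm_eq_abs]
    have h6 : (x / b) ^ 2 < 1 := by
      rw [sq_lt_one_iff_abs_lt_one, abs_div, abs_of_pos hb, div_lt_one hb]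
      exact h4
    have h7 : 0 < (x / b) ^ 2 := by positivity
    rw [abs_of_nonneg (by linarith)]
    linarith
  · have h6 : (Polynomial.C ((b : ℂ)⁻¹ ^ 2) * Polynomial.X ^ 2 : Polynomial ℂ).degree = 2 :=
      Polynomial.degree_C_mul_X_pow 2 (by simp [hb'])
    rw [Polynomial.degree_sub_eq_right_of_degree_lt] <;> rw [h6]
    · norm_num
    · exact lt_of_le_of_lt Polynomial.degree_one_le (by norm_num)

theorem mulVec_pow_of_eigen {M : Matrix (Fin N) (Fin N) ℂ} {w : Fin N → ℂ} {z : ℂ}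
    (hw : Matrix.mulVec M w = z • w) (n : ℕ) : Matrix.mulVec (M ^ n) w = z ^ n • w := by
  induction n with
  | zero => simp
  | succ n ih =>
    rw [pow_succ, ← Matrix.mulVec_mulVec, hw, Matrix.mulVec_smul, ih, smul_smul, pow_succ,
      mul_comm]

theorem mulVec_invSqrtSeries {W : Matrix (Fin N) (Fin N) ℂ} (hW : Summable fun n => ‖W ^ n‖)
    {w : Fin N → ℂ} {x : ℝ} (hx0 : 0 ≤ x) (hx1 : x < 1)
    (hw : Matrix.mulVec W w = (x : ℂ) • w) :
    ∃ t : ℝ, 0 ≤ t ∧ Matrix.mulVec (invSqrtSeries W) w = (t : ℂ) • w := by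
  have hs : Summable fun n => invSqrtCoeff n * x ^ n := by
    refine (summable_geometric_of_lt_one hx0 hx1).of_nonneg_of_le
      (fun n => mul_nonneg (invSqrtCoeff_pos n).le (by positivity)) fun n => ?_
    exact mul_le_of_le_one_left (by positivity) (invSqrtCoeff_le_one n)
  refine ⟨∑' n, invSqrtCoeff n * x ^ n,
    tsum_nonneg fun n => mul_nonneg (invSqrtCoeff_pos n).le (by positivity), ?_⟩
  have h1 : HasSum (fun n => Matrix.mulVec (invSqrtCoeff n • W ^ n) w)
      (Matrix.mulVec (invSqrtSeries W) w) := by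
    have hc : Continuous fun M : Matrix (Fin N) (Fin N) ℂ => Matrix.mulVec M w :=
      continuous_id.matrix_mulVec continuous_const
    exact (hasSum_invSqrtSeries hW).map
      (AddMonoidHom.mk' (fun M : Matrix (Fin N) (Fin N) ℂ => Matrix.mulVec M w)
        fun A B => Matrix.add_mulVec A B w) hc
  have h2 : HasSum (fun n => ((invSqrtCoeff n * x ^ n : ℝ) : ℂ) • w)
      (((∑' n, invSqrtCoeff n * x ^ n : ℝ) : ℂ) • w) :=
    (Complex.hasSum_ofReal.mpr hs.hasSum).smul_const w
  refine h1.unique (h2.congr_fun fun n => ?_)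
  rw [Matrix.smul_mulVec, mulVec_pow_of_eigen hw]
  push_cast
  rw [mul_smul]
  rfl

/-- An involution other than 1 has a non-zero `-1` eigenspace, which `K` preserves and in which `K`
has an eigenvector. -/
theorem exists_eigenvector_of_commute {K A : Matrix (Fin N) (Fin N) ℂ} (hAK : Commute A K)
    (hA : A * A = 1) (hne : A ≠ 1) :
    ∃ (w : Fin N → ℂ) (e : ℂ), w ≠ 0 ∧ Matrix.mulVec A w = -w ∧ Matrix.mulVec K w = e • w := by
  set S := LinearMap.ker (Matrix.toLin' (A + 1)) with hS
  have hmem : ∀ w, w ∈ S ↔ Matrix.mulVec A w = -w := by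
    intro w
    rw [hS, LinearMap.mem_ker, Matrix.toLin'_apply, Matrix.add_mulVec, Matrix.one_mulVec,
      add_eq_zero_iff_eq_neg]
  have hnt : Nontrivial S := by
    rw [Submodule.nontrivial_iff_ne_bot]
    intro h
    refine hne (sub_eq_zero.mp (Matrix.toLin'.injective (LinearMap.ext fun u => ?_)))
    have h1 : Matrix.mulVec (A - 1) u ∈ S := by
      rw [hmem, Matrix.mulVec_mulVec, mul_sub, hA, mul_one, ← Matrix.neg_mulVec, neg_sub]
    rw [h, Submodule.mem_bot] at h1
    rw [Matrix.toLin'_apply, h1, map_zero, LinearMap.zero_apply]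
  have hmaps : ∀ w ∈ S, Matrix.toLin' K w ∈ S := by
    intro w hw
    rw [hmem] at hw ⊢
    rw [Matrix.toLin'_apply, Matrix.mulVec_mulVec, hAK.eq, ← Matrix.mulVec_mulVec, hw,
      Matrix.mulVec_neg]
  obtain ⟨e, he⟩ := Module.End.exists_eigenvalue ((Matrix.toLin' K).restrict hmaps)
  obtain ⟨w, hw⟩ := he.exists_hasEigenvector
  refine ⟨w, e, fun h => hw.2 (Subtype.ext h), (hmem _).mp w.2, ?_⟩
  have h1 := congrArg Subtype.val hw.apply_eq_smul
  simpa using h1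

/-- The sign of `K` is `K / √(K²)`. -/
theorem IsNegativeProjection.one_sub_eq {K P : Matrix (Fin N) (Fin N) ℂ}
    (hP : IsNegativeProjection K P) {b : ℝ} (hb : 0 < b)
    (hK : ∀ e, K.charpoly.IsRoot e → e.im = 0 ∧ e ≠ 0 ∧ ‖e‖ < b)
    (hW : Summable fun n => ‖(1 - ((b : ℂ)⁻¹ • K) * ((b : ℂ)⁻¹ • K)) ^ n‖) :
    1 - (2 : ℂ) • P = ((b : ℂ)⁻¹ • K) *
      invSqrtSeries (1 - ((b : ℂ)⁻¹ • K) * ((b : ℂ)⁻¹ • K)) := by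
  have hb' : (b : ℂ) ≠ 0 := by exact_mod_cast hb.ne'
  set X := (b : ℂ)⁻¹ • K with hX
  set W := 1 - X * X with hWdef
  set T := invSqrtSeries W with hT
  set J := 1 - (2 : ℂ) • P with hJ
  have hJJ : J * J = 1 := by
    have : J * J = 1 - (4 : ℂ) • P + (4 : ℂ) • (P * P) := by
      rw [hJ, sub_mul, one_mul, mul_sub, mul_one, smul_mul_smul_comm]
      module
    rw [this, hP.idempotent]
    simp
  have hPX : Commute P X := hP.commute.smul_right _
  have hJX : Commute J X := (Commute.one_left X).sub_left (hPX.smul_left _)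
  have hJW : Commute J W := (Commute.one_right J).sub_right (hJX.mul_right hJX)
  have hXW : Commute X W := (Commute.one_right X).sub_right ((Commute.refl X).mul_right
    (Commute.refl X))
  have hKX : Commute K X := (Commute.refl K).smul_right _
  have hKW : Commute K W := (Commute.one_right K).sub_right (hKX.mul_right hKX)
  have hJT : Commute J T := commute_invSqrtSeries hW hJW
  have hXT : Commute X T := commute_invSqrtSeries hW hXW
  have hKT : Commute K T := commute_invSqrtSeries hW hKW
  have hJK : Commute J K := (Commute.one_left K).sub_left (hP.commute.smul_left _)
  have hTT : T * T * (X * X) = 1 := by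
    have := invSqrtSeries_mul_self hW
    rwa [hWdef, sub_sub_cancel] at this
  have hXTJ : Commute (X * T) J := hJX.symm.mul_left hJT.symm
  have hAA : (X * T * J) * (X * T * J) = 1 := by
    calc (X * T * J) * (X * T * J) = (X * T) * (J * (X * T)) * J := by noncomm_ring
      _ = (X * T) * ((X * T) * J) * J := by rw [hXTJ.eq]
      _ = X * (T * X) * T * (J * J) := by noncomm_ring
      _ = X * (X * T) * T := by rw [hJJ, hXT.eq, mul_one]
      _ = (X * X) * (T * T) := by noncomm_ring
      _ = T * T * (X * X) := ((hXT.mul_left hXT).mul_right (hXT.mul_left hXT)).eq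
      _ = 1 := hTT
  have hAK : Commute (X * T * J) K := ((hKX.symm.mul_left hKT.symm).mul_left hJK)
  -- The matrix `X T J` is an involution commuting with `K`. Were it not 1, a common eigenvector
  -- would have eigenvalue `-1`; but there `X J` acts as `|x|/b` and `T` as some `t ≥ 0`. One common
  -- eigenvector is enough, so `K` may have Jordan blocks.
  have hA : X * T * J = 1 := by
    by_contra hne
    obtain ⟨w, e, hw0, hAw, hKw⟩ := exists_eigenvector_of_commute hAK hAA hne
    have hroot : K.charpoly.IsRoot e := by
      rw [← Matrix.mem_spectrum_iff_isRoot_charpoly, ← Matrix.spectrum_toLin']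
      refine (Module.End.hasEigenvalue_of_hasEigenvector (x := w) ⟨?_, hw0⟩).mem_spectrum
      rw [Module.End.mem_eigenspace_iff, Matrix.toLin'_apply, hKw]
    obtain ⟨h2, h3, h4⟩ := hK e hroot
    obtain ⟨x, rfl⟩ : ∃ x : ℝ, (x : ℂ) = e := ⟨e.re, by apply Complex.ext <;> simp [h2]⟩
    have hx : x ≠ 0 := by exact_mod_cast h3
    rw [Complex.norm_real, Real.norm_eq_abs] at h4
    have h6 : (x / b) ^ 2 < 1 := by
      rw [sq_lt_one_iff_abs_lt_one, abs_div, abs_of_pos hb, div_lt_one hb]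
      exact h4
    have h7 : 0 < (x / b) ^ 2 := by positivity
    have hXw : Matrix.mulVec X w = ((x / b : ℝ) : ℂ) • w := by
      rw [hX, Matrix.smul_mulVec, hKw, smul_smul]
      push_cast
      rw [div_eq_inv_mul]
    have hWw : Matrix.mulVec W w = ((1 - (x / b) ^ 2 : ℝ) : ℂ) • w := by
      rw [hWdef, Matrix.sub_mulVec, Matrix.one_mulVec, ← Matrix.mulVec_mulVec, hXw,
        Matrix.mulVec_smul, hXw, smul_smul]
      push_cast
      module
    obtain ⟨t, ht0, ht⟩ := mulVec_invSqrtSeries hW (by linarith) (by linarith) hWw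
    have hJw : Matrix.mulVec J w = ((SignType.sign x : ℝ) : ℂ) • w := by
      rw [hJ, Matrix.sub_mulVec, Matrix.one_mulVec, Matrix.smul_mulVec]
      rcases lt_or_gt_of_ne hx with h | h
      · rw [(hP.mulVec_eq hKw).1 (by simpa using h), sign_neg h]
        simp
        module
      · rw [(hP.mulVec_eq hKw).2 (by simpa using h.le), sign_pos h]
        simp
    have h8 : Matrix.mulVec (X * T * J) w = ((t * (|x| / b) : ℝ) : ℂ) • w := by
      rw [← Matrix.mulVec_mulVec, hJw, Matrix.mulVec_smul, ← Matrix.mulVec_mulVec, ht,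
        Matrix.mulVec_smul, hXw, smul_smul, smul_smul, ← Complex.ofReal_mul,
        ← Complex.ofReal_mul, ← sign_mul_self x]
      congr 2
      ring
    rw [hAw] at h8
    have h9 : ((t * (|x| / b) + 1 : ℝ) : ℂ) • w = 0 := by
      push_cast at h8 ⊢
      rw [add_smul, ← h8]
      simp
    rcases smul_eq_zero.mp h9 with h10 | h10
    · have : t * (|x| / b) + 1 = 0 := by exact_mod_cast h10
      have : 0 ≤ t * (|x| / b) := by positivity
      linarith
    · exact hw0 h10
  calc J = X * T * J * J := by rw [hA, one_mul]
    _ = X * T := by rw [mul_assoc, hJJ, mul_one]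

end Sign

end FreeFermion

namespace FreeFermion

open Filter Topology MeasureTheory
open scoped ENNReal NNReal

/-! ## Trigonometric polynomials -/

section Trig

variable {d : ℕ}

/-- Trigonometric polynomials of degree at most `n` in each momentum component. -/
noncomputable def trigSpan (d n : ℕ) : Submodule ℂ (Momentum d → ℂ) :=
  Submodule.span ℂ ((fun (v : Fin d → ℤ) k => phase k v) '' {v | ∀ i, |v i| ≤ n})

theorem trigSpan_mono {m n : ℕ} (h : m ≤ n) : trigSpan d m ≤ trigSpan d n := by
  refine Submodule.span_mono (Set.image_mono fun v hv i => (hv i).trans ?_)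
  exact_mod_cast h

theorem phase_mem_trigSpan {n : ℕ} {v : Fin d → ℤ} (h : ∀ i, |v i| ≤ n) :
    (fun k => phase k v) ∈ trigSpan d n :=
  Submodule.subset_span ⟨v, h, rfl⟩

theorem const_mem_trigSpan (c : ℂ) (n : ℕ) : (fun _ => c) ∈ trigSpan d n := by
  have h : (fun k => phase k (0 : Fin d → ℤ)) ∈ trigSpan d n := phase_mem_trigSpan (by simp)
  convert Submodule.smul_mem _ c h using 1
  ext k
  simp

theorem mul_mem_trigSpan {m n : ℕ} {f g : Momentum d → ℂ} (hf : f ∈ trigSpan d m)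
    (hg : g ∈ trigSpan d n) : (fun k => f k * g k) ∈ trigSpan d (m + n) := by
  have h1 : f * g ∈ trigSpan d m * trigSpan d n := Submodule.mul_mem_mul hf hg
  have h2 : trigSpan d m * trigSpan d n ≤ trigSpan d (m + n) := by
    rw [trigSpan, trigSpan, Submodule.span_mul_span, Submodule.span_le]
    rintro _ ⟨_, ⟨v, hv, rfl⟩, _, ⟨w, hw, rfl⟩, rfl⟩
    refine Submodule.subset_span ⟨v + w, fun i => ?_, ?_⟩
    · push_cast
      exact (abs_add_le _ _).trans (add_le_add (hv i) (hw i))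
    · ext k
      simp [phase_add]
  exact h2 h1

/-- Matrices of trigonometric polynomials. -/
def IsTrigMatrix {N : ℕ} (n : ℕ) (F : Momentum d → Matrix (Fin N) (Fin N) ℂ) : Prop :=
  ∀ a b, (fun k => F k a b) ∈ trigSpan d n

variable {N : ℕ}

theorem IsTrigMatrix.mono {m n : ℕ} {F : Momentum d → Matrix (Fin N) (Fin N) ℂ}
    (hF : IsTrigMatrix m F) (h : m ≤ n) : IsTrigMatrix n F :=
  fun a b => trigSpan_mono h (hF a b)

theorem isTrigMatrix_const (M : Matrix (Fin N) (Fin N) ℂ) (n : ℕ) :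
    IsTrigMatrix n fun _ : Momentum d => M :=
  fun a b => const_mem_trigSpan (M a b) n

theorem IsTrigMatrix.mul {m n : ℕ} {F G : Momentum d → Matrix (Fin N) (Fin N) ℂ}
    (hF : IsTrigMatrix m F) (hG : IsTrigMatrix n G) :
    IsTrigMatrix (m + n) fun k => F k * G k := by
  intro a b
  have h : (fun k => (F k * G k) a b) = ∑ c, fun k => F k a c * G k c b := by
    ext k
    simp [Matrix.mul_apply]
  rw [h]
  exact Submodule.sum_mem _ fun c _ => mul_mem_trigSpan (hF a c) (hG c b)

theorem IsTrigMatrix.sub {n : ℕ} {F G : Momentum d → Matrix (Fin N) (Fin N) ℂ}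
    (hF : IsTrigMatrix n F) (hG : IsTrigMatrix n G) : IsTrigMatrix n fun k => F k - G k :=
  fun a b => Submodule.sub_mem _ (hF a b) (hG a b)

theorem IsTrigMatrix.smul {n : ℕ} {F : Momentum d → Matrix (Fin N) (Fin N) ℂ}
    (hF : IsTrigMatrix n F) (c : ℂ) : IsTrigMatrix n fun k => c • F k :=
  fun a b => Submodule.smul_mem _ c (hF a b)

theorem IsTrigMatrix.sum {ι : Type*} {n : ℕ} (s : Finset ι)
    {F : ι → Momentum d → Matrix (Fin N) (Fin N) ℂ} (hF : ∀ j ∈ s, IsTrigMatrix n (F j)) :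
    IsTrigMatrix n fun k => ∑ j ∈ s, F j k := by
  intro a b
  have h : (fun k => (∑ j ∈ s, F j k) a b) = ∑ j ∈ s, fun k => F j k a b := by
    ext k
    simp [Matrix.sum_apply]
  rw [h]
  exact Submodule.sum_mem _ fun j hj => hF j hj a b

theorem IsTrigMatrix.pow {n : ℕ} {F : Momentum d → Matrix (Fin N) (Fin N) ℂ}
    (hF : IsTrigMatrix n F) (j : ℕ) : IsTrigMatrix (n * j) fun k => F k ^ j := by
  induction j with
  | zero => simpa using isTrigMatrix_const 1 0
  | succ j ih =>
    simp only [pow_succ]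
    exact ih.mul hF

theorem LocalPTHamiltonian.exists_isTrigMatrix (H : LocalPTHamiltonian d N) :
    ∃ r : ℕ, IsTrigMatrix r H.bloch := by
  set r := ∑ v ∈ H.hopping.support, ∑ i, (v i).natAbs with hr
  refine ⟨r, ?_⟩
  refine IsTrigMatrix.sum _ fun v hv a b => ?_
  have h1 : (fun k : Momentum d => phase k v) ∈ trigSpan d r := by
    refine phase_mem_trigSpan fun i => ?_
    have h2 : (v i).natAbs ≤ r :=
      (Finset.single_le_sum (f := fun i => (v i).natAbs) (fun _ _ => Nat.zero_le _)
        (Finset.mem_univ i)).trans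
        (Finset.single_le_sum (f := fun v : Fin d → ℤ => ∑ i, (v i).natAbs)
          (fun _ _ => Nat.zero_le _) hv)
    rw [Int.abs_eq_natAbs]
    exact_mod_cast h2
  convert Submodule.smul_mem _ (H.hopping v a b) h1 using 1
  ext k
  simp [mul_comm]

theorem LocalPTHamiltonian.continuous_bloch (H : LocalPTHamiltonian d N) :
    Continuous H.bloch :=
  continuous_finsetSum _ fun v _ => (continuous_phase v).smul continuous_const

/-- The closed cell `[0, 2π]^d` of momentum space. -/
def momentumCell (d : ℕ) : Set (Momentum d) := {k | ∀ i, k i ∈ Set.Icc 0 (2 * Real.pi)}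

theorem isCompact_momentumCell : IsCompact (momentumCell d) := by
  have h1 : IsCompact (Set.univ.pi fun _ : Fin d => Set.Icc (0 : ℝ) (2 * Real.pi)) :=
    isCompact_univ_pi fun _ => isCompact_Icc
  have h2 : momentumCell d = (EuclideanSpace.equiv (Fin d) ℝ) ⁻¹'
      (Set.univ.pi fun _ : Fin d => Set.Icc (0 : ℝ) (2 * Real.pi)) := by
    ext k
    simp only [momentumCell, Set.mem_preimage, Set.mem_pi, Set.mem_univ, true_imp_iff]
    rfl
  rw [h2]
  exact (EuclideanSpace.equiv (Fin d) ℝ).toHomeomorph.isCompact_preimage.mpr h1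

theorem gridMomentum_mem_momentumCell {Λ : ℕ} (n : Fin d → Fin Λ) :
    gridMomentum n ∈ momentumCell d := by
  intro i
  have h1 : ((n i : ℕ) : ℝ) ≤ Λ := by exact_mod_cast (n i).2.le
  have h2 : (0 : ℝ) < Λ := by exact_mod_cast (n i).pos
  simp only [gridMomentum, PiLp.toLp_apply]
  constructor
  · positivity
  · rw [div_le_iff₀ h2]
    exact mul_le_mul_of_nonneg_left h1 (by positivity)

attribute [local instance] Matrix.linftyOpNormedRing Matrix.linftyOpNormedAlgebra

/-- The spectral sign of a gapped Bloch Hamiltonian is approximated exponentially well by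
trigonometric polynomials. -/
theorem IsGappedUnbroken.exists_trig_approx {H : LocalPTHamiltonian d N}
    {E : Fin N → Momentum d → ℂ} (h : IsGappedUnbroken H E)
    {P : Momentum d → Matrix (Fin N) (Fin N) ℂ}
    (hP : ∀ k, IsNegativeProjection (H.bloch k) (P k)) :
    ∃ (C θ : ℝ) (r : ℕ), 0 ≤ C ∧ 0 < θ ∧ θ < 1 ∧ 0 < r ∧
      ∃ S : ℕ → Momentum d → Matrix (Fin N) (Fin N) ℂ, S 0 = 0 ∧
        ∀ n, IsTrigMatrix (r * (2 * n + 1)) (S n) ∧ ∀ k ∈ momentumCell d, ∀ a b,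
          ‖(1 - (2 : ℂ) • P k) a b - S n k a b‖ ≤ C * θ ^ n := by
  obtain ⟨r, hr⟩ := H.exists_isTrigMatrix
  -- The scale `b` exceeds all energies on the cell, so that `K/b` has its spectrum in `(-1, 1)`
  -- without 0.
  obtain ⟨b, hb, hEb⟩ : ∃ b : ℝ, 0 < b ∧ ∀ α, ∀ k ∈ momentumCell d, ‖E α k‖ < b := by
    choose B hB using fun α => isCompact_momentumCell.exists_bound_of_continuousOn
      (h.bands.continuous α).continuousOn
    refine ⟨1 + ∑ α, |B α|, by positivity, fun α k hk => ?_⟩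
    have h1 : |B α| ≤ ∑ α, |B α| :=
      Finset.single_le_sum (f := fun α => |B α|) (fun _ _ => abs_nonneg _) (Finset.mem_univ α)
    linarith [hB α k hk, le_abs_self (B α)]
  have hK : ∀ k ∈ momentumCell d, ∀ e, (H.bloch k).charpoly.IsRoot e →
      e.im = 0 ∧ e ≠ 0 ∧ ‖e‖ < b := by
    intro k hk e he
    rw [h.bands.charpoly_eq, Polynomial.IsRoot, Polynomial.eval_prod,
      Finset.prod_eq_zero_iff] at he
    obtain ⟨α, -, hα⟩ := he
    rw [Polynomial.eval_sub, Polynomial.eval_X, Polynomial.eval_C, sub_eq_zero] at hα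
    subst hα
    exact ⟨h.real α k, h.gapped α k, hEb α k hk⟩
  set X : Momentum d → Matrix (Fin N) (Fin N) ℂ := fun k => (b : ℂ)⁻¹ • H.bloch k with hX
  set W : Momentum d → Matrix (Fin N) (Fin N) ℂ := fun k => 1 - X k * X k with hW
  have hXc : Continuous X := H.continuous_bloch.const_smul (b : ℂ)⁻¹
  have hWc : Continuous W := continuous_const.sub (hXc.mul hXc)
  have hXt : IsTrigMatrix r X := hr.smul _
  have hWt : IsTrigMatrix (2 * r) W :=
    (isTrigMatrix_const 1 (2 * r)).sub ((hXt.mul hXt).mono (by omega))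
  obtain ⟨C, θ, hC, hθ0, hθ1, hCθ⟩ := exists_norm_pow_le isCompact_momentumCell hWc
    fun k hk => tendsto_pow_of_spectrum fun z hz => norm_lt_one_of_mem_spectrum hb (hK k hk) hz
  obtain ⟨B, hB⟩ := isCompact_momentumCell.exists_bound_of_continuousOn hXc.continuousOn
  -- The approximation is `X` times the truncated series in `W`. Its degree is at most `r + 2rn`,
  -- and for `n = 0` the empty sum gives the zero approximation. Replacing `r` by `r + 1` makes the
  -- degree scale positive.
  refine ⟨|B| * (C * (1 - θ)⁻¹), θ, r + 1, ?_, hθ0, hθ1, Nat.succ_pos r,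
    fun n k => X k * ∑ j ∈ Finset.range n, (invSqrtCoeff j : ℂ) • W k ^ j, ?_,
    fun n => ⟨?_, ?_⟩⟩
  · have : 0 < 1 - θ := by linarith
    positivity
  · ext k
    simp
  · refine (hXt.mul (IsTrigMatrix.sum (n := 2 * r * n) _ fun j hj => ?_)).mono ?_
    · exact ((hWt.pow j).mono (Nat.mul_le_mul_left _ (Finset.mem_range.mp hj).le)).smul _
    · nlinarith
  · intro k hk a c
    have hs : Summable fun n => ‖W k ^ n‖ :=
      ((summable_geometric_of_lt_one hθ0.le hθ1).mul_left C).of_nonneg_of_le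
        (fun n => norm_nonneg _) (hCθ k hk)
    rw [(hP k).one_sub_eq hb (hK k hk) hs, ← Matrix.sub_apply, ← mul_sub]
    refine (norm_entry_le _ a c).trans ((norm_mul_le _ _).trans ?_)
    rw [mul_assoc]
    refine mul_le_mul ((hB k hk).trans (le_abs_self B)) ?_ (norm_nonneg _) (abs_nonneg _)
    exact norm_invSqrtSeries_sub_le hθ0.le hθ1 (hCθ k hk) n

end Trig

end FreeFermion

namespace FreeFermion

open Filter Topology MeasureTheory
open scoped ENNReal NNReal

/-! ## Translation invariant matrices on the torus -/

section Torus

variable {d N : ℕ}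

/-- The translation invariant matrix with symbol `F` (transposed) on the modes of the torus. -/
noncomputable def torusMatrix (F : Momentum d → Matrix (Fin N) (Fin N) ℂ) (Λ : ℕ) :
    Matrix (Mode d N Λ) (Mode d N Λ) ℂ :=
  Matrix.of fun p q => ((Λ : ℂ) ^ d)⁻¹ * ∑ n : Fin d → Fin Λ,
    starRingEnd ℂ (phase (gridMomentum n) (siteVector p.1)) *
      phase (gridMomentum n) (siteVector q.1) * F (gridMomentum n) q.2 p.2

theorem torusMatrix_one {Λ : ℕ} (hΛ : 0 < Λ) :
    torusMatrix (fun _ : Momentum d => (1 : Matrix (Fin N) (Fin N) ℂ)) Λ = 1 := by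
  have hΛ' : (Λ : ℂ) ^ d ≠ 0 := pow_ne_zero _ (by exact_mod_cast hΛ.ne')
  ext p q
  have h1 : ∀ n : Fin d → Fin Λ, starRingEnd ℂ (phase (gridMomentum n) (siteVector p.1)) *
      phase (gridMomentum n) (siteVector q.1) =
        phase (gridMomentum n) (siteVector q.1 - siteVector p.1) := fun n => by
    rw [phase_sub, mul_comm]
  simp only [torusMatrix, Matrix.of_apply, h1]
  rw [← Finset.sum_mul, sum_phase_gridMomentum hΛ, Matrix.one_apply, Matrix.one_apply]
  simp only [dvd_siteVector_sub_iff]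
  by_cases h2 : q.1 = p.1
  · by_cases h3 : q.2 = p.2
    · rw [if_pos h2, if_pos h3, if_pos (Prod.ext h2 h3).symm, mul_one, inv_mul_cancel₀ hΛ']
    · rw [if_neg h3, if_neg fun h => h3 (congrArg Prod.snd h).symm]
      simp
  · rw [if_neg h2, if_neg fun h => h2 (congrArg Prod.fst h).symm]
    simp

/-- The symbol enters transposed, so multiplying the matrices multiplies the symbols in the opposite
order. -/
theorem torusMatrix_mul {Λ : ℕ} (hΛ : 0 < Λ) (F G : Momentum d → Matrix (Fin N) (Fin N) ℂ) :
    torusMatrix F Λ * torusMatrix G Λ = torusMatrix (fun k => G k * F k) Λ := by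
  have hΛ' : (Λ : ℂ) ^ d ≠ 0 := pow_ne_zero _ (by exact_mod_cast hΛ.ne')
  ext p q
  rw [Matrix.mul_apply, Fintype.sum_prod_type_right]
  simp only [torusMatrix, Matrix.of_apply]
  have h1 : ∀ c : Fin N, ∑ x : Fin d → Fin Λ,
      (((Λ : ℂ) ^ d)⁻¹ * ∑ n : Fin d → Fin Λ,
        starRingEnd ℂ (phase (gridMomentum n) (siteVector p.1)) *
          phase (gridMomentum n) (siteVector x) * F (gridMomentum n) c p.2) *
      (((Λ : ℂ) ^ d)⁻¹ * ∑ n : Fin d → Fin Λ,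
        starRingEnd ℂ (phase (gridMomentum n) (siteVector x)) *
          phase (gridMomentum n) (siteVector q.1) * G (gridMomentum n) q.2 c) =
      ((Λ : ℂ) ^ d)⁻¹ * ∑ n : Fin d → Fin Λ,
        starRingEnd ℂ (phase (gridMomentum n) (siteVector p.1)) *
          phase (gridMomentum n) (siteVector q.1) *
            (G (gridMomentum n) q.2 c * F (gridMomentum n) c p.2) := by
    intro c
    have h2 : ∀ x : Fin d → Fin Λ, (((Λ : ℂ) ^ d)⁻¹ * ∑ n : Fin d → Fin Λ,
        starRingEnd ℂ (phase (gridMomentum n) (siteVector p.1)) *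
          phase (gridMomentum n) (siteVector x) * F (gridMomentum n) c p.2) *
      (((Λ : ℂ) ^ d)⁻¹ * ∑ n : Fin d → Fin Λ,
        starRingEnd ℂ (phase (gridMomentum n) (siteVector x)) *
          phase (gridMomentum n) (siteVector q.1) * G (gridMomentum n) q.2 c) =
      ((Λ : ℂ) ^ d)⁻¹ * ((Λ : ℂ) ^ d)⁻¹ * ∑ n : Fin d → Fin Λ, ∑ n' : Fin d → Fin Λ,
        (starRingEnd ℂ (phase (gridMomentum n) (siteVector p.1)) * F (gridMomentum n) c p.2 *
          phase (gridMomentum n') (siteVector q.1) * G (gridMomentum n') q.2 c) *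
          (phase (gridMomentum n) (siteVector x) *
            starRingEnd ℂ (phase (gridMomentum n') (siteVector x))) := by
      intro x
      rw [mul_mul_mul_comm, Finset.sum_mul_sum]
      congr 1
      refine Finset.sum_congr rfl fun n _ => Finset.sum_congr rfl fun n' _ => ?_
      ring
    simp only [h2]
    rw [← Finset.mul_sum, mul_assoc, Finset.sum_comm]
    congr 1
    have h3 : ∀ n : Fin d → Fin Λ, ∑ x : Fin d → Fin Λ, ∑ n' : Fin d → Fin Λ,
        (starRingEnd ℂ (phase (gridMomentum n) (siteVector p.1)) * F (gridMomentum n) c p.2 *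
          phase (gridMomentum n') (siteVector q.1) * G (gridMomentum n') q.2 c) *
          (phase (gridMomentum n) (siteVector x) *
            starRingEnd ℂ (phase (gridMomentum n') (siteVector x))) =
        (Λ : ℂ) ^ d * (starRingEnd ℂ (phase (gridMomentum n) (siteVector p.1)) *
          phase (gridMomentum n) (siteVector q.1) *
            (G (gridMomentum n) q.2 c * F (gridMomentum n) c p.2)) := by
      intro n
      rw [Finset.sum_comm]
      simp only [← Finset.mul_sum, sum_phase_sites hΛ]
      simp only [mul_ite, mul_zero, Finset.sum_ite_eq, Finset.mem_univ, if_true]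
      ring
    rw [Finset.sum_congr rfl fun n _ => h3 n, ← Finset.mul_sum, inv_mul_cancel_left₀ hΛ']
  rw [Finset.sum_congr rfl fun c _ => h1 c, ← Finset.mul_sum, Finset.sum_comm]
  congr 1
  refine Finset.sum_congr rfl fun n _ => ?_
  rw [← Finset.mul_sum, Matrix.mul_apply]

theorem orbitalCorrelation_eq {Λ L : ℕ} (hΛ : 0 < Λ)
    (P : Momentum d → Matrix (Fin N) (Fin N) ℂ) (p q : {p // p ∈ cube d N Λ L}) :
    orbitalCorrelation P Λ L p q = torusMatrix (fun k => 1 - (2 : ℂ) • P k) Λ p q := by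
  have h1 := congrFun (congrFun (torusMatrix_one (d := d) (N := N) hΛ) (p : Mode d N Λ))
    (q : Mode d N Λ)
  rw [Matrix.one_apply] at h1
  have h2 : (if p = q then (1 : ℂ) else 0) = if (p : Mode d N Λ) = q then 1 else 0 := by
    simp only [Subtype.ext_iff]
  rw [orbitalCorrelation, Matrix.of_apply, h2, ← h1]
  simp only [torusMatrix, Matrix.of_apply, Matrix.sub_apply, Matrix.smul_apply, smul_eq_mul,
    mul_sub, Finset.sum_sub_distrib]
  congr 1
  rw [mul_assoc, mul_left_comm, Finset.mul_sum]
  congr 1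
  refine Finset.sum_congr rfl fun n _ => ?_
  ring

/-- A grid sum sees frequencies only modulo `Λ`. No frequency of degree at most `n` can bring `v_i`
to a multiple of `Λ`, so every term vanishes exactly. -/
theorem sum_phase_mul_trig_eq_zero {Λ n : ℕ} (hΛ : 0 < Λ) {v : Fin d → ℤ} {i : Fin d}
    (hv : ∀ m : ℤ, (n : ℤ) < |v i - Λ * m|) {f : Momentum d → ℂ} (hf : f ∈ trigSpan d n) :
    ∑ x : Fin d → Fin Λ, phase (gridMomentum x) v * f (gridMomentum x) = 0 := by
  induction hf using Submodule.span_induction with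
  | mem f hf =>
    obtain ⟨w, hw, rfl⟩ := hf
    simp only [← phase_add]
    rw [sum_phase_gridMomentum hΛ, if_neg]
    intro h
    obtain ⟨c, hc⟩ := h i
    rw [Pi.add_apply] at hc
    have h1 := hv c
    have h2 := hw i
    rw [← hc, show v i - (v i + w i) = -w i by ring, abs_neg] at h1
    omega
  | zero => simp
  | add f g _ _ hf hg => simp [mul_add, Finset.sum_add_distrib, hf, hg]
  | smul c f _ hf =>
    simp only [Pi.smul_apply, smul_eq_mul, mul_left_comm _ c]
    rw [← Finset.mul_sum, hf, mul_zero]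

/-- The distance of two sites of a ring of length `Λ`. -/
def ringDist (Λ a b : ℕ) : ℕ := min ((a - b) + (b - a)) (Λ - ((a - b) + (b - a)))

theorem ringDist_le {Λ : ℕ} (a b : Fin Λ) (m : ℤ) :
    (ringDist Λ a b : ℤ) ≤ |((b : ℕ) : ℤ) - ((a : ℕ) : ℤ) - Λ * m| := by
  have ha := a.2
  have hb := b.2
  rw [ringDist]
  rcases lt_trichotomy m 0 with h | rfl | h
  · have h1 : (Λ : ℤ) * m ≤ -Λ := by nlinarith
    rw [abs_of_pos (by omega)]
    omega
  · rw [mul_zero, sub_zero]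
    rcases abs_cases (((b : ℕ) : ℤ) - ((a : ℕ) : ℤ)) with h1 | h1 <;> rw [h1.1] <;> omega
  · have h1 : (Λ : ℤ) ≤ Λ * m := by nlinarith
    rw [abs_of_neg (by omega)]
    omega

/-- A trigonometric polynomial of degree below the ring distance can be subtracted from the symbol
without changing the matrix element, which leaves only the approximation error. For `n = 0` the
subtracted polynomial is zero, so no distance is required. -/
theorem norm_torusMatrix_le {F : Momentum d → Matrix (Fin N) (Fin N) ℂ} {C θ : ℝ} {r : ℕ}
    {S : ℕ → Momentum d → Matrix (Fin N) (Fin N) ℂ} (hS0 : S 0 = 0)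
    (hS : ∀ n, IsTrigMatrix (r * (2 * n + 1)) (S n) ∧ ∀ k ∈ momentumCell d, ∀ a b,
      ‖F k a b - S n k a b‖ ≤ C * θ ^ n) {Λ : ℕ} (hΛ : 0 < Λ) (p q : Mode d N Λ) {n : ℕ}
    (hn : n = 0 ∨ ∃ i, r * (2 * n + 1) < ringDist Λ (p.1 i) (q.1 i)) :
    ‖torusMatrix F Λ p q‖ ≤ C * θ ^ n := by
  have h1 : ∀ x : Fin d → Fin Λ, starRingEnd ℂ (phase (gridMomentum x) (siteVector p.1)) *
      phase (gridMomentum x) (siteVector q.1) =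
        phase (gridMomentum x) (siteVector q.1 - siteVector p.1) := fun x => by
    rw [phase_sub, mul_comm]
  have h2 : ∑ x : Fin d → Fin Λ, phase (gridMomentum x) (siteVector q.1 - siteVector p.1) *
      S n (gridMomentum x) q.2 p.2 = 0 := by
    rcases hn with rfl | ⟨i, hi⟩
    · simp [hS0]
    · refine sum_phase_mul_trig_eq_zero hΛ (i := i) (fun m => ?_) ((hS n).1 q.2 p.2)
      refine lt_of_lt_of_le ?_ (ringDist_le (p.1 i) (q.1 i) m)
      exact_mod_cast hi
  have h3 : torusMatrix F Λ p q = ((Λ : ℂ) ^ d)⁻¹ * ∑ x : Fin d → Fin Λ,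
      phase (gridMomentum x) (siteVector q.1 - siteVector p.1) *
        (F (gridMomentum x) q.2 p.2 - S n (gridMomentum x) q.2 p.2) := by
    simp only [torusMatrix, Matrix.of_apply, h1, mul_sub, Finset.sum_sub_distrib, h2, sub_zero]
  have hΛ' : (0 : ℝ) < (Λ : ℝ) ^ d := by positivity
  rw [h3, norm_mul, norm_inv, norm_pow, Complex.norm_natCast, inv_mul_le_iff₀ hΛ']
  refine (norm_sum_le _ _).trans ((Finset.sum_le_card_nsmul _ _ (C * θ ^ n) fun x _ => ?_).trans
    (le_of_eq ?_))
  · rw [norm_mul, norm_phase, one_mul]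
    exact (hS n).2 _ (gridMomentum_mem_momentumCell x) _ _
  · simp

/-- The kernel `ψ^|a-b| + ψ^(Λ-|a-b|)` on a ring of length `Λ`. -/
noncomputable def ringKernel (ψ : ℝ) (Λ a b : ℕ) : ℝ :=
  ψ ^ ((a - b) + (b - a)) + ψ ^ (Λ - ((a - b) + (b - a)))

theorem ringKernel_nonneg {ψ : ℝ} (hψ : 0 ≤ ψ) (Λ a b : ℕ) : 0 ≤ ringKernel ψ Λ a b := by
  rw [ringKernel]; positivity

theorem pow_ringDist_le {ψ : ℝ} (hψ : 0 ≤ ψ) (Λ a b : ℕ) :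
    ψ ^ ringDist Λ a b ≤ ringKernel ψ Λ a b := by
  rw [ringDist, ringKernel]
  rcases min_choice ((a - b) + (b - a)) (Λ - ((a - b) + (b - a))) with h | h <;> rw [h]
  · exact le_add_of_nonneg_right (by positivity)
  · exact le_add_of_nonneg_left (by positivity)

/-- The matrix elements of the spectral sign decay exponentially. -/
theorem IsGappedUnbroken.exists_decay {H : LocalPTHamiltonian d N} {E : Fin N → Momentum d → ℂ}
    (hd : 0 < d) (h : IsGappedUnbroken H E) {P : Momentum d → Matrix (Fin N) (Fin N) ℂ}
    (hP : ∀ k, IsNegativeProjection (H.bloch k) (P k)) :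
    ∃ C ω : ℝ, 0 ≤ C ∧ 0 < ω ∧ ω < 1 ∧ ∀ (Λ : ℕ) (p q : Mode d N Λ), 0 < Λ →
      ‖torusMatrix (fun k => 1 - (2 : ℂ) • P k) Λ p q‖ ≤
        C * ∏ i, ringKernel (ω ^ 4) Λ (p.1 i) (q.1 i) := by
  obtain ⟨C, θ, r, hC, hθ0, hθ1, hr, S, hS0, hS⟩ := h.exists_trig_approx hP
  -- The rate is a root of `θ` because the usable order is about `n = D/(2r)` for the largest ring
  -- distance `D`, while the product kernel involves the sum of the distances, at most `d D`, with
  -- base `ω⁴`.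
  set ω : ℝ := θ ^ (((8 * r * d : ℕ) : ℝ)⁻¹) with hω
  have hrd : 8 * r * d ≠ 0 := by positivity
  have hω0 : 0 < ω := Real.rpow_pos_of_pos hθ0 _
  have hω1 : ω < 1 := Real.rpow_lt_one hθ0.le hθ1 (by positivity)
  have hωθ : ω ^ (8 * r * d) = θ := Real.rpow_inv_natCast_pow hθ0.le hrd
  refine ⟨C * (ω ^ (12 * r * d))⁻¹, ω, by positivity, hω0, hω1, fun Λ p q hΛ => ?_⟩
  have : Nonempty (Fin d) := ⟨⟨0, hd⟩⟩
  obtain ⟨i, hi⟩ := Finite.exists_max fun i => ringDist Λ (p.1 i) (q.1 i)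
  set D := ringDist Λ (p.1 i) (q.1 i) with hD
  -- This is an order of approximation with degree `r(2n+1)` below `D`, and truncated subtraction
  -- makes it 0 for small `D`. The rounding loses at most `3r` in the distance, which the prefactor
  -- `ω^(-12rd)` pays for.
  set n := (D - 1 - r) / (2 * r) with hn
  have h2r : 0 < 2 * r := by omega
  have hn1 : n = 0 ∨ r * (2 * n + 1) < D := by
    rcases Nat.eq_zero_or_pos n with h0 | h0
    · exact Or.inl h0
    · right
      have h1 : 2 * r * n ≤ D - 1 - r := Nat.mul_div_le _ _
      have h2 : 0 < 2 * r * n := by positivity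
      have h3 : r * (2 * n + 1) = 2 * r * n + r := by ring
      omega
  have hn2 : D ≤ 2 * r * n + 3 * r := by
    have h1 : D - 1 - r < 2 * r * (n + 1) := Nat.lt_mul_div_succ _ h2r
    have h2 : 2 * r * (n + 1) = 2 * r * n + 2 * r := by ring
    omega
  have h1 := norm_torusMatrix_le hS0 hS hΛ p q (n := n) (hn1.imp_right fun h => ⟨i, h⟩)
  refine h1.trans ?_
  rw [mul_assoc]
  refine mul_le_mul_of_nonneg_left ?_ hC
  rw [← div_eq_inv_mul, le_div_iff₀ (by positivity), ← hωθ, ← pow_mul, ← pow_add]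
  calc ω ^ (8 * r * d * n + 12 * r * d)
      ≤ ω ^ (4 * ∑ j, ringDist Λ (p.1 j) (q.1 j)) := by
        refine pow_le_pow_of_le_one hω0.le hω1.le ?_
        have h3 : ∑ j, ringDist Λ (p.1 j) (q.1 j) ≤ d * D := by
          refine (Finset.sum_le_card_nsmul _ _ D fun j _ => hi j).trans (le_of_eq ?_)
          simp
        calc 4 * ∑ j, ringDist Λ (p.1 j) (q.1 j) ≤ 4 * (d * D) := by omega
          _ ≤ 4 * (d * (2 * r * n + 3 * r)) := by gcongr
          _ = 8 * r * d * n + 12 * r * d := by ring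
    _ = ∏ j, (ω ^ 4) ^ ringDist Λ (p.1 j) (q.1 j) := by
        rw [pow_mul, Finset.prod_pow_eq_pow_sum]
    _ ≤ _ := Finset.prod_le_prod (fun j _ => by positivity)
        fun j _ => pow_ringDist_le (by positivity) _ _ _

end Torus

end FreeFermion

namespace FreeFermion

open Filter Topology MeasureTheory
open scoped ENNReal NNReal

/-! ## The area law for the original orbitals -/

section OrbitalAreaLaw

variable {d N : ℕ}

theorem sum_pow_le {ι : Type*} {ψ : ℝ} (h0 : 0 ≤ ψ) (h1 : ψ < 1) (s : Finset ι) (f : ι → ℕ)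
    (hf : Set.InjOn f s) (m : ℕ) (hm : ∀ j ∈ s, m ≤ f j) :
    ∑ j ∈ s, ψ ^ f j ≤ ψ ^ m * (1 - ψ)⁻¹ := by
  classical
  have hs : HasSum (fun t => ψ ^ m * ψ ^ t) (ψ ^ m * (1 - ψ)⁻¹) :=
    (hasSum_geometric_of_lt_one h0 h1).mul_left _
  have hinj : Set.InjOn (fun j => f j - m) s := by
    intro a ha b hb hab
    have := hm a ha
    have := hm b hb
    refine hf ha hb ?_
    simp only at hab
    omega
  calc ∑ j ∈ s, ψ ^ f j = ∑ j ∈ s, ψ ^ m * ψ ^ (f j - m) :=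
        Finset.sum_congr rfl fun j hj => by rw [← pow_add, Nat.add_sub_cancel' (hm j hj)]
    _ = ∑ t ∈ s.image fun j => f j - m, ψ ^ m * ψ ^ t := by
        rw [Finset.sum_image hinj]
    _ ≤ _ := sum_le_hasSum _ (fun t _ => by positivity) hs

/-- Each of the two exponents is injective on either side of `a`, so four geometric series suffice.
-/
theorem sum_ringKernel_le {ψ : ℝ} (h0 : 0 ≤ ψ) (h1 : ψ < 1) {Λ : ℕ} (a : Fin Λ) :
    ∑ b : Fin Λ, ringKernel ψ Λ a b ≤ 4 * (1 - ψ)⁻¹ := by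
  have hg : 0 < 1 - ψ := by linarith
  have ha := a.2
  have key : ∀ f : Fin Λ → ℕ, (Set.InjOn f {b | b ≤ a}) → (Set.InjOn f {b | ¬ b ≤ a}) →
      ∑ b, ψ ^ f b ≤ 2 * (1 - ψ)⁻¹ := by
    intro f hf1 hf2
    rw [← Finset.sum_filter_add_sum_filter_not Finset.univ (fun b => b ≤ a), two_mul]
    refine add_le_add ?_ ?_
    · simpa using sum_pow_le h0 h1 _ f (by simpa using hf1) 0 fun _ _ => Nat.zero_le _
    · simpa using sum_pow_le h0 h1 _ f (by simpa using hf2) 0 fun _ _ => Nat.zero_le _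
  simp only [ringKernel, Finset.sum_add_distrib]
  have k1 := key (fun b => ((a : ℕ) - b) + (b - a))
    (fun b hb c hc hbc => by
      simp only [Set.mem_ofPred_eq, Fin.le_def] at hb hc hbc
      apply Fin.ext
      omega)
    (fun b hb c hc hbc => by
      simp only [Set.mem_ofPred_eq, Fin.le_def] at hb hc hbc
      apply Fin.ext
      omega)
  have k2 := key (fun b => Λ - (((a : ℕ) - b) + (b - a)))
    (fun b hb c hc hbc => by
      have := b.2
      have := c.2
      simp only [Set.mem_ofPred_eq, Fin.le_def] at hb hc hbc
      apply Fin.ext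
      omega)
    (fun b hb c hc hbc => by
      have := b.2
      have := c.2
      simp only [Set.mem_ofPred_eq, Fin.le_def] at hb hc hbc
      apply Fin.ext
      omega)
  linarith

/-- From `a` the outside is at distance at least `L - a` directly and at least `a + 1` around the
ring, independently of `Λ`. -/
theorem sum_ringKernel_tail_le {ψ : ℝ} (h0 : 0 ≤ ψ) (h1 : ψ < 1) {Λ L a : ℕ} (ha : a < L) :
    ∑ b : Fin Λ, (if L ≤ (b : ℕ) then ringKernel ψ Λ a b else 0) ≤
      (ψ ^ (L - a) + ψ ^ (a + 1)) * (1 - ψ)⁻¹ := by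
  rw [← Finset.sum_filter]
  simp only [ringKernel, Finset.sum_add_distrib, add_mul]
  refine add_le_add ?_ ?_
  · refine sum_pow_le h0 h1 _ _ (fun b hb c hc hbc => ?_) _ fun b hb => ?_
    · simp only [Finset.coe_filter, Finset.mem_univ, true_and, Set.mem_ofPred_eq] at hb hc hbc
      apply Fin.ext
      omega
    · simp only [Finset.mem_filter, Finset.mem_univ, true_and] at hb
      omega
  · refine sum_pow_le h0 h1 _ _ (fun b hb c hc hbc => ?_) _ fun b hb => ?_
    · have := b.2
      have := c.2
      simp only [Finset.coe_filter, Finset.mem_univ, true_and, Set.mem_ofPred_eq] at hb hc hbc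
      apply Fin.ext
      omega
    · have := b.2
      simp only [Finset.mem_filter, Finset.mem_univ, true_and] at hb
      omega

theorem sum_prod_pi {M : ℕ} (g : Fin d → Fin M → ℝ) :
    ∑ x : Fin d → Fin M, ∏ j, g j (x j) = ∏ j, ∑ b, g j b := by
  rw [← Fintype.piFinset_univ, Finset.sum_prod_piFinset Finset.univ g]

theorem sum_prod_ringKernel_le {ψ : ℝ} (h0 : 0 ≤ ψ) (h1 : ψ < 1) {Λ : ℕ} (p : Mode d N Λ) :
    ∑ r : Mode d N Λ, ∏ i, ringKernel ψ Λ (p.1 i) (r.1 i) ≤ N * (4 * (1 - ψ)⁻¹) ^ d := by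
  rw [Fintype.sum_prod_type_right]
  simp only [sum_prod_pi fun i b => ringKernel ψ Λ (p.1 i) (b : Fin Λ)]
  rw [Finset.sum_const, Finset.card_univ, Fintype.card_fin, nsmul_eq_mul]
  refine mul_le_mul_of_nonneg_left ?_ (Nat.cast_nonneg _)
  calc ∏ i, ∑ b, ringKernel ψ Λ (p.1 i) (b : Fin Λ) ≤ ∏ _i : Fin d, 4 * (1 - ψ)⁻¹ :=
        Finset.prod_le_prod (fun i _ => Finset.sum_nonneg fun b _ => ringKernel_nonneg h0 _ _ _)
          fun i _ => sum_ringKernel_le h0 h1 _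
    _ = _ := by simp

/-- A mode outside the cube has some coordinate at least `L`. A union bound over this coordinate
leaves one tail factor, and full ring sums for the other coordinates. -/
theorem sum_prod_ringKernel_tail_le {ψ : ℝ} (h0 : 0 ≤ ψ) (h1 : ψ < 1) {Λ L : ℕ}
    {p : Mode d N Λ} (hp : p ∈ cube d N Λ L) :
    ∑ r : Mode d N Λ with r ∉ cube d N Λ L, ∏ i, ringKernel ψ Λ (p.1 i) (r.1 i) ≤
      N * (4 * (1 - ψ)⁻¹) ^ d * (1 - ψ)⁻¹ *
        ∑ i, (ψ ^ (L - (p.1 i : ℕ)) + ψ ^ ((p.1 i : ℕ) + 1)) := by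
  have hg : 0 < 1 - ψ := by linarith
  set Q := 4 * (1 - ψ)⁻¹ with hQ
  have hQ1 : 1 ≤ Q := by
    have : 1 ≤ (1 - ψ)⁻¹ := (one_le_inv₀ hg).mpr (by linarith)
    rw [hQ]; linarith
  have hpL : ∀ i, (p.1 i : ℕ) < L := by
    simpa [cube] using hp
  have hw0 : ∀ r : Mode d N Λ, 0 ≤ ∏ i, ringKernel ψ Λ (p.1 i) (r.1 i) := fun r =>
    Finset.prod_nonneg fun i _ => ringKernel_nonneg h0 _ _ _
  have hstep : ∀ i : Fin d, ∑ r : Mode d N Λ,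
      (if L ≤ (r.1 i : ℕ) then ∏ i, ringKernel ψ Λ (p.1 i) (r.1 i) else 0) ≤
        N * Q ^ d * (1 - ψ)⁻¹ * (ψ ^ (L - (p.1 i : ℕ)) + ψ ^ ((p.1 i : ℕ) + 1)) := by
    intro i
    set g : Fin d → Fin Λ → ℝ := fun j b =>
      if j = i then (if L ≤ (b : ℕ) then ringKernel ψ Λ (p.1 j) b else 0)
      else ringKernel ψ Λ (p.1 j) b with hg'
    have hg0 : ∀ j b, 0 ≤ g j b := by
      intro j b
      simp only [hg']
      have := ringKernel_nonneg h0 Λ (p.1 j) b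
      split_ifs <;> first | exact le_rfl | exact this
    have e1 : ∀ r : Mode d N Λ,
        (if L ≤ (r.1 i : ℕ) then ∏ i, ringKernel ψ Λ (p.1 i) (r.1 i) else 0) =
          ∏ j, g j (r.1 j) := by
      intro r
      split_ifs with h
      · refine Finset.prod_congr rfl fun j _ => ?_
        simp only [hg']
        split_ifs with h2 h3
        · rfl
        · subst h2; exact absurd h h3
        · rfl
      · refine (Finset.prod_eq_zero (Finset.mem_univ i) ?_).symm
        simp [hg', h]
    simp only [e1]
    rw [Fintype.sum_prod_type_right]
    simp only [sum_prod_pi g]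
    rw [Finset.sum_const, Finset.card_univ, Fintype.card_fin, nsmul_eq_mul, mul_assoc, mul_assoc]
    refine mul_le_mul_of_nonneg_left ?_ (Nat.cast_nonneg _)
    rw [← Finset.mul_prod_erase _ _ (Finset.mem_univ i), mul_comm]
    refine mul_le_mul ?_ ?_ (Finset.sum_nonneg fun b _ => hg0 _ _) (by positivity)
    · calc ∏ j ∈ Finset.univ.erase i, ∑ b, g j b ≤ ∏ j ∈ Finset.univ.erase i, Q := by
            refine Finset.prod_le_prod (fun j _ => Finset.sum_nonneg fun b _ => hg0 _ _)
              fun j hj => ?_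
            simp only [hg', if_neg (Finset.ne_of_mem_erase hj)]
            exact sum_ringKernel_le h0 h1 _
        _ = Q ^ (Finset.univ.erase i).card := by rw [Finset.prod_const]
        _ ≤ Q ^ d := by
            refine pow_le_pow_right₀ hQ1 ((Finset.card_le_univ _).trans ?_)
            simp
    · simp only [hg', if_true]
      rw [mul_comm]
      exact sum_ringKernel_tail_le h0 h1 (hpL i)
  calc ∑ r : Mode d N Λ with r ∉ cube d N Λ L, ∏ i, ringKernel ψ Λ (p.1 i) (r.1 i)
      ≤ ∑ r : Mode d N Λ, ∑ i : Fin d,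
          (if L ≤ (r.1 i : ℕ) then ∏ i, ringKernel ψ Λ (p.1 i) (r.1 i) else 0) := by
        rw [Finset.sum_filter]
        refine Finset.sum_le_sum fun r _ => ?_
        have hnn : ∀ i : Fin d, 0 ≤
            (if L ≤ (r.1 i : ℕ) then ∏ i, ringKernel ψ Λ (p.1 i) (r.1 i) else 0) := fun i => by
          split_ifs
          exacts [hw0 r, le_rfl]
        split_ifs with h
        · exact Finset.sum_nonneg fun i _ => hnn i
        · obtain ⟨i, hi⟩ : ∃ i, L ≤ (r.1 i : ℕ) := by simpa [cube] using h
          refine le_trans ?_ (Finset.single_le_sum (fun i _ => hnn i) (Finset.mem_univ i))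
          rw [if_pos hi]
    _ = ∑ i : Fin d, ∑ r : Mode d N Λ,
          (if L ≤ (r.1 i : ℕ) then ∏ i, ringKernel ψ Λ (p.1 i) (r.1 i) else 0) :=
        Finset.sum_comm
    _ ≤ _ := by
        rw [Finset.mul_sum]
        exact Finset.sum_le_sum fun i _ => hstep i

/-- The coordinate normal to a face sums to a geometric series, and the remaining `d - 1`
coordinates give `L^(d-1)`. -/
theorem sum_cube_boundary_le {ω : ℝ} (h0 : 0 ≤ ω) (h1 : ω < 1) {Λ L : ℕ} (h : L ≤ Λ) :
    ∑ p : {p // p ∈ cube d N Λ L},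
      ∑ i, (ω ^ (L - (p.1.1 i : ℕ)) + ω ^ ((p.1.1 i : ℕ) + 1)) ≤
        N * d * (2 * (1 - ω)⁻¹) * (L : ℝ) ^ (d - 1) := by
  have hg : 0 < 1 - ω := by linarith
  rw [← (cubeEquiv h).sum_comp, Finset.sum_comm]
  have hstep : ∀ i : Fin d, ∑ p : (Fin d → Fin L) × Fin N,
      (ω ^ (L - ((cubeEquiv h p).1.1 i : ℕ)) + ω ^ (((cubeEquiv h p).1.1 i : ℕ) + 1)) ≤
        N * (2 * (1 - ω)⁻¹) * (L : ℝ) ^ (d - 1) := by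
    intro i
    set f : Fin L → ℝ := fun b => ω ^ (L - (b : ℕ)) + ω ^ ((b : ℕ) + 1) with hf
    have hfs : ∑ b, f b ≤ 2 * (1 - ω)⁻¹ := by
      simp only [hf, Finset.sum_add_distrib, two_mul]
      refine add_le_add ?_ ?_
      · simpa using sum_pow_le h0 h1 Finset.univ (fun b : Fin L => L - (b : ℕ))
          (fun b _ c _ hbc => by
            have := b.2
            have := c.2
            simp only at hbc
            apply Fin.ext
            omega) 0 fun _ _ => Nat.zero_le _
      · simpa using sum_pow_le h0 h1 Finset.univ (fun b : Fin L => (b : ℕ) + 1)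
          (fun b _ c _ hbc => by
            simp only at hbc
            apply Fin.ext
            omega) 0 fun _ _ => Nat.zero_le _
    have e1 : ∀ x : Fin d → Fin L, f (x i) = ∏ j, if j = i then f (x j) else 1 := fun x => by
      rw [Finset.prod_ite_eq' Finset.univ i fun j => f (x j), if_pos (Finset.mem_univ i)]
    have e2 : ∑ x : Fin d → Fin L, f (x i) = (∑ b, f b) * (L : ℝ) ^ (d - 1) := by
      simp only [e1]
      rw [sum_prod_pi fun j b => if j = i then f b else 1,
        ← Finset.mul_prod_erase _ _ (Finset.mem_univ i)]
      congr 1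
      · simp
      · rw [Finset.prod_congr rfl fun j hj => by
          rw [Finset.sum_congr rfl fun b _ => if_neg (Finset.ne_of_mem_erase hj)]]
        simp [Finset.card_erase_of_mem]
    change ∑ p : (Fin d → Fin L) × Fin N, f (p.1 i) ≤ _
    rw [Fintype.sum_prod_type_right]
    simp only [e2]
    rw [Finset.sum_const, Finset.card_univ, Fintype.card_fin, nsmul_eq_mul, mul_assoc]
    gcongr
  refine (Finset.sum_le_sum fun i _ => hstep i).trans (le_of_eq ?_)
  rw [Finset.sum_const, Finset.card_univ, Fintype.card_fin, nsmul_eq_mul]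
  ring

theorem sum_pow_four_le {ι : Type*} (s : Finset ι) (f : ι → ℝ) (hf : ∀ i ∈ s, 0 ≤ f i) :
    ∑ i ∈ s, f i ^ 4 ≤ (∑ i ∈ s, f i) ^ 4 := by
  have h0 : 0 ≤ ∑ i ∈ s, f i := Finset.sum_nonneg hf
  calc ∑ i ∈ s, f i ^ 4 = ∑ i ∈ s, f i * f i ^ 3 := Finset.sum_congr rfl fun i _ => by ring
    _ ≤ ∑ i ∈ s, f i * (∑ i ∈ s, f i) ^ 3 := by
        refine Finset.sum_le_sum fun i hi => mul_le_mul_of_nonneg_left ?_ (hf i hi)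
        exact pow_le_pow_left₀ (hf i hi) (Finset.single_le_sum hf hi) 3
    _ = _ := by rw [← Finset.sum_mul]; ring

/-- Since `G² = 1` on the torus, `1 - γ²` contains only paths that leave the cube and return, so its
row sums decay like powers of `ψ = ω⁴` in the distance to the faces. Such row sums are fourth powers
of a boundary function with rate `ω`, as the entropy bound requires. -/
theorem IsGappedUnbroken.orbital_area_law {H : LocalPTHamiltonian d N}
    {E : Fin N → Momentum d → ℂ} (hd : 0 < d) (h : IsGappedUnbroken H E)
    {P : Momentum d → Matrix (Fin N) (Fin N) ℂ}
    (hP : ∀ k, IsNegativeProjection (H.bloch k) (P k)) :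
    ∃ C : ℝ, ∀ Λ L : ℕ, 1 ≤ L → L ≤ Λ → ‖orbitalEntropy P Λ L‖ ≤ C * (L : ℝ) ^ (d - 1) := by
  obtain ⟨K, ω, hK, hω0, hω1, hdecay⟩ := h.exists_decay hd hP
  set ψ := ω ^ 4 with hψ
  have hψ0 : 0 ≤ ψ := by positivity
  have hψ1 : ψ < 1 := pow_lt_one₀ hω0.le hω1 (by norm_num)
  have hgψ : 0 < 1 - ψ := by linarith
  set Q := 4 * (1 - ψ)⁻¹ with hQ
  set B := K * (N * Q ^ d) with hB
  have hB0 : 0 ≤ B := by positivity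
  set R := B * (K * (N * Q ^ d * (1 - ψ)⁻¹)) with hR
  have hR0 : 0 ≤ R := by positivity
  -- The maximum with 1 gives `R ≤ R'^4`, which moves the prefactor inside the fourth power.
  set R' := max 1 R with hR'
  have hR'1 : 1 ≤ R' := le_max_left _ _
  have hRR' : R ≤ R' ^ 4 := (le_max_right 1 R).trans (le_self_pow₀ hR'1 (by norm_num))
  obtain ⟨C, hC, hmain⟩ := exists_norm_sum_entropyFunction_le (B := B)
  refine ⟨C * (R' * (N * d * (2 * (1 - ω)⁻¹))), fun Λ L hL hLΛ => ?_⟩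
  have hΛ : 0 < Λ := by omega
  set G := torusMatrix (fun k => 1 - (2 : ℂ) • P k) Λ with hG
  have hGrow : ∀ p, ∑ r, ‖G p r‖ ≤ B := by
    intro p
    refine (Finset.sum_le_sum fun r _ => hdecay Λ p r hΛ).trans ?_
    rw [← Finset.mul_sum]
    exact mul_le_mul_of_nonneg_left (sum_prod_ringKernel_le hψ0 hψ1 p) hK
  have hGG : G * G = 1 := by
    rw [hG, torusMatrix_mul hΛ, ← torusMatrix_one hΛ]
    congr 1
    ext1 k
    have h2 : (1 - (2 : ℂ) • P k) * (1 - (2 : ℂ) • P k) =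
        1 - (4 : ℂ) • P k + (4 : ℂ) • (P k * P k) := by
      rw [sub_mul, one_mul, mul_sub, mul_one, smul_mul_smul_comm]
      module
    rw [h2, (hP k).idempotent]
    simp
  set γ := orbitalCorrelation P Λ L with hγ
  have hγG : ∀ p q, γ p q = G p q := orbitalCorrelation_eq hΛ P
  set s : {p // p ∈ cube d N Λ L} → ℝ := fun p =>
    R' * ∑ i, (ω ^ (L - (p.1.1 i : ℕ)) + ω ^ ((p.1.1 i : ℕ) + 1)) with hs
  have hs0 : ∀ p, 0 ≤ s p := fun p => by positivity
  have hsub : ∀ (f : Mode d N Λ → ℝ), (∀ r, 0 ≤ f r) →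
      ∑ r : {p // p ∈ cube d N Λ L}, f r ≤ ∑ r, f r := by
    intro f hf
    rw [Finset.sum_coe_sort (cube d N Λ L) f]
    exact Finset.sum_le_sum_of_subset_of_nonneg (Finset.subset_univ _) fun r _ _ => hf r
  have h1 : ∀ p, ∑ q, ‖γ p q‖ ≤ B := by
    intro p
    simp only [hγG]
    exact (hsub (fun r => ‖G p r‖) fun r => norm_nonneg _).trans (hGrow p)
  have hdefect : ∀ p q, (1 - γ * γ) p q =
      ∑ r : Mode d N Λ with r ∉ cube d N Λ L, G p r * G r q := by
    intro p q
    have e1 : (1 : Matrix {p // p ∈ cube d N Λ L} {p // p ∈ cube d N Λ L} ℂ) p q =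
        (1 : Matrix (Mode d N Λ) (Mode d N Λ) ℂ) p q := by
      simp only [Matrix.one_apply, Subtype.ext_iff]
    rw [Matrix.sub_apply, e1, ← hGG, Matrix.mul_apply, Matrix.mul_apply]
    simp only [hγG]
    rw [Finset.sum_coe_sort (cube d N Λ L) fun r => G p r * G r q, sub_eq_iff_eq_add,
      ← Finset.sum_filter_add_sum_filter_not Finset.univ (fun r => r ∉ cube d N Λ L)]
    congr 1
    refine Finset.sum_congr ?_ fun _ _ => rfl
    ext r
    simp
  have h2 : ∀ p, ∑ q, ‖(1 - γ * γ) p q‖ ≤ s p ^ 4 := by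
    intro p
    calc ∑ q, ‖(1 - γ * γ) p q‖
        ≤ ∑ q : {p // p ∈ cube d N Λ L}, ∑ r : Mode d N Λ with r ∉ cube d N Λ L,
            ‖G p r‖ * ‖G r q‖ := by
          refine Finset.sum_le_sum fun q _ => ?_
          rw [hdefect]
          refine (norm_sum_le _ _).trans (le_of_eq (Finset.sum_congr rfl fun r _ => norm_mul _ _))
      _ = ∑ r : Mode d N Λ with r ∉ cube d N Λ L, ‖G p r‖ *
            ∑ q : {p // p ∈ cube d N Λ L}, ‖G r q‖ := by
          rw [Finset.sum_comm]
          simp only [Finset.mul_sum]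
      _ ≤ ∑ r : Mode d N Λ with r ∉ cube d N Λ L,
            (K * ∏ i, ringKernel ψ Λ (p.1.1 i) (r.1 i)) * B := by
          refine Finset.sum_le_sum fun r _ => ?_
          refine mul_le_mul (hdecay Λ p r hΛ) ?_ (Finset.sum_nonneg fun q _ => norm_nonneg _) ?_
          · exact (hsub (fun q => ‖G r q‖) fun q => norm_nonneg _).trans (hGrow r)
          · exact mul_nonneg hK (Finset.prod_nonneg fun i _ => ringKernel_nonneg hψ0 _ _ _)
      _ = B * (K * ∑ r : Mode d N Λ with r ∉ cube d N Λ L,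
            ∏ i, ringKernel ψ Λ (p.1.1 i) (r.1 i)) := by
          rw [← Finset.sum_mul, ← Finset.mul_sum, mul_comm]
      _ ≤ B * (K * (N * Q ^ d * (1 - ψ)⁻¹ *
            ∑ i, (ψ ^ (L - (p.1.1 i : ℕ)) + ψ ^ ((p.1.1 i : ℕ) + 1)))) := by
          have := sum_prod_ringKernel_tail_le hψ0 hψ1 p.2
          gcongr
      _ = R * ∑ i, (ψ ^ (L - (p.1.1 i : ℕ)) + ψ ^ ((p.1.1 i : ℕ) + 1)) := by
          rw [hR]; ring
      _ ≤ R' ^ 4 * (∑ i, (ω ^ (L - (p.1.1 i : ℕ)) + ω ^ ((p.1.1 i : ℕ) + 1))) ^ 4 := by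
          refine mul_le_mul hRR' ?_ (by positivity) (by positivity)
          refine le_trans (Finset.sum_le_sum fun i _ => ?_)
            (sum_pow_four_le Finset.univ _ fun i _ => by positivity)
          rw [hψ, ← pow_mul, ← pow_mul, mul_comm 4, mul_comm 4, pow_mul, pow_mul]
          have := sum_pow_four_le Finset.univ ![ω ^ (L - (p.1.1 i : ℕ)), ω ^ ((p.1.1 i : ℕ) + 1)]
            fun j _ => by fin_cases j <;> simp <;> positivity
          simpa [Fin.sum_univ_two] using this
      _ = s p ^ 4 := by rw [hs, mul_pow]
  refine (hmain γ s h1 hs0 h2).trans ?_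
  rw [mul_assoc C]
  refine mul_le_mul_of_nonneg_left ?_ hC
  rw [hs, ← Finset.mul_sum, mul_assoc R']
  exact mul_le_mul_of_nonneg_left (sum_cube_boundary_le hω0.le hω1 hLΛ) (by positivity)

end OrbitalAreaLaw

end FreeFermion

theorem mainTheorem2 {d N : ℕ} (hd : 0 < d) {X : Type*} [TopologicalSpace X]
    (H : X → FreeFermion.LocalPTHamiltonian d N)
    (E : X → Fin N → FreeFermion.Momentum d → ℂ) :
    (∀ s, FreeFermion.IsGaplessBroken (H s) (E s) →
      FreeFermion.HasYangLeeZeroAtAbsoluteZero (H s) ∧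
      0 < FreeFermion.cMinus d (FreeFermion.fermiArea (E s)) ∧
      ∃ S : ℕ → ℝ,
        (∀ L, Filter.Tendsto (fun Λ => FreeFermion.groundEntropy (E s) Λ L) Filter.atTop
          (nhds (S L : ℂ))) ∧
        (∀ᶠ L : ℕ in Filter.atTop,
          FreeFermion.cMinus d (FreeFermion.fermiArea (E s)) * (L : ℝ) ^ (d - 1) * Real.log L
            < S L) ∧
        (∀ A : ℝ, (∀ α : Fin N, α < Fin.rev α → A ≤ FreeFermion.ringArea (E s) α) →
          ∀ᶠ L : ℕ in Filter.atTop,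
            ((N / 2 : ℕ) : ℝ) * FreeFermion.cMinus d A * (L : ℝ) ^ (d - 1) * Real.log L
              < S L)) ∧
    (∀ s, FreeFermion.IsGappedUnbroken (H s) (E s) →
      (∀ β : ℝ, ¬ FreeFermion.HasYangLeeZero (H s) β) ∧
      (∃ C : ℝ, ∀ Λ L : ℕ, 1 ≤ L → L ≤ Λ →
        ‖FreeFermion.groundEntropy (E s) Λ L‖ ≤ C * (L : ℝ) ^ (d - 1)) ∧
      (∀ P : FreeFermion.Momentum d → Matrix (Fin N) (Fin N) ℂ,
        (∀ k, FreeFermion.IsNegativeProjection ((H s).bloch k) (P k)) →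
        ∃ C : ℝ, ∀ Λ L : ℕ, 1 ≤ L → L ≤ Λ →
          ‖FreeFermion.orbitalEntropy P Λ L‖ ≤ C * (L : ℝ) ^ (d - 1))) ∧
    (FreeFermion.phaseSet H E ∩ FreeFermion.zeroSet H =
        FreeFermion.phaseSet H E ∩ FreeFermion.violationSet E ∧
      FreeFermion.transitionPoints (FreeFermion.phaseSet H E) (FreeFermion.zeroSet H) =
        FreeFermion.transitionPoints (FreeFermion.phaseSet H E)
          (FreeFermion.violationSet E)) := by
  refine ⟨fun s hs => ?_, fun s hs => ?_, ?_, ?_⟩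
  · have hA := hs.fermiArea_pos hd
    refine ⟨hs.hasYangLeeZeroAtAbsoluteZero, FreeFermion.cMinus_pos hd hA,
      FreeFermion.limitEntropy (E s), hs.tendsto_groundEntropy hd,
      hs.eventually_lt_limitEntropy hd (FreeFermion.cMinus_lt hA), fun A hA' => ?_⟩
    exact hs.eventually_lt_limitEntropy hd
      ((FreeFermion.mul_cMinus_le hA').trans_lt (FreeFermion.cMinus_lt hA))
  -- The constant 0 serves in the band basis, where the entropy vanishes identically.
  · refine ⟨hs.not_hasYangLeeZero, ⟨0, fun Λ L h1 h2 => ?_⟩, fun P hP => ?_⟩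
    · rw [hs.groundEntropy_eq_zero (by omega) h2]
      simp
    · exact hs.orbital_area_law hd hP
  · exact FreeFermion.phaseSet_inter_zeroSet hd H E
  · exact FreeFermion.transitionPoints_congr (FreeFermion.phaseSet_inter_zeroSet hd H E)
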